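/- Let $G$ be a finite loopless multigraph with vertex set $V(G)$ and edge set $E(G)$, and let $L : E(G) \to 2^{\mathbb N}$ be a list assignment on its edges. For $x \in V(G)$ let $E_G(x)$ be the set of edges incident to $x$, $\deg(x) = |E_G(x)|$, let $\mu(x,z)$ be the number of edges between $x$ and $z$, $\mu(x) = \max_z \mu(x,z)$, and $$f(x,L) = \bigcap_{e \in E_G(x)} L(e).$$ A proper $L$-edge-coloring is a map $\phi : E(G) \to \mathbb N$ with $\phi(e) \in L(e)$ for every edge $e$ and $\phi(e) \ne \phi(e')$ for any two distinct edges $e, e'$ with a common end. Consider the three conditions 1. (local Shannon) $|f(x,L)| \ge \lfloor 3\deg(x)/2 \rfloor$ for every $x \in V(G)$; 2. (local Vizing) $|f(x,L)| \ge \deg(x) + \mu(x)$ for every $x \in V(G)$; 3. (local König) $G$ is bipartite and $|f(x,L)| \ge \deg(x)$ for every $x \in V(G)$. If any one of them holds, then $G$ has a proper $L$-edge-coloring. Moreover, let $\Delta$ be the maximum degree and $n$ the number of vertices of $G$. For each of the three conditions there is an algorithm such that, for every polynomial $p$ in two variables with coefficients in $\mathbb{N}$, there is a polynomial $q$ in two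 variables with coefficients in $\mathbb{N}$ with the following property: for every pair $(G, L)$ that satisfies the condition and has $|f(x,L)| \le p(\Delta,n)$ for each non-isolated vertex $x$, the algorithm on input $(G,L)$ outputs a proper $L$-edge-coloring after at most $q(\Delta,n)$ steps. Here an algorithm is a program for a random access machine with arrays of natural numbers, in which tests and assignments (with addition and truncated subtraction) cost one step each; the input consists of $n$, $|E(G)|$, the ends of each edge, and, for each edge $e$, an array that enumerates $L(e)$ without repetitions in any order and indicates where the list ends if $L(e)$ is finite. -/

import Mathlib

namespace Graph

variable {α β : Type*}

/-- The degree of a vertex: the number of edges incident to it. -/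
noncomputable def deg (G : Graph α β) (x : α) : ℕ := (G.incidenceSet x).ncard

/-- The multiplicity `μ(x, y)`: the number of edges between `x` and `y`. -/
noncomputable def mult (G : Graph α β) (x y : α) : ℕ := {e | G.IsLink e x y}.ncard

/-- The local multiplicity `μ(x) = max_z μ(x, z)` (in a finite graph the supremum is a maximum, and
it does not matter that `z` also ranges over non-vertices, for which `μ(x, z) = 0`). -/
noncomputable def localMult (G : Graph α β) (x : α) : ℕ := ⨆ z, G.mult x z

/-- The maximum degree `Δ` of a finite graph (elements of `α` outside `V(G)` have degree `0`). -/
noncomputable def maxDeg (G : Graph α β) : ℕ := ⨆ x, G.deg x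

/-- A graph is bipartite if its vertices can be split into two classes such that every edge has
one end in each class. -/
def IsBipartite (G : Graph α β) : Prop :=
  ∃ A : Set α, ∀ e x y, G.IsLink e x y → (x ∈ A ↔ y ∉ A)

/-- `f(x, L)`: the set of the colors common to the lists of all edges at `x`. -/
def commonColors (G : Graph α β) (L : β → Set ℕ) (x : α) : Set ℕ :=
  ⋂ e ∈ G.incidenceSet x, L e

/-- `φ` is a proper `L`-edge-coloring of `G`: each edge gets a color of its list, and distinct edges
with a common end get distinct colors. Values of `φ` outside `E(G)` are irrelevant. -/
structure IsProperListColoring (G : Graph α β) (L : β → Set ℕ) (φ : β → ℕ) : Prop where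
  mem_list : ∀ e ∈ G.edgeSet, φ e ∈ L e
  proper : ∀ e e' x, e ≠ e' → G.Inc e x → G.Inc e' x → φ e ≠ φ e'

/-- The local Shannon condition `|f(x, L)| ≥ ⌊3 deg(x) / 2⌋` for all vertices `x`. -/
def ShannonCondition (G : Graph α β) (L : β → Set ℕ) : Prop :=
  ∀ x ∈ G.vertexSet, ((3 * G.deg x / 2 : ℕ) : ℕ∞) ≤ (G.commonColors L x).encard

/-- The local Vizing condition `|f(x, L)| ≥ deg(x) + μ(x)` for all vertices `x`. -/
def VizingCondition (G : Graph α β) (L : β → Set ℕ) : Prop :=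
  ∀ x ∈ G.vertexSet, ((G.deg x + G.localMult x : ℕ) : ℕ∞) ≤ (G.commonColors L x).encard

/-- The local König condition: `G` is bipartite and `|f(x, L)| ≥ deg(x)` for all vertices `x`. -/
def KonigCondition (G : Graph α β) (L : β → Set ℕ) : Prop :=
  G.IsBipartite ∧ ∀ x ∈ G.vertexSet, (G.deg x : ℕ∞) ≤ (G.commonColors L x).encard

end Graph

/-! A random access machine with unit-cost instructions, programmed in a structured language. The
arithmetic is restricted to addition and truncated subtraction, so that the numbers it computes
cannot grow by more than a constant factor in a step. -/

namespace RAM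

/-- The memory: a collection of two-dimensional arrays of natural numbers;
`s a i j` is the content of the cell `(i, j)` of the array number `a`. -/
abbrev Mem : Type := ℕ → ℕ → ℕ → ℕ

/-- Arithmetic expressions: constants, reading of a memory cell whose indices are themselves
computed (the number of the array is fixed by the program), addition, and truncated subtraction. -/
inductive Exp : Type
  | lit (k : ℕ) : Exp
  | read (a : ℕ) (i j : Exp) : Exp
  | add (x y : Exp) : Exp
  | sub (x y : Exp) : Exp

/-- The value of an expression. -/
def Exp.eval (s : Mem) : Exp → ℕ
  | .lit k => k
  | .read a i j => s a (i.eval s) (j.eval s)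
  | .add x y => x.eval s + y.eval s
  | .sub x y => x.eval s - y.eval s

/-- Programs. A test succeeds if the value of the expression is not zero. -/
inductive Prog : Type
  | skip : Prog
  | assign (a : ℕ) (i j x : Exp) : Prog
  | seq (P Q : Prog) : Prog
  | cond (b : Exp) (P Q : Prog) : Prog
  | loop (b : Exp) (P : Prog) : Prog

/-- The memory after writing the number `v` into the cell `(i, j)` of the array `a`. -/
def Mem.write (s : Mem) (a i j v : ℕ) : Mem :=
  fun a' i' j' => if a' = a ∧ i' = i ∧ j' = j then v else s a' i' j'

/-- `Runs P s t s'`: started with the memory `s`, the program `P` halts after exactly `t` steps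
with the memory `s'`. Each `skip`, each assignment and each evaluation of a test is one step (the
size of the expressions is bounded by a constant of the program). -/
inductive Runs : Prog → Mem → ℕ → Mem → Prop
  | skip (s : Mem) : Runs .skip s 1 s
  | assign (a : ℕ) (i j x : Exp) (s : Mem) :
      Runs (.assign a i j x) s 1 (s.write a (i.eval s) (j.eval s) (x.eval s))
  | seq {P Q : Prog} {s s' s'' : Mem} {t t' : ℕ} :
      Runs P s t s' → Runs Q s' t' s'' → Runs (.seq P Q) s (t + t') s''
  | cond_true {b : Exp} {P Q : Prog} {s s' : Mem} {t : ℕ} :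
      b.eval s ≠ 0 → Runs P s t s' → Runs (.cond b P Q) s (1 + t) s'
  | cond_false {b : Exp} {P Q : Prog} {s s' : Mem} {t : ℕ} :
      b.eval s = 0 → Runs Q s t s' → Runs (.cond b P Q) s (1 + t) s'
  | loop_true {b : Exp} {P : Prog} {s s' s'' : Mem} {t t' : ℕ} :
      b.eval s ≠ 0 → Runs P s t s' → Runs (.loop b P) s' t' s'' →
      Runs (.loop b P) s (1 + t + t') s''
  | loop_false {b : Exp} {P : Prog} {s : Mem} :
      b.eval s = 0 → Runs (.loop b P) s 1 s

/-- The row `r` lists the elements of the (finite or infinite) set `S` without repetitions, in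
any order: the entry for the color `c` is `c + 1`, and all entries after the end of the list are
`0`. -/
structure ListsSet (r : ℕ → ℕ) (S : Set ℕ) : Prop where
  mem_iff : ∀ c, c ∈ S ↔ ∃ j, r j = c + 1
  nodup : ∀ i j, r i ≠ 0 → r i = r j → i = j
  zero_of_le : ∀ i j, i ≤ j → r i = 0 → r j = 0

/-- The memory `s` holds the input `(G, L)`, where `G` has the vertices `0, …, n - 1` and the edges
`0, …, m - 1`. The array `0` holds `n` and `m`, the array `1` holds the ends of the edges, and the
row `e` of the array `2` lists the colors in `L e`. The arrays from `3` on are blank. (The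
remaining cells of the three input arrays may hold anything.) -/
structure Encodes (s : Mem) (n m : ℕ) (G : Graph ℕ ℕ) (L : ℕ → Set ℕ) : Prop where
  vertexSet_eq : G.vertexSet = Set.Iio n
  edgeSet_eq : G.edgeSet = Set.Iio m
  card_vertices : s 0 0 0 = n
  card_edges : s 0 0 1 = m
  ends : ∀ e < m, G.IsLink e (s 1 e 0) (s 1 e 1)
  lists : ∀ e < m, ListsSet (s 2 e) (L e)
  blank : ∀ a i j, 3 ≤ a → s a i j = 0

/-- There is an algorithm that computes proper `L`-edge-colorings, in time polynomial in `Δ` and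
`n`, of all finite loopless multigraphs `G` with `n` vertices and maximum degree `Δ` and all list
assignments `L` that satisfy the condition `H` and for which the sizes of the sets `f(x, L)` are
bounded by a polynomial in `Δ` and `n`. The color of the edge `e` is written into the cell `(e, 0)`
of the array `3`. The bound on `|f(x, L)|` is required only at vertices with an incident edge: at an
isolated vertex the intersection is over the empty family. -/
def PolyTimeColoring (H : Graph ℕ ℕ → (ℕ → Set ℕ) → Prop) : Prop :=
  ∃ P : Prog, ∀ p : MvPolynomial (Fin 2) ℕ, ∃ q : MvPolynomial (Fin 2) ℕ,
    ∀ (n m : ℕ) (G : Graph ℕ ℕ) (L : ℕ → Set ℕ) (s : Mem),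
      G.Loopless → Encodes s n m G L → H G L →
      (∀ x ∈ G.vertexSet, (G.incidenceSet x).Nonempty →
        (G.commonColors L x).encard ≤ (MvPolynomial.eval ![G.maxDeg, n] p : ℕ)) →
      ∃ (t : ℕ) (s' : Mem), Runs P s t s' ∧ t ≤ MvPolynomial.eval ![G.maxDeg, n] q ∧
        G.IsProperListColoring L (fun e => s' 3 e 0)

end RAM

/-!
A partial coloring is improved by local search until no uncolored edge is left. Call an edge *short*
if its list has fewer colors than the graph has edges. The other edges can be colored greedily at
the end, so the search deals with the short edges only, and with finitely many colors at each
vertex.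

The search considers proper colorings of some of the short edges in which the color of each edge is
common at one of its ends, that is, contained in the lists of all short edges there. It maximizes
first the number `Inst.Phi` of pairs of a vertex `v` and a colored edge at `v` whose color is common
at `v`, and then the sum `Inst.Psi` of the degrees of the ends of the colored edges. A move colors
an uncolored edge with a color free at one end; if another edge at the other end has this color,
then that edge loses its color and is the next to be colored. In this way one runs through fans,
along Kempe chains, and along chains that branch off from fans. Each coloring on the way counts as a
neighbor in the local search. This deals with the difficulty that a Kempe chain may lead to a vertex
where one of its colors is not common: when that happens, the coloring reached just before already
has a larger `Inst.Phi` than the initial one, since along the chain the value of `Inst.Phi` stays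
constant if one adds to it the two contributions that the chain expects at the ends of its uncolored
edge. Hence in a local maximum such a chain can fail to improve the coloring only by returning to
the other end of the uncolored edge where it started, as in the classical arguments
(`Inst.exists_walk_return`). Therefore the classical proofs of the theorems of König, Shannon and
Vizing apply at a local maximum and show that all short edges are colored (`Inst.LocalMax.ne_zero`):
by parity for König, by counting the colors missing at three vertices for Shannon, where `Psi`
guarantees that the third vertex has a large degree, and by fans for Vizing.

All values of the score are bounded by a polynomial in the number of edges, and a round of the
search tries polynomially many moves, so that the search takes polynomial time. A program for it is
verified with a calculus of total correctness (`RAM.Does`) in which the running time is bounded by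
the structure of the program, given a bound for the number of times each loop is executed. The
existence of the colorings for arbitrary graphs follows by running the program on a numbered copy of
the graph.
-/

/-! ### Instances, partial colorings, and the score -/

/-- A multigraph with vertices `0, …, n - 1` and edges `0, …, m - 1`, given by the ends of each
edge, together with lists of colors. As in `RAM.Encodes` the color `c` is stored as `c + 1`, so that
`0` means no color; throughout, colors are handled in this shifted form. -/
structure Inst where
  n : ℕ
  m : ℕ
  ends : ℕ → ℕ → ℕ
  lst : ℕ → ℕ → ℕ
  ends_lt : ∀ e < m, ends e 0 < n ∧ ends e 1 < n
  ends_ne : ∀ e < m, ends e 0 ≠ ends e 1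

namespace Inst

variable (I : Inst)

/-- The vertex `v` is an end of the edge `e`. -/
abbrev Inc (e v : ℕ) : Prop := I.ends e 0 = v ∨ I.ends e 1 = v

/-- The end of `e` other than `v`, computed arithmetically. It is meaningful only if `v` is an end
of `e`. -/
def other (e v : ℕ) : ℕ := I.ends e 0 + I.ends e 1 - v

variable {I} in
theorem inc_lt {e v : ℕ} (he : e < I.m) (h : I.Inc e v) : v < I.n := by
  have := I.ends_lt e he
  rcases h with h | h <;> omega

variable {I} in
theorem inc_other {e v : ℕ} (h : I.Inc e v) : I.Inc e (I.other e v) := by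
  unfold Inst.Inc Inst.other at *
  omega

variable {I} in
theorem other_ne {e v : ℕ} (he : e < I.m) (h : I.Inc e v) : I.other e v ≠ v := by
  have := I.ends_ne e he
  unfold Inst.Inc Inst.other at *
  omega

variable {I} in
theorem other_other {e v : ℕ} (h : I.Inc e v) : I.other e (I.other e v) = v := by
  unfold Inst.Inc Inst.other at *
  omega

variable {I} in
theorem eq_or_eq_other {e v w : ℕ} (h : I.Inc e v) (hw : I.Inc e w) :
    w = v ∨ w = I.other e v := by
  unfold Inst.Inc Inst.other at *
  omega

variable {I} in
theorem other_eq {e v w : ℕ} (h : I.Inc e v) (hw : I.Inc e w) (hvw : v ≠ w) :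
    I.other e v = w := by
  rcases eq_or_eq_other h hw with h | h
  · exact absurd h.symm hvw
  · exact h.symm

/-- The list of `e` has fewer than `m` colors. The other edges can be colored greedily after the
short ones. (For `m = 0` there are no edges, and the truncated index does not matter.) -/
def IsShort (e : ℕ) : Prop := I.lst e (I.m - 1) = 0

instance (e : ℕ) : Decidable (I.IsShort e) := inferInstanceAs (Decidable (_ = _))

/-- The number of edges at `v`. -/
def deg (v : ℕ) : ℕ := ((Finset.range I.m).filter fun e => I.Inc e v).card

/-- The number of edges between `v` and `w`, for `v ≠ w`. -/
def mult (v w : ℕ) : ℕ := ((Finset.range I.m).filter fun e => I.Inc e v ∧ I.Inc e w).card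

/-- All colors among the first `m` entries of the lists. -/
def palette : Finset ℕ :=
  ((Finset.range I.m ×ˢ Finset.range I.m).image fun p => I.lst p.1 p.2).erase 0

/-- The colors in the lists of all short edges at `v`, taken from the finite palette. -/
def common (v : ℕ) : Finset ℕ :=
  I.palette.filter fun c => ∀ e < I.m, I.Inc e v → I.IsShort e → ∃ j < I.m, I.lst e j = c

theorem zero_notMem_common (v : ℕ) : 0 ∉ I.common v := by simp [common, palette]

/-- The factor by which `Phi` is weighted against `Psi` in the score: it exceeds every value of
`Psi`. -/
def K : ℕ := 1 + ∑ e ∈ Finset.range I.m, (I.deg (I.ends e 0) + I.deg (I.ends e 1))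

/-- The bonus `K` for an edge at `v` that has a color common at `v`. -/
def F (v c : ℕ) : ℕ := if c ∈ I.common v then I.K else 0

/-- The contribution to the score of a short edge `e` with the color `c`. It is nonzero exactly if
`c` is common at one of the ends of `e` (see `W_ne_zero`), and these are the colors that the local
search may give to `e`. -/
def W (e c : ℕ) : ℕ :=
  if I.IsShort e ∧ (c ∈ I.common (I.ends e 0) ∨ c ∈ I.common (I.ends e 1)) then
    I.F (I.ends e 0) c + I.F (I.ends e 1) c + I.deg (I.ends e 0) + I.deg (I.ends e 1)
  else 0

theorem K_pos : 0 < I.K := by unfold K; omega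

variable {I} in
theorem W_ne_zero {e c : ℕ} : I.W e c ≠ 0 ↔
    I.IsShort e ∧ (c ∈ I.common (I.ends e 0) ∨ c ∈ I.common (I.ends e 1)) := by
  have hK := I.K_pos
  unfold W F
  by_cases h0 : c ∈ I.common (I.ends e 0) <;> by_cases h1 : c ∈ I.common (I.ends e 1) <;>
    by_cases hs : I.IsShort e <;> simp [h0, h1, hs] <;> omega

variable {I} in
theorem W_ne_zero_of_mem {e v c : ℕ} (h : I.Inc e v) (hs : I.IsShort e) (hc : c ∈ I.common v) :
    I.W e c ≠ 0 := by
  rw [W_ne_zero]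
  rcases h with h | h <;> subst h <;> simp [hs, hc]

theorem W_zero (e : ℕ) : I.W e 0 = 0 := by
  by_contra h
  rw [← ne_eq, W_ne_zero] at h
  simp [zero_notMem_common] at h

/-- A proper coloring of some of the short edges, the value `0` standing for uncolored, in which
each colored edge has a color common at one of its ends. -/
structure IsPartial (φ : ℕ → ℕ) : Prop where
  zero : ∀ e, I.m ≤ e → φ e = 0
  weight : ∀ e < I.m, φ e ≠ 0 → I.W e (φ e) ≠ 0
  inj : ∀ e < I.m, ∀ e' < I.m, ∀ v, I.Inc e v → I.Inc e' v → φ e = φ e' → φ e ≠ 0 → e = e'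

/-- The search of an edge of color `c` at `v` among the edges below `k`; the result `e + 1` means
`e`, and `0` that there is none. -/
def findBelow (φ : ℕ → ℕ) (v c : ℕ) : ℕ → ℕ
  | 0 => 0
  | k + 1 => if I.Inc k v ∧ φ k = c then k + 1 else findBelow φ v c k

/-- The edge of color `c` at `v`, as `e + 1`, or `0` if there is none. -/
def find (φ : ℕ → ℕ) (v c : ℕ) : ℕ := I.findBelow φ v c I.m

/-- No edge at `v` has the color `c`. -/
def Free (φ : ℕ → ℕ) (v c : ℕ) : Prop := ∀ e < I.m, I.Inc e v → φ e ≠ c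

variable {I}

theorem findBelow_eq_zero {φ : ℕ → ℕ} {v c k : ℕ} :
    I.findBelow φ v c k = 0 ↔ ∀ e < k, I.Inc e v → φ e ≠ c := by
  induction k with
  | zero => simp [findBelow]
  | succ k ih =>
    rw [findBelow]
    split_ifs with h
    · simp only [false_iff]
      exact fun h' => h' k (by omega) h.1 h.2
    · rw [ih]
      constructor
      · intro h' e he hi hc
        rcases Nat.lt_succ_iff_lt_or_eq.1 he with he | rfl
        · exact h' e he hi hc
        · exact h ⟨hi, hc⟩
      · exact fun h' e he => h' e (by omega)

theorem findBelow_spec {φ : ℕ → ℕ} {v c k r : ℕ} (h : I.findBelow φ v c k = r + 1) :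
    r < k ∧ I.Inc r v ∧ φ r = c := by
  induction k with
  | zero => simp [findBelow] at h
  | succ k ih =>
    rw [findBelow] at h
    split_ifs at h with h'
    · obtain rfl : k = r := by omega
      exact ⟨by omega, h'⟩
    · have := ih h
      exact ⟨by omega, this.2⟩

theorem find_eq_zero {φ : ℕ → ℕ} {v c : ℕ} : I.find φ v c = 0 ↔ I.Free φ v c :=
  findBelow_eq_zero

theorem find_spec {φ : ℕ → ℕ} {v c r : ℕ} (h : I.find φ v c = r + 1) :
    r < I.m ∧ I.Inc r v ∧ φ r = c := findBelow_spec h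

theorem find_eq {φ : ℕ → ℕ} (hφ : I.IsPartial φ) {v c e : ℕ} (hc : c ≠ 0) (he : e < I.m)
    (hv : I.Inc e v) (hec : φ e = c) : I.find φ v c = e + 1 := by
  rcases h : I.find φ v c with _ | r
  · exact absurd hec (find_eq_zero.1 h e he hv)
  · obtain ⟨h1, h2, h3⟩ := find_spec h
    rw [hφ.inj r h1 e he v h2 hv (h3.trans hec.symm) (by rwa [h3])]

theorem find_congr {φ ψ : ℕ → ℕ} {v c : ℕ}
    (h : ∀ e < I.m, I.Inc e v → (φ e = c ↔ ψ e = c)) : I.find φ v c = I.find ψ v c := by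
  have : ∀ k ≤ I.m, I.findBelow φ v c k = I.findBelow ψ v c k := by
    intro k
    induction k with
    | zero => intro; rfl
    | succ k ih =>
      intro hk
      rw [findBelow, findBelow, ih (by omega)]
      congr 1
      apply propext
      exact and_congr_right fun hi => h k (by omega) hi
  exact this _ le_rfl

variable (I) in
/-- `1` if `c` is common at `v`, and `0` otherwise. -/
def good (v c : ℕ) : ℕ := if c ∈ I.common v then 1 else 0

theorem good_le (v c : ℕ) : I.good v c ≤ 1 := by unfold good; split_ifs <;> omega

theorem good_of_mem {v c : ℕ} (h : c ∈ I.common v) : I.good v c = 1 := by simp [good, h]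

theorem mem_of_good {v c : ℕ} (h : I.good v c ≠ 0) : c ∈ I.common v := by
  by_contra h'
  simp [good, h'] at h

variable (I) in
/-- The number of ends of `e` at which `c` is common. -/
def val (e c : ℕ) : ℕ := I.good (I.ends e 0) c + I.good (I.ends e 1) c

variable (I) in
/-- The sum of the degrees of the ends of `e`, if `c` is a color and not `0`. -/
def dval (e c : ℕ) : ℕ := if c = 0 then 0 else I.deg (I.ends e 0) + I.deg (I.ends e 1)

variable (I) in
/-- The number of pairs of a colored edge and an end of it at which the color of the edge is common.
This is what the local search primarily maximizes. -/
def Phi (φ : ℕ → ℕ) : ℕ := ∑ e ∈ Finset.range I.m, I.val e (φ e)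

variable (I) in
/-- The sum of the degrees of the ends over all colored edges; it breaks ties between colorings with
the same `Phi`. -/
def Psi (φ : ℕ → ℕ) : ℕ := ∑ e ∈ Finset.range I.m, I.dval e (φ e)

variable (I) in
/-- The objective of the local search. By `score_eq` it orders the partial colorings
lexicographically by `Phi` and `Psi`. -/
def score (φ : ℕ → ℕ) : ℕ := ∑ e ∈ Finset.range I.m, I.W e (φ e)

theorem val_zero (e : ℕ) : I.val e 0 = 0 := by simp [val, good, zero_notMem_common]

theorem dval_zero (e : ℕ) : I.dval e 0 = 0 := by simp [dval]

theorem val_eq {e u v : ℕ} (hu : I.Inc e u) (hv : I.Inc e v) (huv : u ≠ v) (c : ℕ) :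
    I.val e c = I.good u c + I.good v c := by
  unfold val
  rcases hu with hu | hu <;> rcases hv with hv | hv
  · omega
  · rw [hu, hv]
  · rw [hu, hv, add_comm]
  · omega

theorem dval_eq {e u v c : ℕ} (hu : I.Inc e u) (hv : I.Inc e v) (huv : u ≠ v) (hc : c ≠ 0) :
    I.dval e c = I.deg u + I.deg v := by
  unfold dval
  rw [if_neg hc]
  rcases hu with hu | hu <;> rcases hv with hv | hv
  · omega
  · rw [hu, hv]
  · rw [hu, hv, add_comm]
  · omega

theorem score_eq {φ : ℕ → ℕ} (hφ : I.IsPartial φ) : I.score φ = I.K * I.Phi φ + I.Psi φ := by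
  unfold score Phi Psi
  rw [Finset.mul_sum, ← Finset.sum_add_distrib]
  refine Finset.sum_congr rfl fun e he => ?_
  by_cases h : φ e = 0
  · rw [h, W_zero, val_zero, dval_zero]; simp
  · have hw := W_ne_zero.1 (hφ.weight e (Finset.mem_range.1 he) h)
    unfold W
    rw [if_pos hw]
    unfold val dval good F
    rw [if_neg h]
    split_ifs <;> ring

theorem Psi_lt (φ : ℕ → ℕ) : I.Psi φ < I.K := by
  have : I.Psi φ ≤ ∑ e ∈ Finset.range I.m, (I.deg (I.ends e 0) + I.deg (I.ends e 1)) :=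
    Finset.sum_le_sum fun e _ => by unfold dval; split_ifs <;> omega
  unfold K
  omega

theorem Phi_le_of_score_le {φ ψ : ℕ → ℕ} (hφ : I.IsPartial φ) (hψ : I.IsPartial ψ)
    (h : I.score ψ ≤ I.score φ) : I.Phi ψ ≤ I.Phi φ := by
  rw [score_eq hφ, score_eq hψ] at h
  have := I.Psi_lt φ
  by_contra hlt
  have : I.K * (I.Phi φ + 1) ≤ I.K * I.Phi ψ := Nat.mul_le_mul_left _ (by omega)
  rw [mul_add] at this
  omega

theorem Psi_le_of_score_le {φ ψ : ℕ → ℕ} (hφ : I.IsPartial φ) (hψ : I.IsPartial ψ)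
    (h : I.score ψ ≤ I.score φ) (h' : I.Phi φ ≤ I.Phi ψ) : I.Psi ψ ≤ I.Psi φ := by
  rw [score_eq hφ, score_eq hψ] at h
  have : I.K * I.Phi φ ≤ I.K * I.Phi ψ := Nat.mul_le_mul_left _ h'
  omega

/-- The coloring `φ` after coloring `e` with `c` and taking away the color of the edge `r - 1` (of
no edge if `r = 0`). -/
def recolor (φ : ℕ → ℕ) (e c r : ℕ) : ℕ → ℕ :=
  fun e' => if e' = e then c else if e' + 1 = r then 0 else φ e'

theorem sum_recolor_zero (f : ℕ → ℕ → ℕ) (hf : ∀ e, f e 0 = 0) {φ : ℕ → ℕ} {e c : ℕ}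
    (he : e < I.m) (h0 : φ e = 0) :
    ∑ e' ∈ Finset.range I.m, f e' (recolor φ e c 0 e') =
      ∑ e' ∈ Finset.range I.m, f e' (φ e') + f e c := by
  have hmem := Finset.mem_range.2 he
  rw [← Finset.add_sum_erase _ _ hmem, ← Finset.add_sum_erase _ (fun e' => f e' (φ e')) hmem]
  rw [Finset.sum_congr rfl (g := fun e' => f e' (φ e'))]
  · simp [recolor, h0, hf]; ring
  · intro e' he'
    simp [recolor, Finset.ne_of_mem_erase he']

theorem sum_recolor_succ (f : ℕ → ℕ → ℕ) (hf : ∀ e, f e 0 = 0) {φ : ℕ → ℕ} {e c r : ℕ}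
    (he : e < I.m) (h0 : φ e = 0) (hr : r < I.m) (hre : r ≠ e) :
    ∑ e' ∈ Finset.range I.m, f e' (recolor φ e c (r + 1) e') + f r (φ r) =
      ∑ e' ∈ Finset.range I.m, f e' (φ e') + f e c := by
  have hmem := Finset.mem_range.2 he
  have hr' : r ∈ (Finset.range I.m).erase e := Finset.mem_erase.2 ⟨hre, Finset.mem_range.2 hr⟩
  rw [← Finset.add_sum_erase _ _ hmem, ← Finset.add_sum_erase _ (fun e' => f e' (φ e')) hmem,
    ← Finset.add_sum_erase _ _ hr', ← Finset.add_sum_erase _ (fun e' => f e' (φ e')) hr']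
  rw [Finset.sum_congr rfl (g := fun e' => f e' (φ e'))]
  · simp [recolor, h0, hf, hre]; ring
  · intro e' he'
    have h1 := Finset.ne_of_mem_erase he'
    have h2 := Finset.ne_of_mem_erase (Finset.mem_of_mem_erase he')
    simp [recolor, h1, h2]

/-! ### Moves -/

variable (I) in
/-- The state in the course of a move: a partial coloring `B` and, if `live ≠ 0`, an uncolored
edge `E` with the ends `U` and `V`, which is to be given the color `C`; the color `D` is the second
color of a Kempe chain. -/
@[ext] structure Cfg where
  B : ℕ → ℕ
  E : ℕ
  U : ℕ
  V : ℕ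
  C : ℕ
  D : ℕ
  live : ℕ

variable (I) in
/-- The edge `E` can be given the color `C`, as far as the end `U` is concerned. -/
def CanPush (κ : Cfg) : Prop :=
  κ.live ≠ 0 ∧ κ.B κ.E = 0 ∧ I.W κ.E κ.C ≠ 0 ∧ I.find κ.B κ.U κ.C = 0

instance (κ : Cfg) : Decidable (I.CanPush κ) := inferInstanceAs (Decidable (_ ∧ _))

variable (I) in
/-- The elementary step of all moves: color `E` with `C`; the edge at `V` that had this color, if
any, loses it and becomes the current edge. The move is dead afterwards if the step was impossible
or if there was no such edge. -/
def push (κ : Cfg) : Cfg :=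
  if I.CanPush κ then
    { κ with
      B := recolor κ.B κ.E κ.C (I.find κ.B κ.V κ.C)
      E := I.find κ.B κ.V κ.C - 1
      live := I.find κ.B κ.V κ.C }
  else { κ with live := 0 }

variable (I) in
/-- A step along a Kempe chain: after the push the other end of the new current edge becomes `V`,
and the two colors change places. -/
def chainStep (κ : Cfg) : Cfg :=
  { I.push κ with
    U := κ.V, V := I.other (I.push κ).E κ.V, C := κ.D, D := κ.C }

variable (I) in
/-- A step of a fan with the center `V`: the current edge is given its candidate color, and the edge
that loses the color becomes the current one. -/
def fanStep (cand : ℕ → ℕ) (κ : Cfg) : Cfg :=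
  { I.push { κ with C := cand κ.E } with
    U := I.other (I.push { κ with C := cand κ.E }).E κ.V }

variable (I) in
/-- The coloring is a partial coloring, and the current edge joins `U` and `V`. -/
structure Cfg.Ok (κ : Cfg) : Prop where
  isPartial : I.IsPartial κ.B
  edge : κ.live ≠ 0 → κ.E < I.m ∧ I.Inc κ.E κ.U ∧ I.Inc κ.E κ.V ∧ κ.U ≠ κ.V

theorem isPartial_recolor {φ : ℕ → ℕ} (hφ : I.IsPartial φ) {e c u v : ℕ} (he : e < I.m)
    (hu : I.Inc e u) (hv : I.Inc e v) (huv : u ≠ v) (hW : I.W e c ≠ 0)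
    (hfree : I.Free φ u c) : I.IsPartial (recolor φ e c (I.find φ v c)) := by
  have hc : c ≠ 0 := by rintro rfl; exact hW (I.W_zero e)
  have key : ∀ e' < I.m, e' ≠ e → ∀ w, I.Inc e w → I.Inc e' w →
      recolor φ e c (I.find φ v c) e' ≠ c := by
    intro e' he' hne w hw hw' h
    simp only [recolor, if_neg hne] at h
    split_ifs at h with h1
    · exact hc h.symm
    · rcases eq_or_eq_other hu hw with rfl | rfl
      · exact hfree e' he' hw' h
      · rw [other_eq hu hv huv] at hw'
        exact h1 (find_eq hφ hc he' hw' h).symm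
  have hee : recolor φ e c (I.find φ v c) e = c := by simp [recolor]
  constructor
  · intro e' he'
    simp only [recolor]
    rw [if_neg (by omega), hφ.zero e' he', ite_self]
  · intro e' he' h
    by_cases hne : e' = e
    · subst hne; rwa [hee]
    · simp only [recolor, if_neg hne] at h ⊢
      split_ifs at h ⊢ with h1
      · exact absurd rfl h
      · exact hφ.weight e' he' h
  · intro e1 h1 e2 h2 w hw1 hw2 heq hne
    by_cases ha : e1 = e
    · by_cases hb : e2 = e
      · rw [ha, hb]
      · subst ha
        rw [hee] at heq
        exact absurd heq.symm (key e2 h2 hb w hw1 hw2)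
    · by_cases hb : e2 = e
      · subst hb
        rw [hee] at heq
        exact absurd heq (key e1 h1 ha w hw2 hw1)
      · simp only [recolor, if_neg ha, if_neg hb] at heq hne
        by_cases h3 : e1 + 1 = I.find φ v c
        · simp [h3] at hne
        · by_cases h4 : e2 + 1 = I.find φ v c
          · simp [h3, h4] at heq hne
            exact absurd heq hne
          · simp only [h3, h4, if_false] at heq hne
            exact hφ.inj e1 h1 e2 h2 w hw1 hw2 heq hne

theorem Cfg.Ok.push {κ : Cfg} (h : κ.Ok I) : I.IsPartial (I.push κ).B ∧
    ((I.push κ).live ≠ 0 → (I.push κ).E < I.m ∧ I.Inc (I.push κ).E κ.V) := by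
  unfold Inst.push
  split_ifs with hc
  · obtain ⟨h1, h2, h3, h4⟩ := hc
    obtain ⟨h5, h6, h7, h8⟩ := h.edge h1
    refine ⟨isPartial_recolor h.isPartial h5 h6 h7 h8 h3 (find_eq_zero.1 h4), fun hl => ?_⟩
    simp only at hl ⊢
    obtain ⟨r, hr⟩ := Nat.exists_eq_succ_of_ne_zero hl
    have := find_spec hr
    rw [hr]
    exact ⟨this.1, this.2.1⟩
  · exact ⟨h.isPartial, fun h => absurd rfl h⟩

theorem Cfg.Ok.chainStep {κ : Cfg} (h : κ.Ok I) : (I.chainStep κ).Ok I :=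
  ⟨h.push.1, fun hl => ⟨(h.push.2 hl).1, (h.push.2 hl).2, inc_other (h.push.2 hl).2,
    (other_ne (h.push.2 hl).1 (h.push.2 hl).2).symm⟩⟩

theorem Cfg.Ok.fanStep {κ : Cfg} (h : κ.Ok I) (cand : ℕ → ℕ) : (I.fanStep cand κ).Ok I := by
  have h' : Cfg.Ok I { κ with C := cand κ.E } := ⟨h.1, h.2⟩
  have hV : (I.push { κ with C := cand κ.E }).V = κ.V := by
    unfold Inst.push; split_ifs <;> rfl
  refine ⟨h'.push.1, fun hl => ?_⟩
  have := h'.push.2 hl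
  exact ⟨this.1, inc_other this.2, by simp only [Inst.fanStep]; rw [hV]; exact this.2, by
    simp only [Inst.fanStep]; rw [hV]; exact other_ne this.1 this.2⟩

/-! ### Kempe chains that never improve the score -/

variable (I) in
/-- The state along a Kempe chain. In `phi` the colors that the chain is going to use at the ends of
the current edge are counted as if the edge had them; since `Phi B ≤ Φ₀`, this forces them to be
common at these ends, so that the next push is possible. -/
structure ChainInv (Φ₀ : ℕ) (κ : Cfg) : Prop where
  ok : κ.Ok I
  live : κ.live ≠ 0
  short : I.IsShort κ.E
  uncolored : κ.B κ.E = 0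
  freeU : I.Free κ.B κ.U κ.C
  freeV : I.Free κ.B κ.V κ.D
  ne : κ.C ≠ κ.D
  C_ne : κ.C ≠ 0
  D_ne : κ.D ≠ 0
  phi : I.Phi κ.B + I.good κ.U κ.C + I.good κ.V κ.D = Φ₀ + 2

/-- As long as `Phi` does not exceed `Φ₀`, a Kempe chain continues: if there was no conflicting
edge, the push would have raised `Phi` above `Φ₀`. -/
theorem ChainInv.step {Φ₀ : ℕ} {κ : Cfg} (h : I.ChainInv Φ₀ κ) (h0 : I.Phi κ.B ≤ Φ₀)
    (h1 : I.Phi (I.chainStep κ).B ≤ Φ₀) :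
    I.ChainInv Φ₀ (I.chainStep κ) ∧ I.CanPush κ ∧ (I.push κ).live ≠ 0 := by
  obtain ⟨hE, hU, hV, hUV⟩ := h.ok.edge h.live
  have hphi := h.phi
  have gU := I.good_le κ.U κ.C
  have gV := I.good_le κ.V κ.D
  have gU1 : I.good κ.U κ.C = 1 := by omega
  have gV1 : I.good κ.V κ.D = 1 := by omega
  have hcan : I.CanPush κ := ⟨h.live, h.uncolored,
    W_ne_zero_of_mem hU h.short (mem_of_good (by omega)), find_eq_zero.2 h.freeU⟩
  have hB : (I.chainStep κ).B = recolor κ.B κ.E κ.C (I.find κ.B κ.V κ.C) := by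
    simp [Inst.chainStep, Inst.push, hcan]
  have hEe : (I.chainStep κ).E = I.find κ.B κ.V κ.C - 1 := by
    simp [Inst.chainStep, Inst.push, hcan]
  have hl : (I.push κ).live = I.find κ.B κ.V κ.C := by simp [Inst.push, hcan]
  rcases hr : I.find κ.B κ.V κ.C with _ | r
  · rw [hB, hr] at h1
    have := sum_recolor_zero (I := I) I.val val_zero (c := κ.C) hE h.uncolored
    rw [val_eq hU hV hUV] at this
    unfold Phi at *
    omega
  · obtain ⟨hrm, hrV, hrC⟩ := find_spec hr
    have hrE : r ≠ κ.E := by rintro rfl; exact h.C_ne (by rw [← hrC, h.uncolored])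
    rw [hr] at hB hEe hl
    rw [Nat.add_sub_cancel] at hEe
    have hVo : (I.chainStep κ).V = I.other r κ.V := by
      rw [← hEe]; rfl
    have hrU : ¬ I.Inc r κ.U := fun hi => h.freeU r hrm hi hrC
    refine ⟨⟨h.ok.chainStep, ?_, ?_, ?_, ?_, ?_, ?_, ?_, ?_, ?_⟩, hcan, by omega⟩
    · change (I.push κ).live ≠ 0; omega
    · rw [hEe]
      exact (W_ne_zero.1 (h.ok.isPartial.weight r hrm (by rw [hrC]; exact h.C_ne))).1
    · rw [hB, hEe]; simp [recolor, hrE]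
    · change I.Free _ κ.V κ.D
      intro e he hi
      rw [hB]
      simp only [recolor]
      split_ifs with h2 h3
      · exact h.ne
      · exact h.D_ne.symm
      · exact h.freeV e he hi
    · rw [hVo]
      change I.Free _ _ κ.C
      intro e he hi
      rw [hB]
      simp only [recolor]
      split_ifs with h2 h3
      · subst h2
        exfalso
        rcases eq_or_eq_other hU hi with h4 | h4
        · exact hrU (h4 ▸ inc_other hrV)
        · rw [other_eq hU hV hUV] at h4
          exact other_ne hrm hrV h4
      · exact h.C_ne.symm
      · intro hec
        apply h3
        rw [h.ok.isPartial.inj e he r hrm _ hi (inc_other hrV) (hec.trans hrC.symm)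
          (by rw [hec]; exact h.C_ne)]
    · exact h.ne.symm
    · exact h.D_ne
    · exact h.C_ne
    · have := sum_recolor_succ (I := I) I.val val_zero (c := κ.C) hE h.uncolored hrm hrE
      rw [val_eq hU hV hUV, hrC, val_eq hrV (inc_other hrV) (other_ne hrm hrV).symm] at this
      rw [hVo, hB]
      change I.Phi _ + I.good κ.V κ.D + I.good _ κ.C = _
      unfold Phi at *
      omega

variable (I) in
/-- The neighbor of `v` along the edge of color `c`. -/
def nb (φ : ℕ → ℕ) (v c : ℕ) : ℕ := I.other (I.find φ v c - 1) v

variable (I) in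
/-- The walk from `v` along edges of the colors `c, d, c, d, …` in a fixed coloring. -/
def walk (φ : ℕ → ℕ) (c d v : ℕ) : ℕ → ℕ
  | 0 => v
  | i + 1 => I.nb φ (walk φ c d v i) (if Even i then c else d)

variable (I) in
/-- The walk can leave its `i`-th vertex. -/
def Steps (φ : ℕ → ℕ) (c d v i : ℕ) : Prop :=
  ¬ I.Free φ (I.walk φ c d v i) (if Even i then c else d)

theorem exists_edge_of_steps {φ : ℕ → ℕ} {c d v i : ℕ} (h : I.Steps φ c d v i) :
    ∃ e < I.m, I.Inc e (I.walk φ c d v i) ∧ φ e = (if Even i then c else d) ∧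
      I.find φ (I.walk φ c d v i) (if Even i then c else d) = e + 1 ∧
      I.walk φ c d v (i + 1) = I.other e (I.walk φ c d v i) := by
  unfold Steps at h
  rw [← find_eq_zero] at h
  obtain ⟨r, hr⟩ := Nat.exists_eq_succ_of_ne_zero h
  obtain ⟨h1, h2, h3⟩ := find_spec hr
  exact ⟨r, h1, h2, h3, hr, by rw [walk, nb, hr]; rfl⟩

/-- The edges of one color form a matching, so that a step of the walk can be reversed. -/
theorem nb_nb {φ : ℕ → ℕ} (hφ : I.IsPartial φ) {v c : ℕ} (hc : c ≠ 0) (h : ¬ I.Free φ v c) :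
    I.nb φ (I.nb φ v c) c = v ∧ I.nb φ v c ≠ v ∧ ¬ I.Free φ (I.nb φ v c) c := by
  rw [← find_eq_zero] at h
  obtain ⟨r, hr⟩ := Nat.exists_eq_succ_of_ne_zero h
  obtain ⟨h1, h2, h3⟩ := find_spec hr
  have hn : I.nb φ v c = I.other r v := by unfold nb; rw [hr]; rfl
  have hf := find_eq hφ hc h1 (inc_other h2) h3
  refine ⟨?_, by rw [hn]; exact other_ne h1 h2, fun hfree => hfree r h1 (hn ▸ inc_other h2) h3⟩
  rw [hn]
  unfold nb
  rw [hf]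
  exact other_other h2

theorem walk_pred {φ : ℕ → ℕ} (hφ : I.IsPartial φ) {c d v i : ℕ} (hc : c ≠ 0) (hd : d ≠ 0)
    (h : I.Steps φ c d v i) :
    I.walk φ c d v i = I.nb φ (I.walk φ c d v (i + 1)) (if Even i then c else d) :=
  (nb_nb hφ (by split_ifs <;> assumption) h).1.symm

/-- If the color `d` is free at the start, the walk does not revisit a vertex after an even number
of steps: going back from both visits, the start would be entered by an edge of color `d`. -/
theorem walk_ne_of_even {φ : ℕ → ℕ} (hφ : I.IsPartial φ) {c d v : ℕ} (hc : c ≠ 0) (hd : d ≠ 0)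
    (hfree : I.Free φ v d) (r : ℕ) (hr : Even r) (hr0 : r ≠ 0) (i : ℕ)
    (h : ∀ j < i + r, I.Steps φ c d v j) : I.walk φ c d v i ≠ I.walk φ c d v (i + r) := by
  induction i with
  | zero =>
    intro heq
    rw [zero_add] at heq h
    obtain ⟨s, rfl⟩ := Nat.exists_eq_succ_of_ne_zero hr0
    have h1 := nb_nb hφ (by split_ifs <;> assumption) (h s (by omega))
    have h2 : I.nb φ (I.walk φ c d v s) (if Even s then c else d) = v := heq.symm
    rw [h2] at h1
    have hs : ¬ Even s := by
      have := hr; rw [Nat.even_add_one] at this; exact this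
    rw [if_neg hs] at h1
    exact h1.2.2 hfree
  | succ i ih =>
    intro heq
    apply ih fun j hj => h j (by omega)
    rw [walk_pred hφ hc hd (h i (by omega)), walk_pred hφ hc hd (h (i + r) (by omega)), heq]
    have : Even (i + r) ↔ Even i := by rw [Nat.even_add]; tauto
    simp only [this]
    congr 2; omega

/-- The walk does not revisit a vertex after an odd number of steps: both visits can be moved
towards each other along the same edges, until they are adjacent. -/
theorem walk_ne_of_odd {φ : ℕ → ℕ} (hφ : I.IsPartial φ) {c d v : ℕ} (hc : c ≠ 0) (hd : d ≠ 0)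
    (r : ℕ) : ∀ i, (∀ j < i + (2 * r + 1), I.Steps φ c d v j) →
      I.walk φ c d v i ≠ I.walk φ c d v (i + (2 * r + 1)) := by
  induction r with
  | zero =>
    intro i h
    exact (nb_nb hφ (by split_ifs <;> assumption) (h i (by omega))).2.1.symm
  | succ r ih =>
    intro i h heq
    apply ih (i + 1) fun j hj => h j (by omega)
    have h1 := walk_pred hφ hc hd (h (i + (2 * r + 2)) (by omega))
    have e1 : i + 1 + (2 * r + 1) = i + (2 * r + 2) := by ring
    have e2 : i + (2 * r + 2) + 1 = i + (2 * (r + 1) + 1) := by ring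
    rw [e1, h1, e2, ← heq, walk]
    have : Even (i + (2 * r + 2)) ↔ Even i := by
      rw [Nat.even_add]; have : Even (2 * r + 2) := ⟨r + 1, by ring⟩
      tauto
    simp only [this]

theorem walk_injective {φ : ℕ → ℕ} (hφ : I.IsPartial φ) {c d v : ℕ} (hc : c ≠ 0) (hd : d ≠ 0)
    (hfree : I.Free φ v d) {k : ℕ} (h : ∀ j < k, I.Steps φ c d v j) {i j : ℕ} (hij : i < j)
    (hj : j ≤ k) : I.walk φ c d v i ≠ I.walk φ c d v j := by
  obtain ⟨s, rfl⟩ := Nat.exists_eq_add_of_lt hij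
  rcases Nat.even_or_odd (s + 1) with hs | ⟨r, hr⟩
  · exact walk_ne_of_even hφ hc hd hfree (s + 1) hs (by omega) i fun j' hj' => h j' (by omega)
  · have := walk_ne_of_odd hφ hc hd r i fun j' hj' => h j' (by omega)
    rwa [← hr] at this

theorem walk_congr {φ ψ : ℕ → ℕ} {c d : ℕ} (hc : ∀ e < I.m, φ e = c ↔ ψ e = c)
    (hd : ∀ e < I.m, φ e = d ↔ ψ e = d) (v i : ℕ) :
    I.walk φ c d v i = I.walk ψ c d v i := by
  induction i with
  | zero => rfl
  | succ i ih =>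
    rw [walk, walk, ih, nb, nb]
    congr 2
    apply find_congr
    intro e he _
    split_ifs
    · exact hc e he
    · exact hd e he

/-- If no prefix of the Kempe chain has a larger `Phi` than its start, then the alternating walk
from `V` in the original coloring ends at `U` after an even number of steps. The chain recolors the
edges of this walk one by one, and it can stop without an increase of `Phi` only by running into
`U`, because the walk does not meet itself. -/
theorem exists_walk_return {κ : Cfg} (h0 : I.ChainInv (I.Phi κ.B) κ)
    (hle : ∀ k ≤ I.n + 1, I.Phi (I.chainStep^[k] κ).B ≤ I.Phi κ.B) :
    ∃ k, Even k ∧ k ≠ 0 ∧ I.walk κ.B κ.C κ.D κ.V k = κ.U ∧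
      ∀ i < k, I.Steps κ.B κ.C κ.D κ.V i := by
  have hφ := h0.ok.isPartial
  have hc := h0.C_ne
  have hd := h0.D_ne
  obtain ⟨hE, hU, hV, hUV⟩ := h0.ok.edge h0.live
  have hinv : ∀ k ≤ I.n + 1, I.ChainInv (I.Phi κ.B) (I.chainStep^[k] κ) := by
    intro k
    induction k with
    | zero => intro; exact h0
    | succ k ih =>
      intro hk
      have h2 := hle (k + 1) hk
      rw [Function.iterate_succ_apply'] at h2 ⊢
      exact ((ih (by omega)).step (hle k (by omega)) h2).1
  set p := I.walk κ.B κ.C κ.D κ.V with hp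
  -- the current edge of the `k`-th state joins `w k` and `p k`
  set w : ℕ → ℕ := fun i => if i = 0 then κ.U else p (i - 1) with hw
  have main : ∀ k ≤ I.n + 1, (∀ i < k, I.Steps κ.B κ.C κ.D κ.V i) ∧ (∃ i ≤ k, p i = κ.U) ∨
      ((∀ i < k, I.Steps κ.B κ.C κ.D κ.V i) ∧ (∀ i ≤ k, p i ≠ κ.U) ∧
      (I.chainStep^[k] κ).V = p k ∧ (I.chainStep^[k] κ).U = w k ∧
      (I.chainStep^[k] κ).C = (if Even k then κ.C else κ.D) ∧
      (I.chainStep^[k] κ).D = (if Even k then κ.D else κ.C) ∧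
      ∀ e < I.m, (I.chainStep^[k] κ).B e ≠ κ.B e →
        ∃ i ≤ k, ∀ v, I.Inc e v → v = w i ∨ v = p i) ∨
      ∃ k' < k, (∀ i < k', I.Steps κ.B κ.C κ.D κ.V i) ∧ (∃ i ≤ k', p i = κ.U) := by
    intro k
    induction k with
    | zero =>
      intro _
      right; left
      refine ⟨by omega, fun i hi => ?_, rfl, rfl, by simp, by simp, fun e _ h => absurd rfl h⟩
      obtain rfl : i = 0 := by omega
      exact hUV.symm
    | succ k ih =>
      intro hk
      rcases ih (by omega) with h | ⟨hs, hnu, hVk, hUk, hCk, hDk, hB⟩ | ⟨k', hk', h⟩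
      · exact Or.inr (Or.inr ⟨k, by omega, h⟩)
      swap
      · exact Or.inr (Or.inr ⟨k', by omega, h⟩)
      have hik := hinv k (by omega)
      obtain ⟨_, hcan, hl⟩ := hik.step (hle k (by omega))
        (by have := hle (k + 1) hk; rwa [Function.iterate_succ_apply'] at this)
      simp only [Function.iterate_succ_apply']
      set κ' := I.chainStep^[k] κ with hκ'
      have hfind : I.find κ'.B κ'.V κ'.C ≠ 0 := by
        simpa [Inst.push, hcan] using hl
      obtain ⟨r, hr⟩ := Nat.exists_eq_succ_of_ne_zero hfind
      obtain ⟨hrm, hrV, hrC⟩ := find_spec hr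
      obtain ⟨hE', hU', hV', hUV'⟩ := hik.ok.edge hik.live
      have hrU : ¬ I.Inc r κ'.U := fun hi => hik.freeU r hrm hi hrC
      -- the conflicting edge has not been recolored yet
      have hold : κ.B r = κ'.C := by
        by_contra hne
        obtain ⟨i, hi, hends⟩ := hB r hrm (by rw [hrC]; exact fun h => hne h.symm)
        have h1 := hends _ hrV
        have h2 := hends _ (inc_other hrV)
        have h3 := other_ne hrm hrV
        by_cases hik' : i = k
        · subst hik'
          rw [← hUk, ← hVk] at h1 h2
          rcases h2 with h2 | h2
          · exact hrU (h2 ▸ inc_other hrV)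
          · exact h3 h2
        · rw [hVk] at h1
          rcases h1 with h1 | h1
          · simp only [hw] at h1
            split_ifs at h1 with h4
            · exact hnu k le_rfl h1
            · exact walk_injective hφ hc hd h0.freeV hs (i := i - 1) (j := k) (by omega) le_rfl
                h1.symm
          · exact walk_injective hφ hc hd h0.freeV hs (i := i) (j := k) (by omega) le_rfl h1.symm
      have hCne : (if Even k then κ.C else κ.D) ≠ 0 := by split_ifs <;> assumption
      have hstep : I.Steps κ.B κ.C κ.D κ.V k := by
        intro hf
        exact hf r hrm (by rw [← hp, ← hVk]; exact hrV) (by rw [hold, hCk])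
      have hpk : p (k + 1) = I.other r κ'.V := by
        have h1 : I.find κ.B (p k) (if Even k then κ.C else κ.D) = r + 1 :=
          find_eq hφ hCne hrm (hVk ▸ hrV) (by rw [hold, hCk])
        rw [hp, walk, ← hp, nb, h1, hVk]; rfl
      have hs' : ∀ i < k + 1, I.Steps κ.B κ.C κ.D κ.V i := by
        intro i hi
        rcases Nat.lt_succ_iff_lt_or_eq.1 hi with hi | rfl
        · exact hs i hi
        · exact hstep
      by_cases hret : p (k + 1) = κ.U
      · exact Or.inl ⟨hs', k + 1, le_rfl, hret⟩
      refine Or.inr (Or.inl ⟨hs', ?_, ?_, ?_, ?_, ?_, ?_⟩)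
      · intro i hi
        rcases Nat.le_succ_iff.1 hi with hi | rfl
        · exact hnu i hi
        · exact hret
      · rw [hpk]
        simp [Inst.chainStep, Inst.push, hcan, hr]
      · change κ'.V = _
        rw [hVk]; simp [hw]
      · change κ'.D = _
        rw [hDk]
        simp only [Nat.even_add_one]
        split_ifs <;> rfl
      · change κ'.C = _
        rw [hCk]
        simp only [Nat.even_add_one]
        split_ifs <;> rfl
      · intro e he hne
        have hBe : (I.chainStep κ').B e = recolor κ'.B κ'.E κ'.C (r + 1) e := by
          simp [Inst.chainStep, Inst.push, hcan, hr]
        rw [hBe] at hne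
        simp only [recolor] at hne
        split_ifs at hne with h1 h2
        · refine ⟨k, by omega, fun v hv => ?_⟩
          subst h1
          rw [← hUk, ← hVk]
          rcases eq_or_eq_other hU' hv with h | h
          · exact Or.inl h
          · exact Or.inr (by rw [h, other_eq hU' hV' hUV'])
        · obtain rfl : e = r := by omega
          refine ⟨k + 1, le_rfl, fun v hv => ?_⟩
          rcases eq_or_eq_other hrV hv with h | h
          · left; rw [h, hVk]; simp [hw]
          · right; rw [h, hpk]
        · obtain ⟨i, hi, h⟩ := hB e he hne
          exact ⟨i, by omega, h⟩
  -- the walk cannot visit more than `n` vertices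
  have hret : ∃ k', (∀ i < k', I.Steps κ.B κ.C κ.D κ.V i) ∧ (∃ i ≤ k', p i = κ.U) := by
    rcases main (I.n + 1) le_rfl with h | ⟨hs, _⟩ | ⟨k', _, h⟩
    · exact ⟨_, h⟩
    · exfalso
      have hmaps : ∀ i ∈ Finset.range (I.n + 1), p i ∈ Finset.range I.n := by
        intro i hi
        obtain ⟨e, he, hi', -⟩ := exists_edge_of_steps (hs i (Finset.mem_range.1 hi))
        exact Finset.mem_range.2 (inc_lt he hi')
      obtain ⟨i, hi, j, hj, hij, heq⟩ := Finset.exists_ne_map_eq_of_card_lt_of_maps_to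
        (by simp) hmaps
      rw [Finset.mem_range] at hi hj
      rcases lt_or_gt_of_ne hij with h | h
      · exact walk_injective hφ hc hd h0.freeV hs h (by omega) heq
      · exact walk_injective hφ hc hd h0.freeV hs h (by omega) heq.symm
    · exact ⟨_, h⟩
  obtain ⟨k', hs, k, hk, hpk⟩ := hret
  have hs' : ∀ i < k, I.Steps κ.B κ.C κ.D κ.V i := fun i hi => hs i (by omega)
  have hk0 : k ≠ 0 := by rintro rfl; exact hUV hpk.symm
  refine ⟨k, ?_, hk0, hpk, hs'⟩
  -- after an odd number of steps the walk would enter `U` by an edge of the color `C`, free there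
  by_contra hodd
  obtain ⟨s, rfl⟩ := Nat.exists_eq_succ_of_ne_zero hk0
  have hse : Even s := by rw [Nat.even_add_one] at hodd; exact not_not.1 hodd
  have h1 := nb_nb hφ (by split_ifs; assumption) (hs' s (by omega))
  have h2 : I.nb κ.B (I.walk κ.B κ.C κ.D κ.V s) (if Even s then κ.C else κ.D) = κ.U := hpk
  rw [h2, if_pos hse] at h1
  exact h1.2.2 h0.freeU

end Inst

/-! ### Local maxima and fans -/

namespace Inst

variable {I : Inst}

theorem lt_phi_of_free {κ : Cfg} (ok : κ.Ok I) (hl : κ.live ≠ 0) (hs : I.IsShort κ.E)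
    (h0 : κ.B κ.E = 0) (hC : κ.C ∈ I.common κ.U) (hU : I.Free κ.B κ.U κ.C)
    (hV : I.Free κ.B κ.V κ.C) : I.Phi κ.B < I.Phi (I.push κ).B := by
  obtain ⟨hE, hiU, hiV, hUV⟩ := ok.edge hl
  have hcan : I.CanPush κ := ⟨hl, h0, W_ne_zero_of_mem hiU hs hC, find_eq_zero.2 hU⟩
  have hB : (I.push κ).B = recolor κ.B κ.E κ.C 0 := by
    simp [Inst.push, hcan, find_eq_zero.2 hV]
  have := sum_recolor_zero (I := I) I.val val_zero (c := κ.C) hE h0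
  rw [val_eq hiU hiV hUV, good_of_mem hC] at this
  rw [hB]
  unfold Phi
  omega

/-- If `C` and `D` are missing at the ends `U` and `V` of an uncolored edge and the Kempe chain from
there never improves `Phi`, then `C ≠ D` and the alternating walk joins `V` to `U`. -/
theorem ne_and_exists_walk_return {κ : Cfg} (ok : κ.Ok I) (hl : κ.live ≠ 0)
    (hs : I.IsShort κ.E) (h0 : κ.B κ.E = 0) (hC : κ.C ∈ I.common κ.U)
    (hU : I.Free κ.B κ.U κ.C) (hD : κ.D ∈ I.common κ.V) (hV : I.Free κ.B κ.V κ.D)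
    (hle : ∀ k ≤ I.n + 1, I.Phi (I.chainStep^[k] κ).B ≤ I.Phi κ.B) :
    κ.C ≠ κ.D ∧ ∃ k, Even k ∧ k ≠ 0 ∧ I.walk κ.B κ.C κ.D κ.V k = κ.U ∧
      ∀ i < k, I.Steps κ.B κ.C κ.D κ.V i := by
  have hne : κ.C ≠ κ.D := by
    intro heq
    have h1 := hle 1 (by omega)
    have h2 := lt_phi_of_free ok hl hs h0 hC hU (by rw [heq]; exact hV)
    rw [Function.iterate_one] at h1
    change I.Phi (I.push κ).B ≤ _ at h1
    omega
  refine ⟨hne, exists_walk_return ⟨ok, hl, hs, h0, hU, hV, hne, ?_, ?_, ?_⟩ hle⟩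
  · intro h; rw [h] at hC; exact zero_notMem_common _ _ hC
  · intro h; rw [h] at hD; exact zero_notMem_common _ _ hD
  · rw [good_of_mem hC, good_of_mem hD]

variable (I) in
open Classical in
/-- The common colors at `v` that no edge at `v` has. -/
noncomputable def missing (φ : ℕ → ℕ) (v : ℕ) : Finset ℕ := (I.common v).filter (I.Free φ v)

theorem mem_missing {φ : ℕ → ℕ} {v c : ℕ} :
    c ∈ I.missing φ v ↔ c ∈ I.common v ∧ I.Free φ v c := by simp [missing]

variable (I) in
/-- The colored edges at `v`. -/
def colored (φ : ℕ → ℕ) (v : ℕ) : Finset ℕ :=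
  (Finset.range I.m).filter fun e => I.Inc e v ∧ φ e ≠ 0

theorem card_common_le (φ : ℕ → ℕ) (v : ℕ) :
    (I.common v).card ≤ (I.missing φ v).card + (I.colored φ v).card := by
  have : I.common v ⊆ I.missing φ v ∪ (I.colored φ v).image φ := by
    intro c hc
    rw [Finset.mem_union, mem_missing]
    by_cases hf : I.Free φ v c
    · exact Or.inl ⟨hc, hf⟩
    · right
      unfold Free at hf
      push Not at hf
      obtain ⟨e, he, hi, hec⟩ := hf
      refine Finset.mem_image.2 ⟨e, ?_, hec⟩
      simp only [colored, Finset.mem_filter, Finset.mem_range]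
      refine ⟨he, hi, ?_⟩
      rintro h
      rw [← hec, h] at hc
      exact zero_notMem_common _ _ hc
  exact (Finset.card_le_card this).trans
    ((Finset.card_union_le _ _).trans (Nat.add_le_add_left Finset.card_image_le _))

theorem card_colored_le (φ : ℕ → ℕ) (v : ℕ) : (I.colored φ v).card ≤ I.deg v :=
  Finset.card_le_card (Finset.monotone_filter_right _ fun _ _ h => h.1)

theorem card_colored_lt {φ : ℕ → ℕ} {v e : ℕ} (he : e < I.m) (hi : I.Inc e v) (h0 : φ e = 0) :
    (I.colored φ v).card < I.deg v := by
  refine Finset.card_lt_card (Finset.ssubset_iff_of_subset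
    (Finset.monotone_filter_right _ fun _ _ h => h.1) |>.2 ⟨e, ?_, ?_⟩)
  · simp [he, hi]
  · simp [h0]

variable (I) in
/-- `cand` chooses for the edges at `x` the colors they get in a fan that starts with the edge `e₀`:
the color `a` for `e₀`, and colors missing at the other end for the others, distinct ones for
parallel edges. The value `0` means that there is no candidate; it is excluded if enough colors are
missing. -/
structure IsCand (φ : ℕ → ℕ) (e₀ x a : ℕ) (cand : ℕ → ℕ) : Prop where
  first : cand e₀ = a
  mem : ∀ e < I.m, e ≠ e₀ → I.Inc e x → cand e ≠ 0 → cand e ∈ I.missing φ (I.other e x)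
  inj : ∀ e < I.m, ∀ e' < I.m, I.Inc e x → I.Inc e' x → I.other e x = I.other e' x →
    cand e = cand e' → cand e ≠ 0 → e = e'
  total : ∀ e < I.m, e ≠ e₀ → I.Inc e x →
    I.mult x (I.other e x) ≤ (I.missing φ (I.other e x)).card → cand e ≠ 0

variable (I) in
/-- The state after `i` steps of the fan with the center `I.ends e₀ o` that starts with the edge
`e₀`. -/
def fanCfg (φ : ℕ → ℕ) (e₀ o : ℕ) (cand : ℕ → ℕ) (i : ℕ) : Cfg :=
  (I.fanStep cand)^[i] ⟨φ, e₀, I.ends e₀ (1 - o), I.ends e₀ o, 0, 0, 1⟩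

variable (I) in
/-- The start of a Kempe chain with the colors `c` and `d` from the state `κ`, with the ends of the
current edge exchanged if `sw ≠ 0`. -/
def chainStart (κ : Cfg) (sw c d : ℕ) : Cfg :=
  { κ with U := if sw = 0 then κ.U else κ.V, V := if sw = 0 then κ.V else κ.U, C := c, D := d }

variable (I) in
/-- Neither the states of the fan nor those of the Kempe chains that branch off from it have a
larger score than `φ`. -/
structure NoGain (φ : ℕ → ℕ) (e₀ o : ℕ) (cand : ℕ → ℕ) : Prop where
  fan : ∀ i ≤ I.m, I.score (I.fanCfg φ e₀ o cand i).B ≤ I.score φ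
  chain : ∀ t ≤ I.m, ∀ sw < 2, ∀ c ∈ I.palette, ∀ d ∈ I.palette, ∀ k ≤ I.n + 1,
    I.score (I.chainStep^[k] (chainStart (I.fanCfg φ e₀ o cand t) sw c d)).B ≤ I.score φ

variable (I) in
/-- The score cannot be improved by the moves that the algorithm tries. -/
def LocalMax (φ : ℕ → ℕ) : Prop :=
  ∀ e₀ < I.m, ∀ o < 2, ∀ a ∈ I.palette, ∃ cand,
    I.IsCand φ e₀ (I.ends e₀ o) a cand ∧ I.NoGain φ e₀ o cand

theorem chainStart_ok {κ : Cfg} (h : κ.Ok I) (sw c d : ℕ) : (chainStart κ sw c d).Ok I := by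
  refine ⟨h.1, fun hl => ?_⟩
  obtain ⟨h1, h2, h3, h4⟩ := h.2 hl
  unfold chainStart
  split_ifs
  · exact ⟨h1, h2, h3, h4⟩
  · exact ⟨h1, h3, h2, h4.symm⟩

theorem chain_ok {κ : Cfg} (h : κ.Ok I) (k : ℕ) : (I.chainStep^[k] κ).Ok I := by
  induction k with
  | zero => exact h
  | succ k ih => rw [Function.iterate_succ_apply']; exact ih.chainStep

variable (I) in
/-- The edges of the fan in terms of the original coloring: the edge after `e` is the one at `x`
whose color is the candidate color of `e`. -/
def fanEdge (φ : ℕ → ℕ) (e₀ x : ℕ) (cand : ℕ → ℕ) : ℕ → ℕ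
  | 0 => e₀
  | i + 1 => I.find φ x (cand (fanEdge φ e₀ x cand i)) - 1

variable (I) in
/-- The data of a fan in a local maximum `φ` in which the short edge `e₀` is uncolored; the color
`a` is missing at the far end of `e₀`. -/
structure Fan (φ : ℕ → ℕ) (e₀ o a : ℕ) (cand : ℕ → ℕ) : Prop where
  isPartial : I.IsPartial φ
  lt : e₀ < I.m
  o_lt : o < 2
  short : I.IsShort e₀
  uncolored : φ e₀ = 0
  isCand : I.IsCand φ e₀ (I.ends e₀ o) a cand
  noGain : I.NoGain φ e₀ o cand
  mem : a ∈ I.missing φ (I.other e₀ (I.ends e₀ o))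

theorem inc_ends {e o : ℕ} (ho : o < 2) : I.Inc e (I.ends e o) := by
  interval_cases o <;> simp [Inst.Inc]

theorem other_ends {e o : ℕ} (ho : o < 2) : I.other e (I.ends e o) = I.ends e (1 - o) := by
  interval_cases o <;> simp [Inst.other]

variable (I) in
/-- The state after `i` steps of a fan whose edges have been distinct so far: its first `i` edges
have their candidate colors, the current edge is uncolored, and all other edges have their original
colors. -/
structure FanInv (φ : ℕ → ℕ) (e₀ o : ℕ) (cand : ℕ → ℕ) (i : ℕ) : Prop where
  ok : (I.fanCfg φ e₀ o cand i).Ok I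
  live : (I.fanCfg φ e₀ o cand i).live ≠ 0
  E_eq : (I.fanCfg φ e₀ o cand i).E = I.fanEdge φ e₀ (I.ends e₀ o) cand i
  V_eq : (I.fanCfg φ e₀ o cand i).V = I.ends e₀ o
  U_eq : (I.fanCfg φ e₀ o cand i).U =
    I.other (I.fanEdge φ e₀ (I.ends e₀ o) cand i) (I.ends e₀ o)
  short : I.IsShort (I.fanEdge φ e₀ (I.ends e₀ o) cand i)
  lt : I.fanEdge φ e₀ (I.ends e₀ o) cand i < I.m
  inc : I.Inc (I.fanEdge φ e₀ (I.ends e₀ o) cand i) (I.ends e₀ o)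
  inj : ∀ l < i, I.fanEdge φ e₀ (I.ends e₀ o) cand l ≠ I.fanEdge φ e₀ (I.ends e₀ o) cand i
  current : (I.fanCfg φ e₀ o cand i).B (I.fanEdge φ e₀ (I.ends e₀ o) cand i) = 0
  shifted : ∀ l < i, (I.fanCfg φ e₀ o cand i).B (I.fanEdge φ e₀ (I.ends e₀ o) cand l) =
    cand (I.fanEdge φ e₀ (I.ends e₀ o) cand l)
  old : ∀ e, (∀ l ≤ i, e ≠ I.fanEdge φ e₀ (I.ends e₀ o) cand l) →
    (I.fanCfg φ e₀ o cand i).B e = φ e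
  prev : ∀ l < i, I.find φ (I.ends e₀ o) (cand (I.fanEdge φ e₀ (I.ends e₀ o) cand l)) =
    I.fanEdge φ e₀ (I.ends e₀ o) cand (l + 1) + 1
  prev_ne : ∀ l < i, cand (I.fanEdge φ e₀ (I.ends e₀ o) cand l) ≠ 0
  prev_inc : ∀ l < i, I.fanEdge φ e₀ (I.ends e₀ o) cand l < I.m ∧
    I.Inc (I.fanEdge φ e₀ (I.ends e₀ o) cand l) (I.ends e₀ o)
  phi : I.Phi (I.fanCfg φ e₀ o cand i).B = I.Phi φ

section

variable {φ : ℕ → ℕ} {e₀ o a : ℕ} {cand : ℕ → ℕ}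

theorem Fan.mem_missing (h : I.Fan φ e₀ o a cand) {e : ℕ} (he : e < I.m)
    (hi : I.Inc e (I.ends e₀ o)) (hne : cand e ≠ 0) :
    cand e ∈ I.missing φ (I.other e (I.ends e₀ o)) := by
  by_cases h' : e = e₀
  · subst h'; rw [h.isCand.first]; exact h.mem
  · exact h.isCand.mem e he h' hi hne

theorem Fan.inv_zero (h : I.Fan φ e₀ o a cand) : I.FanInv φ e₀ o cand 0 where
  ok := ⟨h.isPartial, fun _ => ⟨h.lt, by
    change I.Inc e₀ (I.ends e₀ (1 - o)); exact inc_ends (by omega), inc_ends h.o_lt, by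
    change I.ends e₀ (1 - o) ≠ _
    rw [← other_ends h.o_lt]; exact other_ne h.lt (inc_ends h.o_lt)⟩⟩
  live := one_ne_zero
  E_eq := rfl
  V_eq := rfl
  U_eq := (other_ends h.o_lt).symm
  short := h.short
  lt := h.lt
  inc := inc_ends h.o_lt
  inj := by omega
  current := h.uncolored
  shifted := by omega
  old := fun _ _ => rfl
  prev := by omega
  prev_ne := by omega
  prev_inc := by omega
  phi := rfl

/-- The candidate color of the current edge is still free at its far end. Earlier edges of the fan
with the same far end do not have it, because the candidates of parallel edges are distinct. -/
theorem FanInv.free {i : ℕ} (hi : I.FanInv φ e₀ o cand i) (h : I.Fan φ e₀ o a cand)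
    (hne : cand (I.fanEdge φ e₀ (I.ends e₀ o) cand i) ≠ 0) :
    I.Free (I.fanCfg φ e₀ o cand i).B (I.fanCfg φ e₀ o cand i).U
      (cand (I.fanEdge φ e₀ (I.ends e₀ o) cand i)) := by
  intro e he hinc hc
  rw [hi.U_eq] at hinc
  by_cases h1 : e = I.fanEdge φ e₀ (I.ends e₀ o) cand i
  · rw [h1, hi.current] at hc; exact hne hc.symm
  by_cases h2 : ∃ l < i, e = I.fanEdge φ e₀ (I.ends e₀ o) cand l
  · obtain ⟨l, hl, rfl⟩ := h2
    rw [hi.shifted l hl] at hc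
    refine hi.inj l hl (h.isCand.inj _ he _ hi.lt (hi.prev_inc l hl).2 hi.inc ?_ hc (by rwa [hc]))
    exact other_eq (hi.prev_inc l hl).2 hinc (other_ne hi.lt hi.inc).symm
  · rw [hi.old e ?_] at hc
    · exact (Inst.mem_missing.1 (h.mem_missing hi.lt hi.inc hne)).2 e he hinc hc
    · intro l hl heq
      rcases hl.eq_or_lt with rfl | hl
      · exact h1 heq
      · exact h2 ⟨l, hl, heq⟩

/-- The fan only permutes the colors at the center. -/
theorem FanInv.free_center {i α : ℕ} (hi : I.FanInv φ e₀ o cand i) (hα : α ≠ 0)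
    (h : I.Free φ (I.ends e₀ o) α) : I.Free (I.fanCfg φ e₀ o cand i).B (I.ends e₀ o) α := by
  intro e he hinc hc
  by_cases h1 : e = I.fanEdge φ e₀ (I.ends e₀ o) cand i
  · rw [h1, hi.current] at hc; exact hα hc.symm
  by_cases h2 : ∃ l < i, e = I.fanEdge φ e₀ (I.ends e₀ o) cand l
  · obtain ⟨l, hl, rfl⟩ := h2
    rw [hi.shifted l hl] at hc
    have := find_spec (hi.prev l hl)
    exact h _ this.1 this.2.1 (this.2.2.trans hc)
  · rw [hi.old e ?_] at hc
    · exact h e he hinc hc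
    · intro l hl heq
      rcases hl.eq_or_lt with rfl | hl
      · exact h1 heq
      · exact h2 ⟨l, hl, heq⟩

theorem FanInv.old_of_not_inc {i e : ℕ} (hi : I.FanInv φ e₀ o cand i)
    (he : ¬ I.Inc e (I.ends e₀ o)) : (I.fanCfg φ e₀ o cand i).B e = φ e := by
  refine hi.old e fun l hl heq => he ?_
  rcases hl.eq_or_lt with rfl | hl
  · rw [heq]; exact hi.inc
  · rw [heq]; exact (hi.prev_inc l hl).2

theorem fanStep_V (cand : ℕ → ℕ) (κ : Cfg) : (I.fanStep cand κ).V = κ.V := by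
  simp only [Inst.fanStep, Inst.push]
  split_ifs <;> rfl

/-- If the current edge has a candidate, it conflicts with an edge of the original coloring at the
center (else `Phi` would grow), and the fan continues if this edge is new. -/
theorem FanInv.step {i : ℕ} (hi : I.FanInv φ e₀ o cand i) (h : I.Fan φ e₀ o a cand)
    (him : i < I.m) (hne : cand (I.fanEdge φ e₀ (I.ends e₀ o) cand i) ≠ 0) :
    I.find φ (I.ends e₀ o) (cand (I.fanEdge φ e₀ (I.ends e₀ o) cand i)) =
      I.fanEdge φ e₀ (I.ends e₀ o) cand (i + 1) + 1 ∧
    ((∀ l ≤ i, I.fanEdge φ e₀ (I.ends e₀ o) cand l ≠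
      I.fanEdge φ e₀ (I.ends e₀ o) cand (i + 1)) → I.FanInv φ e₀ o cand (i + 1)) := by
  have hfree := hi.free h hne
  set fe := I.fanEdge φ e₀ (I.ends e₀ o) cand with hfe
  set x := I.ends e₀ o with hx
  have hfes : fe (i + 1) = I.find φ x (cand (fe i)) - 1 := rfl
  have hsucc : I.fanCfg φ e₀ o cand (i + 1) = I.fanStep cand (I.fanCfg φ e₀ o cand i) :=
    Function.iterate_succ_apply' _ _ _
  set κ := I.fanCfg φ e₀ o cand i with hκ
  have hgain := h.noGain.fan (i + 1) him
  set κ' : Cfg := { κ with C := cand κ.E } with hκ'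
  have ok' : κ'.Ok I := ⟨hi.ok.1, hi.ok.2⟩
  have hBs : (I.fanCfg φ e₀ o cand (i + 1)).B = (I.push κ').B := by rw [hsucc]; rfl
  have hok := hi.ok.fanStep cand
  rw [← hsucc] at hok
  have hphi := Phi_le_of_score_le h.isPartial hok.1 hgain
  have hCE : κ'.C = cand (fe i) := congrArg cand hi.E_eq
  have hmem : κ'.C ∈ I.common κ'.U := by
    rw [hCE]; change _ ∈ I.common κ.U; rw [hi.U_eq]
    exact (Inst.mem_missing.1 (h.mem_missing hi.lt hi.inc hne)).1
  have hshort : I.IsShort κ'.E := by change I.IsShort κ.E; rw [hi.E_eq]; exact hi.short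
  have hunc : κ'.B κ'.E = 0 := by change κ.B κ.E = 0; rw [hi.E_eq]; exact hi.current
  have hfU : I.Free κ'.B κ'.U κ'.C := by rw [hCE]; exact hfree
  have hfind : I.find φ x (cand (fe i)) ≠ 0 := by
    intro h0
    have := lt_phi_of_free ok' hi.live hshort hunc hmem hfU (by
      rw [hCE]; change I.Free κ.B κ.V _; rw [hi.V_eq]
      exact hi.free_center hne (find_eq_zero.1 h0))
    rw [← hBs] at this
    have h2 : I.Phi κ.B = I.Phi φ := hi.phi
    change I.Phi κ.B < _ at this
    omega
  have hfind' : I.find φ x (cand (fe i)) = fe (i + 1) + 1 := by omega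
  refine ⟨hfind', fun hnew => ?_⟩
  obtain ⟨hlt, hinc, hcol⟩ := find_spec hfind'
  have hBnew : κ.B (fe (i + 1)) = cand (fe i) := by
    rw [hi.old _ fun l hl => (hnew l hl).symm, hcol]
  have hfindB : I.find κ'.B κ'.V κ'.C = fe (i + 1) + 1 := by
    rw [hCE]
    refine find_eq hi.ok.1 hne hlt ?_ hBnew
    change I.Inc _ κ.V; rw [hi.V_eq]; exact hinc
  have hcan : I.CanPush κ' := by
    obtain ⟨h1, h2, h3, h4⟩ := ok'.edge hi.live
    exact ⟨hi.live, hunc, W_ne_zero_of_mem h2 hshort hmem, find_eq_zero.2 hfU⟩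
  have hpush : (I.push κ').E = fe (i + 1) ∧ (I.push κ').live = fe (i + 1) + 1 ∧
      (I.push κ').B = recolor κ.B (fe i) (cand (fe i)) (fe (i + 1) + 1) := by
    have : κ'.E = fe i := hi.E_eq
    have hp : I.push κ' = _ := if_pos hcan
    rw [hp, hfindB]
    exact ⟨rfl, rfl, by rw [this, hCE]⟩
  have hE : (I.fanCfg φ e₀ o cand (i + 1)).E = fe (i + 1) := by rw [hsucc]; exact hpush.1
  have hV : (I.fanCfg φ e₀ o cand (i + 1)).V = x := by
    rw [hsucc, fanStep_V]; exact hi.V_eq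
  have hB := hBs.trans hpush.2.2
  have hnei : fe (i + 1) ≠ fe i := (hnew i le_rfl).symm
  constructor
  · exact hok
  · rw [hsucc]; change (I.push κ').live ≠ 0; omega
  · exact hE
  · exact hV
  · rw [hsucc]
    change I.other (I.push κ').E κ.V = _
    rw [hpush.1, hi.V_eq]
  · exact (W_ne_zero.1 (h.isPartial.weight _ hlt (by rw [hcol]; exact hne))).1
  · exact hlt
  · exact hinc
  · exact fun l hl => hnew l (by omega)
  · rw [hB]; change recolor κ.B (fe i) (cand (fe i)) (fe (i + 1) + 1) (fe (i + 1)) = 0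
    simp [recolor, hnei]
  · intro l hl
    rw [hB]
    change recolor κ.B (fe i) (cand (fe i)) (fe (i + 1) + 1) (fe l) = cand (fe l)
    have h3 := hnew l (by omega)
    rcases Nat.lt_succ_iff_lt_or_eq.1 hl with hl | rfl
    · have h1 := hi.inj l hl
      simp only [recolor]
      rw [if_neg h1, if_neg (by omega)]
      exact hi.shifted l hl
    · simp [recolor]
  · intro e he
    rw [hB]
    have h1 := he i (by omega)
    have h2 := he (i + 1) (by omega)
    change e ≠ fe i at h1
    change e ≠ fe (i + 1) at h2
    simp only [recolor]
    rw [if_neg h1, if_neg (by omega)]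
    exact hi.old e fun l hl => he l (by omega)
  · intro l hl
    rcases Nat.lt_succ_iff_lt_or_eq.1 hl with hl | rfl
    · exact hi.prev l hl
    · exact hfind'
  · intro l hl
    rcases Nat.lt_succ_iff_lt_or_eq.1 hl with hl | rfl
    · exact hi.prev_ne l hl
    · exact hne
  · intro l hl
    rcases Nat.lt_succ_iff_lt_or_eq.1 hl with hl | rfl
    · exact hi.prev_inc l hl
    · exact ⟨hi.lt, hi.inc⟩
  · refine le_antisymm hphi ?_
    have h2 : I.Phi κ.B = I.Phi φ := hi.phi
    rw [hB, ← h2]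
    have h3 := sum_recolor_succ (I := I) I.val val_zero (φ := κ.B) (e := fe i) (c := cand (fe i)) hi.lt
      hi.current hlt hnei
    have hi1 : I.Inc (fe i) x := hi.inc
    rw [hBnew, val_eq hi1 (inc_other hi1) (other_ne hi.lt hi1).symm,
      val_eq hinc (inc_other hinc) (other_ne hlt hinc).symm] at h3
    have h4 := good_of_mem (Inst.mem_missing.1 (h.mem_missing hi.lt hi.inc hne)).1
    change I.good (I.other (fe i) x) (cand (fe i)) = 1 at h4
    have h5 := I.good_le (I.other (fe (i + 1)) x) (cand (fe i))
    unfold Phi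
    omega

/-- The Kempe chain that branches off from a fan in a local maximum returns to its start. -/
theorem FanInv.walk_return {i sw c d u v : ℕ} (hi : I.FanInv φ e₀ o cand i)
    (h : I.Fan φ e₀ o a cand) (him : i ≤ I.m) (hsw : sw < 2)
    (hu : (chainStart (I.fanCfg φ e₀ o cand i) sw c d).U = u)
    (hv : (chainStart (I.fanCfg φ e₀ o cand i) sw c d).V = v)
    (hC : c ∈ I.missing (I.fanCfg φ e₀ o cand i).B u)
    (hD : d ∈ I.missing (I.fanCfg φ e₀ o cand i).B v) :
    c ≠ d ∧ ∃ k, Even k ∧ k ≠ 0 ∧ I.walk (I.fanCfg φ e₀ o cand i).B c d v k = u ∧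
      ∀ i' < k, I.Steps (I.fanCfg φ e₀ o cand i).B c d v i' := by
  have hpal : ∀ v, I.common v ⊆ I.palette := fun v => Finset.filter_subset _ _
  rw [Inst.mem_missing] at hC hD
  subst hu hv
  refine ne_and_exists_walk_return (κ := chainStart (I.fanCfg φ e₀ o cand i) sw c d)
    (chainStart_ok hi.ok sw c d) hi.live ?_ ?_ hC.1 hC.2 hD.1 hD.2 fun k hk => ?_
  · exact (congrArg I.IsShort hi.E_eq).mpr hi.short
  · exact (congrArg _ hi.E_eq).trans hi.current
  · refine (Phi_le_of_score_le h.isPartial (chain_ok (chainStart_ok hi.ok sw c d) k).1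
      (h.noGain.chain i him sw hsw c (hpal _ hC.1) d (hpal _ hD.1) k hk)).trans hi.phi.ge

end

theorem LocalMax.fan {φ : ℕ → ℕ} (hφ : I.IsPartial φ) (hmax : I.LocalMax φ) {e₀ o a : ℕ}
    (he : e₀ < I.m) (ho : o < 2) (hs : I.IsShort e₀) (h0 : φ e₀ = 0)
    (ha : a ∈ I.missing φ (I.ends e₀ (1 - o))) : ∃ cand, I.Fan φ e₀ o a cand := by
  obtain ⟨cand, h1, h2⟩ := hmax e₀ he o ho a
    (Finset.filter_subset _ _ (Inst.mem_missing.1 ha).1)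
  exact ⟨cand, hφ, he, ho, hs, h0, h1, h2, by rwa [other_ends ho]⟩

/-! ### Local maxima color all short edges -/

variable (I) in
/-- The vertex `v` has a short edge, so that the finite set `I.common v` contains all its common
colors. -/
def Active (v : ℕ) : Prop := ∃ e < I.m, I.Inc e v ∧ I.IsShort e

variable (I) in
/-- The local König condition at the vertices that matter to the local search. -/
def Konig : Prop :=
  (∃ A : Set ℕ, ∀ e < I.m, ∀ v, I.Inc e v → (v ∈ A ↔ I.other e v ∉ A)) ∧
    ∀ v, I.Active v → I.deg v ≤ (I.common v).card

variable (I) in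
/-- The local Vizing condition at the vertices that matter to the local search. -/
def Vizing : Prop :=
  ∀ v w, v ≠ w → I.Active v → I.deg v + I.mult v w ≤ (I.common v).card

variable (I) in
/-- The local Shannon condition at the vertices that matter to the local search. -/
def Shannon : Prop := ∀ v, I.Active v → 3 * I.deg v / 2 ≤ (I.common v).card

theorem card_missing_pos {φ : ℕ → ℕ} {e v : ℕ} (he : e < I.m) (hi : I.Inc e v) (h0 : φ e = 0)
    (h : I.deg v ≤ (I.common v).card) : ∃ c, c ∈ I.missing φ v := by
  apply Finset.card_pos.1
  have := card_common_le (I := I) φ v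
  have := card_colored_lt he hi h0
  omega

/-- An alternating walk of even length between the ends of the uncolored edge contradicts
bipartiteness. -/
theorem LocalMax.ne_zero_of_konig {φ : ℕ → ℕ} (hφ : I.IsPartial φ) (hmax : I.LocalMax φ)
    (hK : I.Konig) {e₀ : ℕ} (he : e₀ < I.m) (hs : I.IsShort e₀) : φ e₀ ≠ 0 := by
  intro h0
  obtain ⟨⟨A, hA⟩, hK⟩ := hK
  have act : ∀ o < 2, I.Active (I.ends e₀ o) := fun o ho => ⟨e₀, he, inc_ends ho, hs⟩
  obtain ⟨a, ha⟩ := card_missing_pos he (inc_ends (o := 1) (by omega)) h0 (hK _ (act 1 (by omega)))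
  obtain ⟨b, hb⟩ := card_missing_pos he (inc_ends (o := 0) (by omega)) h0 (hK _ (act 0 (by omega)))
  obtain ⟨cand, h⟩ := hmax.fan hφ he (o := 0) (by omega) hs h0 ha
  obtain ⟨-, k, hk, -, hret, hst⟩ := h.inv_zero.walk_return h (by omega) (sw := 0) (by omega)
    (c := a) (d := b) rfl rfl ha hb
  change I.walk φ a b (I.ends e₀ 0) k = I.ends e₀ 1 at hret
  change ∀ i < k, I.Steps φ a b (I.ends e₀ 0) i at hst
  have hside : ∀ i ≤ k, (I.walk φ a b (I.ends e₀ 0) i ∈ A ↔ (I.ends e₀ 0 ∈ A ↔ Even i)) := by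
    intro i
    induction i with
    | zero => intro; simp [walk]
    | succ i ih =>
      intro hi
      obtain ⟨e, he, hinc, -, -, hw⟩ := exists_edge_of_steps (hst i (by omega))
      have h1 := hA e he _ hinc
      rw [← hw] at h1
      have h2 := ih (by omega)
      rw [Nat.even_add_one]
      tauto
  have h1 := hside k le_rfl
  rw [hret] at h1
  have h2 := hA e₀ he _ (inc_ends (o := 0) (by omega))
  rw [other_ends (by omega)] at h2
  change _ ↔ I.ends e₀ 1 ∉ A at h2
  tauto

/-- Let `x y` be the uncolored edge with `deg y ≤ deg x`. A color `a` missing at `x` is used on an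
edge `y z`, and shifting the color to `x y` does not change `Phi`; hence `deg y ≤ deg z`, by the
choice of `Psi`. Kempe chains with a color `b` missing at `y` show that the colors missing at `x`,
and after the shift those missing at `z`, are all used at `y`, and that only `a` belongs to both
sets. Together these are more colors than there are at `y`. -/
theorem LocalMax.ne_zero_of_shannon {φ : ℕ → ℕ} (hφ : I.IsPartial φ) (hmax : I.LocalMax φ)
    (hS : I.Shannon) {e₀ : ℕ} (he : e₀ < I.m) (hs : I.IsShort e₀) : φ e₀ ≠ 0 := by
  intro h0
  have act : ∀ o < 2, I.Active (I.ends e₀ o) := fun o ho => ⟨e₀, he, inc_ends ho, hs⟩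
  obtain ⟨o, ho, hdeg⟩ : ∃ o < 2, I.deg (I.ends e₀ o) ≤ I.deg (I.ends e₀ (1 - o)) := by
    rcases le_total (I.deg (I.ends e₀ 0)) (I.deg (I.ends e₀ 1)) with h | h
    · exact ⟨0, by omega, h⟩
    · exact ⟨1, by omega, h⟩
  have ho' : 1 - o < 2 := by omega
  have hSx := hS _ (act _ ho')
  have hSy := hS _ (act _ ho)
  have hm : I.m ≠ 0 := by omega
  obtain ⟨a, ha⟩ := card_missing_pos he (inc_ends ho') h0 (by omega)
  obtain ⟨b, hb⟩ := card_missing_pos he (inc_ends ho) h0 (by omega)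
  obtain ⟨cand, h⟩ := hmax.fan hφ he ho hs h0 ha
  have hf0 : I.fanEdge φ e₀ (I.ends e₀ o) cand 0 = e₀ := rfl
  have ha0 : a ≠ 0 := by
    rintro rfl; exact zero_notMem_common _ _ (Inst.mem_missing.1 ha).1
  have hb0 : b ≠ 0 := by
    rintro rfl; exact zero_notMem_common _ _ (Inst.mem_missing.1 hb).1
  have i0 := h.inv_zero
  obtain ⟨hfind, hstep⟩ := i0.step h (by omega) (by rw [hf0, h.isCand.first]; exact ha0)
  rw [hf0, h.isCand.first] at hfind
  set e₁ := I.fanEdge φ e₀ (I.ends e₀ o) cand 1 with he₁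
  obtain ⟨h1m, h1i, h1c⟩ := find_spec hfind
  have hne : e₁ ≠ e₀ := by
    intro heq
    rw [heq, h0] at h1c
    exact ha0 h1c.symm
  have i1 := hstep fun l hl => by
    obtain rfl : l = 0 := by omega
    exact hne.symm
  rw [zero_add] at i1
  set y := I.ends e₀ o with hy
  set x := I.ends e₀ (1 - o) with hx
  set φ₁ := (I.fanCfg φ e₀ o cand 1).B with hφ₁
  have hB0 : φ₁ e₀ = a := by
    have := i1.shifted 0 (by omega)
    rwa [hf0, h.isCand.first] at this
  have hB1 : φ₁ e₁ = 0 := i1.current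
  have hBold : ∀ e, e ≠ e₀ → e ≠ e₁ → φ₁ e = φ e := fun e h1 h2 => i1.old e fun l hl => by
    rcases Nat.le_one_iff_eq_zero_or_eq_one.1 hl with rfl | rfl
    · exact h1
    · exact h2
  have hrec : φ₁ = recolor φ e₀ a (e₁ + 1) := by
    funext e
    simp only [recolor]
    split_ifs with h1 h2
    · rw [h1, hB0]
    · rw [show e = e₁ by omega, hB1]
    · exact hBold e h1 (by omega)
  set z := I.other e₁ y with hz
  have hiz : I.Inc e₁ z := inc_other h1i
  have hyz : z ≠ y := other_ne h1m h1i
  have hyx : y ≠ x := by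
    rw [hx, ← other_ends ho]; exact (other_ne he (inc_ends ho)).symm
  by_cases hdz : I.deg z < I.deg y
  · have h1 := Psi_le_of_score_le hφ i1.ok.1 (h.noGain.fan 1 (by omega)) i1.phi.ge
    rw [← hφ₁, hrec] at h1
    have h2 := sum_recolor_succ (I := I) I.dval dval_zero (c := a) he h0 h1m hne
    rw [h1c, dval_eq h1i hiz hyz.symm ha0, dval_eq (u := y) (v := x) (inc_ends ho) (inc_ends ho') hyx ha0] at h2
    unfold Psi at h1
    omega
  -- from here on `deg y ≤ deg z`
  have hX : ∀ c ∈ I.missing φ x, ∃ k, Even k ∧ k ≠ 0 ∧ I.walk φ c b y k = x ∧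
      ∀ i < k, I.Steps φ c b y i := fun c hc =>
    (i0.walk_return h (by omega) (sw := 0) (by omega) (c := c) (d := b) rfl rfl hc hb).2
  have hU1 : (I.fanCfg φ e₀ o cand 1).U = z := i1.U_eq
  have hV1 : (I.fanCfg φ e₀ o cand 1).V = y := i1.V_eq
  have hb1 : b ∈ I.missing φ₁ y :=
    Inst.mem_missing.2 ⟨(Inst.mem_missing.1 hb).1, i1.free_center hb0 (Inst.mem_missing.1 hb).2⟩
  have hZ : ∀ c ∈ I.missing φ₁ z, ∃ k, Even k ∧ k ≠ 0 ∧ I.walk φ₁ c b y k = z ∧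
      ∀ i < k, I.Steps φ₁ c b y i := by
    intro c hc
    exact (i1.walk_return h (by omega) (sw := 0) (by omega) (c := c) (d := b) hU1 hV1 hc hb1).2
  have hsubX : I.missing φ x ⊆ (I.colored φ y).image φ := by
    intro c hc
    obtain ⟨k, -, hk0, -, hst⟩ := hX c hc
    obtain ⟨e, hem, hei, hec, -⟩ := exists_edge_of_steps (hst 0 (by omega))
    rw [if_pos Even.zero] at hec
    refine Finset.mem_image.2 ⟨e, ?_, hec⟩
    simp only [colored, Finset.mem_filter, Finset.mem_range]
    refine ⟨hem, hei, ?_⟩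
    rw [hec]; rintro rfl; exact zero_notMem_common _ _ (Inst.mem_missing.1 hc).1
  have hsubZ : I.missing φ₁ z ⊆ (I.colored φ y).image φ := by
    intro c hc
    have hc0 : c ≠ 0 := by rintro rfl; exact zero_notMem_common _ _ (Inst.mem_missing.1 hc).1
    obtain ⟨k, -, hk0, -, hst⟩ := hZ c hc
    obtain ⟨e, hem, hei, hec, -⟩ := exists_edge_of_steps (hst 0 (by omega))
    rw [if_pos Even.zero] at hec
    simp only [colored, Finset.mem_image, Finset.mem_filter, Finset.mem_range]
    by_cases h1 : e = e₀
    · rw [h1, hB0] at hec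
      exact ⟨e₁, ⟨h1m, h1i, by rw [h1c]; exact ha0⟩, by rw [h1c, hec]⟩
    · have h2 : e ≠ e₁ := by rintro rfl; rw [hB1] at hec; exact hc0 hec.symm
      rw [hBold e h1 h2] at hec
      exact ⟨e, ⟨hem, hei, by rw [hec]; exact hc0⟩, hec⟩
  have hinter : I.missing φ x ∩ I.missing φ₁ z ⊆ {a} := by
    intro c hc
    rw [Finset.mem_inter] at hc
    rw [Finset.mem_singleton]
    by_contra hca
    have hcx := (Inst.mem_missing.1 hc.1).2
    have hcz := (Inst.mem_missing.1 hc.2).2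
    have hc0 : c ≠ 0 := by rintro rfl; exact zero_notMem_common _ _ (Inst.mem_missing.1 hc.1).1
    obtain ⟨k, hke, hk0, hret, hst⟩ := hX c hc.1
    obtain ⟨k', hke', hk0', hret', hst'⟩ := hZ c hc.2
    have hba : b ≠ a := by
      rintro rfl
      exact (Inst.mem_missing.1 hb).2 e₁ h1m h1i h1c
    have hagree : ∀ d, d ≠ a → d ≠ 0 → ∀ e < I.m, φ e = d ↔ φ₁ e = d := by
      intro d hda hd0 e _
      by_cases h1 : e = e₀
      · subst h1; rw [h0, hB0]; exact ⟨fun h => absurd h.symm hd0, fun h => absurd h.symm hda⟩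
      by_cases h2 : e = e₁
      · subst h2; rw [h1c, hB1]; exact ⟨fun h => absurd h.symm hda, fun h => absurd h.symm hd0⟩
      rw [hBold e h1 h2]
    have hwalk := walk_congr (hagree c hca hc0) (hagree b hba hb0) y
    -- the two walks agree, since `a` is the only color moved; but one ends at `x`, the other at `z`
    rcases lt_trichotomy k k' with hlt | rfl | hlt
    · obtain ⟨e, hem, hei, hec, -⟩ := exists_edge_of_steps (hst' k hlt)
      rw [if_pos hke] at hec
      rw [← hwalk, hret] at hei
      exact hcx e hem hei ((hagree c hca hc0 e hem).2 hec)
    · rw [← hwalk, hret] at hret'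
      have : I.Inc e₁ x := hret' ▸ hiz
      exact (Inst.mem_missing.1 ha).2 e₁ h1m this h1c
    · obtain ⟨e, hem, hei, hec, -⟩ := exists_edge_of_steps (hst k' hlt)
      rw [if_pos hke'] at hec
      rw [hwalk, hret'] at hei
      exact hcz e hem hei ((hagree c hca hc0 e hem).1 hec)
  have hcard := Finset.card_union_add_card_inter (I.missing φ x) (I.missing φ₁ z)
  have hc1 := (Finset.card_le_card (Finset.union_subset hsubX hsubZ)).trans Finset.card_image_le
  have hc2 := Finset.card_le_card hinter
  rw [Finset.card_singleton] at hc2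
  have hc3 := card_colored_lt he (inc_ends ho) h0
  have hc4 := card_common_le (I := I) φ x
  have hc5 := card_colored_lt he (inc_ends ho') h0
  have hc6 := card_common_le (I := I) φ₁ z
  have hc7 := card_colored_lt h1m hiz hB1
  have hc8 := hS z ⟨e₁, h1m, hiz, i1.short⟩
  rw [← hy] at hc3
  rw [← hx] at hc5
  omega

/-- The argument of Vizing, Berge and Fournier: every edge of the fan has a candidate, so that the
fan runs into an edge `fe (s + 1) = fe (k + 1)` that it has met before. The candidates of `fe s` and
`fe k` are then the same color `γ`. With a color `b` missing at the center, the chain of the colors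
`γ` and `b` would have to join the center to the far end of `fe s` in the fan after `s` steps and to
the far end of `fe k` after `k` steps; the second walk passes through the far end of `fe s` and
follows the first one from there until it gets stuck next to the center, and the first walk does not
pass through the far end of `fe k` in between, since `γ` is missing there. -/
theorem LocalMax.ne_zero_of_vizing {φ : ℕ → ℕ} (hφ : I.IsPartial φ) (hmax : I.LocalMax φ)
    (hV : I.Vizing) {e₀ : ℕ} (he : e₀ < I.m) (hs : I.IsShort e₀) : φ e₀ ≠ 0 := by
  intro h0
  have hmiss : ∀ v w, v ≠ w → I.Active v → I.mult v w ≤ (I.missing φ v).card := by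
    intro v w hvw hv
    have h1 := hV v w hvw hv
    have h2 := card_common_le (I := I) φ v
    have h3 := card_colored_le (I := I) φ v
    omega
  have act : ∀ o < 2, I.Active (I.ends e₀ o) := fun o ho => ⟨e₀, he, inc_ends ho, hs⟩
  have hdeg : ∀ o < 2, I.deg (I.ends e₀ o) ≤ (I.common (I.ends e₀ o)).card := fun o ho =>
    (Nat.le_add_right _ _).trans (hV _ _ (Nat.succ_ne_self _).symm (act o ho))
  obtain ⟨a, ha⟩ := card_missing_pos he (inc_ends (o := 1) (by omega)) h0 (hdeg 1 (by omega))
  obtain ⟨b, hb⟩ := card_missing_pos he (inc_ends (o := 0) (by omega)) h0 (hdeg 0 (by omega))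
  obtain ⟨cand, h⟩ := hmax.fan hφ he (o := 0) (by omega) hs h0 ha
  have ha0 : a ≠ 0 := by
    rintro rfl; exact zero_notMem_common _ _ (Inst.mem_missing.1 ha).1
  have hb0 : b ≠ 0 := by
    rintro rfl; exact zero_notMem_common _ _ (Inst.mem_missing.1 hb).1
  set x := I.ends e₀ 0 with hx
  set fe := I.fanEdge φ e₀ x cand with hfe
  have hcand : ∀ e < I.m, I.Inc e x → I.IsShort e → cand e ≠ 0 := by
    intro e hem hei hes
    by_cases hee : e = e₀
    · rw [hee, h.isCand.first]; exact ha0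
    · refine h.isCand.total e hem hee hei ?_
      have := hmiss (I.other e x) x (other_ne hem hei) ⟨e, hem, inc_other hei, hes⟩
      have hcomm : I.mult (I.other e x) x = I.mult x (I.other e x) := by
        unfold mult; congr 1; ext; simp only [Finset.mem_filter]; tauto
      rwa [hcomm] at this
  -- the fan runs until an edge is repeated
  have hrun : ∀ i ≤ I.m, (∀ l ≤ i, I.FanInv φ e₀ 0 cand l) ∨
      ∃ k < i, (∀ l ≤ k, I.FanInv φ e₀ 0 cand l) ∧ ∃ j ≤ k, fe j = fe (k + 1) := by
    intro i
    induction i with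
    | zero =>
      intro _
      left
      intro l hl
      obtain rfl : l = 0 := by omega
      exact h.inv_zero
    | succ i ih =>
      intro hi
      rcases ih (by omega) with h1 | ⟨k, hk, h1⟩
      · by_cases hrep : ∃ j ≤ i, fe j = fe (i + 1)
        · exact Or.inr ⟨i, by omega, h1, hrep⟩
        · left
          push Not at hrep
          intro l hl
          rcases Nat.le_succ_iff.1 hl with hl | rfl
          · exact h1 l hl
          · have hi' := h1 i le_rfl
            exact (hi'.step h (by omega) (hcand _ hi'.lt hi'.inc hi'.short)).2 hrep
      · exact Or.inr ⟨k, by omega, h1⟩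
  obtain ⟨k, hk, hinv, j, hj, hjk⟩ : ∃ k < I.m, (∀ l ≤ k, I.FanInv φ e₀ 0 cand l) ∧
      ∃ j ≤ k, fe j = fe (k + 1) := by
    rcases hrun I.m le_rfl with h1 | h1
    · exfalso
      obtain ⟨i, hi, j, hj, hij, heq⟩ := Finset.exists_ne_map_eq_of_card_lt_of_maps_to
        (s := Finset.range (I.m + 1)) (t := Finset.range I.m) (f := fe) (by simp)
        fun i hi => by
          have := (h1 i (by have := Finset.mem_range.1 hi; omega)).lt
          simp only [Finset.coe_range, Set.mem_Iio]; exact this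
      rw [Finset.mem_range] at hi hj
      rcases lt_or_gt_of_ne hij with hlt | hlt
      · exact (h1 j (by omega)).inj i hlt heq
      · exact (h1 i (by omega)).inj j hlt heq.symm
    · exact h1
  have ik := hinv k le_rfl
  have hck := hcand _ ik.lt ik.inc ik.short
  obtain ⟨hfindk, -⟩ := ik.step h hk hck
  obtain ⟨hjm, hjx, hjc⟩ := find_spec hfindk
  change fe (k + 1) < I.m at hjm
  change I.Inc (fe (k + 1)) x at hjx
  change φ (fe (k + 1)) = cand (fe k) at hjc
  rw [← hjk] at hjm hjx hjc
  have hj0 : j ≠ 0 := by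
    rintro rfl
    exact hck (hjc.symm.trans h0)
  obtain ⟨s, rfl⟩ := Nat.exists_eq_succ_of_ne_zero hj0
  rw [Nat.succ_eq_add_one] at *
  have is := hinv s (by omega)
  have hcs := hcand _ is.lt is.inc is.short
  have hss : φ (fe (s + 1)) = cand (fe s) := by
    have := (find_spec (is.step h (by omega) hcs).1).2.2
    exact this
  have hγ : cand (fe s) = cand (fe k) := hss.symm.trans hjc
  set γ := cand (fe k) with hγk
  have hfs := is.free h hcs
  have hfk := ik.free h hck
  rw [is.U_eq] at hfs
  rw [ik.U_eq] at hfk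
  change I.Free _ (I.other (fe s) x) (cand (fe s)) at hfs
  change I.Free _ (I.other (fe k) x) γ at hfk
  rw [hγ] at hfs
  set A := (I.fanCfg φ e₀ 0 cand s).B with hA
  set B := (I.fanCfg φ e₀ 0 cand k).B with hB
  set ys := I.other (fe s) x with hys
  set yk := I.other (fe k) x with hyk
  have hms : γ ∈ I.missing φ ys := hγ ▸ h.mem_missing is.lt is.inc hcs
  have hmk : γ ∈ I.missing φ yk := h.mem_missing ik.lt ik.inc hck
  have hbA : b ∈ I.missing A x :=
    Inst.mem_missing.2 ⟨(Inst.mem_missing.1 hb).1, is.free_center hb0 (Inst.mem_missing.1 hb).2⟩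
  have hbB : b ∈ I.missing B x :=
    Inst.mem_missing.2 ⟨(Inst.mem_missing.1 hb).1, ik.free_center hb0 (Inst.mem_missing.1 hb).2⟩
  have hγA : γ ∈ I.missing A ys := Inst.mem_missing.2 ⟨(Inst.mem_missing.1 hms).1, hfs⟩
  have hγB : γ ∈ I.missing B yk := Inst.mem_missing.2 ⟨(Inst.mem_missing.1 hmk).1, hfk⟩
  have hUs : (I.fanCfg φ e₀ 0 cand s).U = ys := is.U_eq
  have hVs : (I.fanCfg φ e₀ 0 cand s).V = x := is.V_eq
  have hUk : (I.fanCfg φ e₀ 0 cand k).U = yk := ik.U_eq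
  have hVk : (I.fanCfg φ e₀ 0 cand k).V = x := ik.V_eq
  have retA : b ≠ γ ∧ ∃ p, Even p ∧ p ≠ 0 ∧ I.walk A b γ ys p = x ∧
      ∀ i < p, I.Steps A b γ ys i := by
    exact is.walk_return h (by omega) (sw := 1) (by omega) hVs hUs hbA hγA
  have retB : γ ≠ b ∧ ∃ p, Even p ∧ p ≠ 0 ∧ I.walk B γ b x p = yk ∧
      ∀ i < p, I.Steps B γ b x i := by
    exact ik.walk_return h (by omega) (sw := 0) (by omega) hUk hVk hγB hbB
  obtain ⟨hbγ, p, hp, hp0, hpx, hpst⟩ := retA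
  obtain ⟨-, q, hq, hq0, hqy, hqst⟩ := retB
  have hpA := is.ok.1
  have hpB := ik.ok.1
  rw [← hA] at hpA
  rw [← hB] at hpB
  have hxA : ∀ i < p, I.walk A b γ ys i ≠ x := fun i hi =>
    hpx ▸ walk_injective hpA hb0 hck hfs hpst hi le_rfl
  -- a shifted edge of color `γ` is the `s`-th one
  have hshift : ∀ l < k, cand (fe l) = γ → l = s := by
    intro l hl hlγ
    have h1 := ik.prev l hl
    change I.find φ x (cand (fe l)) = fe (l + 1) + 1 at h1
    have h2 : I.find φ x (cand (fe s)) = fe (s + 1) + 1 := ik.prev s (by omega)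
    rw [hlγ] at h1
    rw [hγ, h1] at h2
    have h3 : fe (l + 1) = fe (s + 1) := by omega
    rcases lt_trichotomy l s with h4 | h4 | h4
    · exact absurd h3 ((hinv (s + 1) hj).inj (l + 1) (by omega))
    · exact h4
    · exact absurd h3.symm ((hinv (l + 1) hl).inj (s + 1) (by omega))
  have hBs : B (fe s) = γ := (ik.shifted s (by omega)).trans hγ
  -- after `k` steps the walk from the center first enters `ys` by the edge `fe s`, and then follows
  -- the walk that starts there after `s` steps
  have hcomp : ∀ i < p, I.walk B γ b x (i + 1) = I.walk A b γ ys i := by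
    intro i
    induction i with
    | zero =>
      intro _
      change I.nb B x (if Even 0 then γ else b) = ys
      rw [if_pos Even.zero, nb, find_eq hpB hck is.lt is.inc hBs]
      rfl
    | succ i ih =>
      intro hi
      have hi' := ih (by omega)
      obtain ⟨e, hem, hei, hec, -, hw⟩ := exists_edge_of_steps (hpst i (by omega))
      rw [hw, walk, hi']
      have hcol : (if Even (i + 1) then γ else b) = if Even i then b else γ := by
        simp only [Nat.even_add_one]; split_ifs <;> rfl
      have hex : ¬ I.Inc e x := by
        intro hex
        rcases eq_or_eq_other hei hex with h1 | h1
        · exact hxA i (by omega) h1.symm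
        · exact hxA (i + 1) hi (hw.trans h1.symm)
      have hBe : B e = A e := (ik.old_of_not_inc hex).trans (is.old_of_not_inc hex).symm
      rw [hcol, nb, find_eq hpB (by split_ifs <;> assumption) hem hei (hBe.trans hec)]
      rfl
  obtain ⟨p', rfl⟩ := Nat.exists_eq_succ_of_ne_zero hp0
  rw [Nat.succ_eq_add_one] at *
  have hp' : ¬ Even p' := by rw [Nat.even_add_one] at hp; exact hp
  have hjnew : ∀ l ≤ s, fe (s + 1) ≠ fe l := fun l hl =>
    ((hinv (s + 1) hj).inj l (by omega)).symm
  have hlast : I.walk A b γ ys p' = I.other (fe (s + 1)) x := by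
    obtain ⟨e, hem, hei, hec, -, hw⟩ := exists_edge_of_steps (hpst p' (by omega))
    rw [if_neg hp'] at hec
    have hex : I.Inc e x := by rw [← hpx, hw]; exact inc_other hei
    have hAj : A (fe (s + 1)) = γ := (is.old _ hjnew).trans hjc
    have : e = fe (s + 1) :=
      hpA.inj e hem _ hjm x hex hjx (hec.trans hAj.symm) (by rw [hec]; exact hck)
    rw [← this, ← hpx, hw, other_other hei]
  -- where the first walk uses the edge `fe (s + 1)`, the second one cannot go on
  have hfj : I.Free B (I.other (fe (s + 1)) x) γ := by
    intro e hem hei hec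
    by_cases h1 : e = fe k
    · rw [h1] at hec; exact hck (hec.symm.trans ik.current)
    by_cases h2 : ∃ l < k, e = fe l
    · obtain ⟨l, hl, rfl⟩ := h2
      obtain rfl := hshift l hl ((ik.shifted l hl).symm.trans hec)
      have : I.other (fe (l + 1)) x = ys :=
        (other_eq is.inc hei (other_ne hjm hjx).symm).symm
      exact (Inst.mem_missing.1 hms).2 _ hjm (this ▸ inc_other hjx) hjc
    · have hold : ∀ l ≤ k, e ≠ fe l := fun l hl heq => by
        rcases hl.eq_or_lt with rfl | hl
        · exact h1 heq
        · exact h2 ⟨l, hl, heq⟩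
      have hφe := (ik.old e hold).symm.trans hec
      exact hold (s + 1) hj (hφ.inj e hem _ hjm _ hei (inc_other hjx) (hφe.trans hjc.symm)
        (by rw [hφe]; exact hck))
  have hqp : q ≤ p' + 1 := by
    by_contra hlt
    have h1 := hqst (p' + 1) (by omega)
    unfold Steps at h1
    rw [if_pos hp, hcomp p' (by omega), hlast] at h1
    exact h1 hfj
  obtain ⟨q', rfl⟩ := Nat.exists_eq_succ_of_ne_zero hq0
  rw [Nat.succ_eq_add_one] at *
  have hq' : ¬ Even q' := by rw [Nat.even_add_one] at hq; exact hq
  -- the first walk goes on at the far end of `fe k`, where `γ` is missing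
  obtain ⟨e, hem, hei, hec, -⟩ := exists_edge_of_steps (hpst q' (by omega))
  rw [if_neg hq'] at hec
  rw [← hcomp q' (by omega), hqy] at hei
  by_cases h1 : e = fe s
  · rw [h1] at hec; exact hck (hec.symm.trans is.current)
  by_cases h2 : ∃ l < s, e = fe l
  · obtain ⟨l, hl, rfl⟩ := h2
    have := hshift l (by omega) ((is.shifted l hl).symm.trans hec)
    omega
  · have hold : ∀ l ≤ s, e ≠ fe l := fun l hl heq => by
      rcases hl.eq_or_lt with rfl | hl
      · exact h1 heq
      · exact h2 ⟨l, hl, heq⟩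
    exact (Inst.mem_missing.1 hmk).2 e hem hei ((is.old e hold).symm.trans hec)

theorem LocalMax.ne_zero {φ : ℕ → ℕ} (hφ : I.IsPartial φ) (hmax : I.LocalMax φ)
    (h : I.Shannon ∨ I.Vizing ∨ I.Konig) {e : ℕ} (he : e < I.m) (hs : I.IsShort e) : φ e ≠ 0 := by
  rcases h with h | h | h
  · exact hmax.ne_zero_of_shannon hφ h he hs
  · exact hmax.ne_zero_of_vizing hφ h he hs
  · exact hmax.ne_zero_of_konig hφ h he hs

end Inst

/-! ### Verification of programs -/

namespace RAM

theorem Mem.write_of_ne {s : Mem} {a a' i j v : ℕ} (h : a' ≠ a) : s.write a i j v a' = s a' := by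
  funext i' j'
  simp [Mem.write, h]

theorem Mem.write_same {s : Mem} {a i j v : ℕ} (i' j' : ℕ) :
    s.write a i j v a i' j' = if i' = i ∧ j' = j then v else s a i' j' := by
  simp [Mem.write]

namespace Exp

/-- A scalar variable is the cell `(0, 0)` of an array of its own. -/
abbrev var (a : ℕ) : Exp := .read a (.lit 0) (.lit 0)

/-- The test whether `x` and `y` have the same value. -/
def eq (x y : Exp) : Exp := .sub (.lit 1) (.add (.sub x y) (.sub y x))

/-- The conjunction of two tests. -/
def and (x y : Exp) : Exp := .sub (.lit 1) (.add (.sub (.lit 1) x) (.sub (.lit 1) y))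

theorem eval_eq {s : Mem} {x y : Exp} : (eq x y).eval s ≠ 0 ↔ x.eval s = y.eval s := by
  simp only [eq, eval]
  omega

theorem eval_and {s : Mem} {x y : Exp} :
    (and x y).eval s ≠ 0 ↔ x.eval s ≠ 0 ∧ y.eval s ≠ 0 := by
  simp only [and, eval]
  omega

end Exp

namespace Prog

/-- The assignment to a scalar variable. -/
abbrev set (a : ℕ) (x : Exp) : Prog := .assign a (.lit 0) (.lit 0) x

/-- The loop over `v = 0, …, b - 1`. -/
def forP (v : ℕ) (b : Exp) (P : Prog) : Prog :=
  .seq (set v (.lit 0)) (.loop (.sub b (.var v)) (.seq P (set v (.add (.var v) (.lit 1)))))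

/-- The numbers of the arrays to which a program may write, with repetitions. -/
def writes : Prog → List ℕ
  | skip => []
  | assign a _ _ _ => [a]
  | seq P Q => P.writes ++ Q.writes
  | cond _ P Q => P.writes ++ Q.writes
  | loop _ P => P.writes

/-- A bound for the running time of a program in which each loop is executed at most `N` times
whenever it is entered. -/
def time (N : ℕ) : Prog → ℕ
  | skip => 1
  | assign _ _ _ _ => 1
  | seq P Q => P.time N + Q.time N
  | cond _ P Q => 1 + (P.time N + Q.time N)
  | loop _ P => N * (P.time N + 1) + 1

theorem exists_polynomial_time (P : Prog) :
    ∃ q : Polynomial ℕ, ∀ N, P.time N = q.eval N := by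
  induction P with
  | skip => exact ⟨1, fun N => by simp [time]⟩
  | assign => exact ⟨1, fun N => by simp [time]⟩
  | seq P Q hP hQ =>
    obtain ⟨p, hp⟩ := hP
    obtain ⟨q, hq⟩ := hQ
    exact ⟨p + q, fun N => by simp [time, hp, hq]⟩
  | cond b P Q hP hQ =>
    obtain ⟨p, hp⟩ := hP
    obtain ⟨q, hq⟩ := hQ
    exact ⟨1 + (p + q), fun N => by simp [time, hp, hq]⟩
  | loop b P hP =>
    obtain ⟨p, hp⟩ := hP
    exact ⟨Polynomial.X * (p + 1) + 1, fun N => by simp [time, hp]⟩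

end Prog

/-- The memories agree except for the arrays with numbers in `l`. -/
def SameOff (l : List ℕ) (s s' : Mem) : Prop := ∀ a, a ∉ l → s' a = s a

theorem Runs.sameOff {P : Prog} {s s' : Mem} {t : ℕ} (h : Runs P s t s') :
    SameOff P.writes s s' := by
  induction h with
  | skip => exact fun _ _ => rfl
  | assign a i j x s =>
    intro b hb
    exact Mem.write_of_ne (by simpa [Prog.writes] using hb)
  | seq _ _ ih1 ih2 =>
    intro a ha
    simp only [Prog.writes, List.mem_append, not_or] at ha
    rw [ih2 a ha.2, ih1 a ha.1]
  | cond_true _ _ ih =>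
    intro a ha
    simp only [Prog.writes, List.mem_append, not_or] at ha
    exact ih a ha.1
  | cond_false _ _ ih =>
    intro a ha
    simp only [Prog.writes, List.mem_append, not_or] at ha
    exact ih a ha.2
  | loop_true _ _ _ ih1 ih2 =>
    intro a ha
    rw [ih2 a ha, ih1 a ha]
  | loop_false => exact fun _ _ => rfl

/-- Total correctness with a time bound: started with the memory `s`, the program `P` halts within
`P.time N` steps with a memory that satisfies `Q`. -/
def Does (N : ℕ) (P : Prog) (s : Mem) (Q : Mem → Prop) : Prop :=
  ∃ t s', Runs P s t s' ∧ t ≤ P.time N ∧ Q s'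

variable {N : ℕ} {P P' : Prog} {s : Mem} {Q R : Mem → Prop}

theorem Does.mono (h : Does N P s Q) (hQ : ∀ s', SameOff P.writes s s' → Q s' → R s') :
    Does N P s R := by
  obtain ⟨t, s', hr, ht, hq⟩ := h
  exact ⟨t, s', hr, ht, hQ s' hr.sameOff hq⟩

theorem does_skip (h : Q s) : Does N .skip s Q := ⟨1, s, .skip s, le_rfl, h⟩

theorem does_assign {a : ℕ} {i j x : Exp} (h : Q (s.write a (i.eval s) (j.eval s) (x.eval s))) :
    Does N (.assign a i j x) s Q := ⟨1, _, .assign a i j x s, le_rfl, h⟩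

theorem does_set {a : ℕ} {x : Exp} (h : Q (s.write a 0 0 (x.eval s))) :
    Does N (.set a x) s Q := does_assign h

theorem does_seq (h : Does N P s Q)
    (h' : ∀ s', SameOff P.writes s s' → Q s' → Does N P' s' R) : Does N (.seq P P') s R := by
  obtain ⟨t, s', hr, ht, hq⟩ := h
  obtain ⟨t', s'', hr', ht', hq'⟩ := h' s' hr.sameOff hq
  exact ⟨t + t', s'', .seq hr hr', Nat.add_le_add ht ht', hq'⟩

theorem does_set_seq {a : ℕ} {x : Exp} (h : Does N P (s.write a 0 0 (x.eval s)) Q) :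
    Does N (.seq (.set a x) P) s Q := by
  obtain ⟨t, s', hr, ht, hq⟩ := h
  exact ⟨1 + t, s', .seq (.assign _ _ _ _ _) hr, Nat.add_le_add le_rfl ht, hq⟩

theorem does_assign_seq {a : ℕ} {i j x : Exp}
    (h : Does N P (s.write a (i.eval s) (j.eval s) (x.eval s)) Q) :
    Does N (.seq (.assign a i j x) P) s Q := by
  obtain ⟨t, s', hr, ht, hq⟩ := h
  exact ⟨1 + t, s', .seq (.assign _ _ _ _ _) hr, Nat.add_le_add le_rfl ht, hq⟩

theorem does_cond {b : Exp} (h : b.eval s ≠ 0 → Does N P s Q) (h' : b.eval s = 0 → Does N P' s Q) :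
    Does N (.cond b P P') s Q := by
  by_cases hb : b.eval s = 0
  · obtain ⟨t, s', hr, ht, hq⟩ := h' hb
    exact ⟨1 + t, s', .cond_false hb hr, by simp only [Prog.time]; omega, hq⟩
  · obtain ⟨t, s', hr, ht, hq⟩ := h hb
    exact ⟨1 + t, s', .cond_true hb hr, by simp only [Prog.time]; omega, hq⟩

/-- The rule for loops with an invariant `J` and a variant `μ`. -/
theorem does_loop {b : Exp} (J : Mem → Prop) (μ : Mem → ℕ)
    (hstep : ∀ s, J s → b.eval s ≠ 0 → μ s ≠ 0 ∧ Does N P s fun s' => J s' ∧ μ s' < μ s)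
    (h0 : J s) (hμ : μ s ≤ N) : Does N (.loop b P) s fun s' => J s' ∧ b.eval s' = 0 := by
  have key : ∀ k s, J s → μ s ≤ k → ∃ t s', Runs (.loop b P) s t s' ∧
      t ≤ k * (P.time N + 1) + 1 ∧ J s' ∧ b.eval s' = 0 := by
    intro k
    induction k with
    | zero =>
      intro s hJ hk
      by_cases hb : b.eval s = 0
      · exact ⟨1, s, .loop_false hb, by omega, hJ, hb⟩
      · exact absurd (Nat.le_zero.1 hk) (hstep s hJ hb).1
    | succ k ih =>
      intro s hJ hk
      by_cases hb : b.eval s = 0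
      · exact ⟨1, s, .loop_false hb, by omega, hJ, hb⟩
      · obtain ⟨t, s', hr, ht, hJ', hlt⟩ := (hstep s hJ hb).2
        obtain ⟨t', s'', hr', ht', hq⟩ := ih s' hJ' (by omega)
        exact ⟨1 + t + t', s'', .loop_true hb hr hr', by rw [Nat.succ_mul]; omega, hq⟩
  obtain ⟨t, s', hr, ht, hq⟩ := key _ s h0 hμ
  exact ⟨t, s', hr, ht, hq⟩

/-- The rule for counting loops. The bound may be recomputed in each round, and the invariant must
not depend on the loop variable. -/
theorem does_for {v k : ℕ} {b : Exp} (J : ℕ → Mem → Prop) (hv : v ∉ P.writes) (hk : k ≤ N)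
    (hb : ∀ s', SameOff (v :: P.writes) s s' → b.eval s' = k)
    (hJ : ∀ i s x, J i s → J i (s.write v 0 0 x)) (h0 : J 0 s)
    (hstep : ∀ i < k, ∀ s', SameOff (v :: P.writes) s s' → s' v 0 0 = i → J i s' →
      Does N P s' (J (i + 1))) : Does N (.forP v b P) s (J k) := by
  unfold Prog.forP
  apply does_set_seq
  have := does_loop (N := N) (b := .sub b (.var v))
    (P := .seq P (.set v (.add (.var v) (.lit 1)))) (s := s.write v 0 0 0)
    (fun s' => SameOff (v :: P.writes) s s' ∧ s' v 0 0 ≤ k ∧ J (s' v 0 0) s')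
    (fun s' => k - s' v 0 0) ?_ ?_ ?_
  · refine this.mono fun s' _ ⟨⟨h1, h2, h3⟩, h4⟩ => ?_
    have h5 := hb s' h1
    simp only [Exp.eval] at h4
    obtain h6 : s' v 0 0 = k := by omega
    rwa [h6] at h3
  · rintro s' ⟨h1, h2, h3⟩ h4
    have h5 := hb s' h1
    simp only [Exp.eval] at h4
    refine ⟨by omega, ?_⟩
    refine does_seq (hstep _ (by omega) s' h1 rfl h3) fun s'' hs hJ' => ?_
    have h6 : s'' v 0 0 = s' v 0 0 := by rw [hs v hv]
    apply does_set
    have h7 : (s''.write v 0 0 ((Exp.add (.var v) (.lit 1)).eval s'')) v 0 0 = s' v 0 0 + 1 := by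
      simp [Mem.write_same, Exp.eval, h6]
    rw [h7]
    refine ⟨⟨fun a ha => ?_, by omega, hJ _ _ _ hJ'⟩, by omega⟩
    simp only [List.mem_cons, not_or] at ha
    rw [Mem.write_of_ne ha.1, hs a ha.2]
    exact h1 a (by simp [ha])
  · refine ⟨fun a ha => ?_, ?_, ?_⟩
    · simp only [List.mem_cons, not_or] at ha
      exact Mem.write_of_ne ha.1
    · simp [Mem.write_same]
    · have : s.write v 0 0 0 v 0 0 = 0 := by simp [Mem.write_same]
      rw [this]
      exact hJ _ _ _ h0
  · simp only [Mem.write_same]; simp; omega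

end RAM

/-! ### The building blocks of the program

The arrays are used as follows; scalar variables occupy the cell `(0, 0)` of an array.

* `0`, `1`, `2`: the input, `3`: the output;
* `4`: the trial coloring `Cfg.B`, `9`: the current coloring, both in column `0`;
* `5`: the table of the weights `Inst.W`, `6`: the table of the bonuses `Inst.F`, `7`: the degrees,
  `10`: the constant `Inst.K`;
* `8`: the candidate colors of a fan, `11`: whether the current coloring has changed in this round;
* `20`, …, `25`: the fields `E`, `U`, `V`, `C`, `D`, `live` of `Inst.Cfg`;
* `26`: the result of a search for an edge, `29`, `30`: scores;
* `40`, `41`, `44`: the first edge, the center, and the first color of a fan, `45`: the number of fan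
  steps, `46`: the direction of a Kempe chain, `49`, `52`: its colors;
* all others: loop variables and auxiliary variables. -/

namespace RAM

open Exp Prog

/-- The number of vertices. -/
def nE : Exp := .read 0 (.lit 0) (.lit 0)
/-- The number of edges. -/
def mE : Exp := .read 0 (.lit 0) (.lit 1)
/-- The end number `o` of the edge `e`. -/
def endE (e o : Exp) : Exp := .read 1 e o
/-- The end of `e` other than `v`, see `Inst.other`. -/
def otherE (e v : Exp) : Exp := .sub (.add (endE e (.lit 0)) (endE e (.lit 1))) v
/-- The test whether `v` is an end of `e`. -/
def atE (e v : Exp) : Exp := .add (eq (endE e (.lit 0)) v) (eq (endE e (.lit 1)) v)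
/-- The entry `i` of a one-dimensional array. -/
def cellE (a : ℕ) (i : Exp) : Exp := .read a i (.lit 0)

/-- The memory `s` holds the instance `I` in the input arrays. -/
structure Rep (I : Inst) (s : Mem) : Prop where
  n : s 0 0 0 = I.n
  m : s 0 0 1 = I.m
  ends : s 1 = I.ends
  lst : s 2 = I.lst

variable {I : Inst} {N : ℕ} {s : Mem}

theorem SameOff.refl {l : List ℕ} : SameOff l s s := fun _ _ => rfl

theorem SameOff.trans {l l' : List ℕ} {s₁ s₂ s₃ : Mem} (h : SameOff l s₁ s₂)
    (h' : SameOff l' s₂ s₃) : SameOff (l ++ l') s₁ s₃ := fun a ha => by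
  simp only [List.mem_append, not_or] at ha
  rw [h' a ha.2, h a ha.1]

theorem SameOff.write {a i j x : ℕ} : SameOff [a] s (s.write a i j x) := fun b hb =>
  Mem.write_of_ne (by simpa using hb)

theorem Rep.of_sameOff {s' : Mem} {l : List ℕ} (h : Rep I s) (hs : SameOff l s s')
    (hl : ∀ a ∈ l, 3 ≤ a) : Rep I s' := by
  have key : ∀ a < 3, s' a = s a := fun a ha => hs a fun h => absurd (hl a h) (by omega)
  exact ⟨by rw [key 0 (by omega), h.n], by rw [key 0 (by omega), h.m],
    by rw [key 1 (by omega), h.ends], by rw [key 2 (by omega), h.lst]⟩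

theorem Rep.write {a i j x : ℕ} (h : Rep I s) (ha : 3 ≤ a) : Rep I (s.write a i j x) :=
  h.of_sameOff SameOff.write (by simpa using ha)

theorem Rep.eval_n (h : Rep I s) : nE.eval s = I.n := h.n

theorem Rep.eval_m (h : Rep I s) : mE.eval s = I.m := h.m

theorem Rep.eval_end (h : Rep I s) (e o : Exp) :
    (endE e o).eval s = I.ends (e.eval s) (o.eval s) := by
  simp only [endE, eval, h.ends]

theorem Rep.eval_other (h : Rep I s) (e v : Exp) :
    (otherE e v).eval s = I.other (e.eval s) (v.eval s) := by
  simp only [otherE, endE, eval, h.ends, Inst.other]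

theorem Rep.eval_at (h : Rep I s) (e v : Exp) :
    (atE e v).eval s ≠ 0 ↔ I.Inc (e.eval s) (v.eval s) := by
  have h0 := eval_eq (s := s) (x := endE e (.lit 0)) (y := v)
  have h1 := eval_eq (s := s) (x := endE e (.lit 1)) (y := v)
  rw [h.eval_end] at h0 h1
  simp only [eval] at h0 h1
  unfold Inst.Inc
  rw [← h0, ← h1]
  simp only [atE, eval]
  omega

/-- The loop over all colors among the first `m` entries of the lists, as values of the variable
`c`. -/
def forColor (i j c : ℕ) (P : Prog) : Prog :=
  forP i mE (forP j mE (.seq (set c (.read 2 (.var i) (.var j))) P))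

end RAM

/-- The values over which `forColor` loops, possibly including the non-color `0`. -/
def Inst.colors (I : Inst) : Set ℕ := {c | ∃ e < I.m, ∃ j < I.m, I.lst e j = c}

theorem Inst.mem_colors {I : Inst} {c : ℕ} (h : c ∈ I.palette) : c ∈ I.colors := by
  simp only [palette, Finset.mem_erase, Finset.mem_image, Finset.mem_product, Finset.mem_range,
    Prod.exists] at h
  obtain ⟨-, e, j, h, rfl⟩ := h
  exact ⟨e, h.1, j, h.2, rfl⟩

namespace RAM

open Exp Prog

variable {I : Inst} {N : ℕ} {s : Mem}

theorem union_lt_succ {A : Set ℕ} (f : ℕ → ℕ) (j : ℕ) :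
    insert (f j) (A ∪ {c | ∃ x < j, f x = c}) = A ∪ {c | ∃ x < j + 1, f x = c} := by
  ext c
  constructor
  · rintro (rfl | h | ⟨x, hx, rfl⟩)
    · exact Or.inr ⟨j, by omega, rfl⟩
    · exact Or.inl h
    · exact Or.inr ⟨x, by omega, rfl⟩
  · rintro (h | ⟨x, hx, rfl⟩)
    · exact Or.inr (Or.inl h)
    · rcases Nat.lt_succ_iff_lt_or_eq.1 hx with hx | rfl
      · exact Or.inr (Or.inr ⟨x, hx, rfl⟩)
      · exact Or.inl rfl

theorem setOf_lt_succ (p : ℕ → ℕ → Prop) (i : ℕ) :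
    {c | ∃ e < i, p e c} ∪ {c | p i c} = {c | ∃ e < i + 1, p e c} := by
  ext c
  constructor
  · rintro (⟨e, he, h⟩ | h)
    · exact ⟨e, by omega, h⟩
    · exact ⟨i, by omega, h⟩
  · rintro ⟨e, he, h⟩
    rcases Nat.lt_succ_iff_lt_or_eq.1 he with he | rfl
    · exact Or.inl ⟨e, he, h⟩
    · exact Or.inr h

/-- The invariant is indexed by the set of the colors done so far; a color may occur many times, so
the body has to be correct also for a color that was done before. -/
theorem does_forColor {i j c : ℕ} {P : Prog} (J : Set ℕ → Mem → Prop) (rep : Rep I s)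
    (hm : I.m ≤ N) (hl : ∀ a ∈ i :: j :: c :: P.writes, 3 ≤ a)
    (hi : i ≠ j ∧ i ≠ c ∧ i ∉ P.writes) (hj : j ≠ c ∧ j ∉ P.writes)
    (hJ : ∀ S s a x, a = i ∨ a = j ∨ a = c → J S s → J S (s.write a 0 0 x))
    (h0 : J ∅ s)
    (hstep : ∀ S s' e j', SameOff (i :: j :: c :: P.writes) s s' → s' c 0 0 = I.lst e j' →
      J S s' → Does N P s' (J (insert (I.lst e j') S))) :
    Does N (forColor i j c P) s (J I.colors) := by
  have sub1 : ∀ {s' : Mem}, SameOff (i :: (forP j mE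
      (.seq (set c (.read 2 (.var i) (.var j))) P)).writes) s s' →
      SameOff (i :: j :: c :: P.writes) s s' := fun h a ha => h a (by
    simp only [forP, Prog.writes, List.mem_cons, List.mem_append, not_or] at ha ⊢
    simp only [List.not_mem_nil]; tauto)
  unfold forColor
  refine does_for (k := I.m) (fun i' s => J {c | ∃ e < i', ∃ j < I.m, I.lst e j = c} s) ?_ hm
    (fun s' hs => (rep.of_sameOff (sub1 hs) hl).eval_m) (fun _ s x h => hJ _ s i x (Or.inl rfl) h)
    ?_ ?_
  · simp only [forP, Prog.writes, List.mem_cons, List.mem_append]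
    simp only [List.not_mem_nil]; tauto
  · simpa using h0
  intro i' hi' s₁ hs₁ hv₁ hJ₁
  have rep₁ := rep.of_sameOff (sub1 hs₁) hl
  have sub2 : ∀ {s' : Mem}, SameOff (j :: (Prog.seq (set c (.read 2 (.var i) (.var j))) P).writes)
      s₁ s' → SameOff (j :: c :: P.writes) s₁ s' := fun h a ha => h a (by
    simp only [Prog.writes, List.mem_cons, List.mem_append, not_or] at ha ⊢
    simp only [List.not_mem_nil]; tauto)
  have hl' : ∀ a ∈ j :: c :: P.writes, 3 ≤ a := fun a ha => hl a (List.mem_cons_of_mem _ ha)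
  refine (does_for (k := I.m) (fun j' s => J ({c | ∃ e < i', ∃ j < I.m, I.lst e j = c} ∪
    {c | ∃ j < j', I.lst i' j = c}) s) ?_ hm
    (fun s' hs => (rep₁.of_sameOff (sub2 hs) hl').eval_m)
    (fun _ s x h => hJ _ s j x (Or.inr (Or.inl rfl)) h) ?_ ?_).mono ?_
  · simp only [Prog.writes, List.mem_cons, List.mem_append]
    simp only [List.not_mem_nil]; tauto
  · simpa using hJ₁
  · intro j' hj' s₂ hs₂ hv₂ hJ₂
    have rep₂ := rep₁.of_sameOff (sub2 hs₂) hl'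
    apply does_set_seq
    have hvi : s₂ i 0 0 = i' := by
      rw [sub2 hs₂ i (by simp only [List.mem_cons, not_or]; tauto), hv₁]
    have heval : (Exp.read 2 (.var i) (.var j)).eval s₂ = I.lst i' j' := by
      simp only [eval, rep₂.lst, hvi, hv₂]
    rw [heval]
    refine (hstep _ _ i' j' ?_ (by simp [Mem.write_same]) (hJ _ _ c _ (Or.inr (Or.inr rfl))
      hJ₂)).mono fun s₃ _ h => ?_
    · intro a ha
      simp only [List.mem_cons, not_or] at ha
      rw [Mem.write_of_ne ha.2.2.1, sub2 hs₂ a (by simp only [List.mem_cons, not_or]; tauto),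
        sub1 hs₁ a (by simp only [List.mem_cons, not_or]; tauto)]
    · rwa [union_lt_succ (I.lst i')] at h
  · intro s₂ _ h
    rwa [setOf_lt_succ fun e c => ∃ j < I.m, I.lst e j = c] at h

/-- Computes `Inst.find` for the coloring in the array `a` into the variable `26`. The arguments are
copied first because the loop overwrites auxiliary variables. -/
def findP (a : ℕ) (v c : Exp) : Prog :=
  .seq (set 60 v) (.seq (set 61 c) (.seq (set 26 (.lit 0)) (forP 27 mE
    (.cond (Exp.and (atE (.var 27) (.var 60)) (eq (cellE a (.var 27)) (.var 61)))
      (set 26 (.add (.var 27) (.lit 1))) .skip))))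

theorem findP_sameOff {a : ℕ} {v c : Exp} {s' : Mem} (h : SameOff (findP a v c).writes s s') :
    SameOff [60, 61, 26, 27] s s' := fun b hb => h b (by
  simp only [List.mem_cons, not_or] at hb
  simp [findP, forP, Prog.writes, hb])

theorem does_find {a : ℕ} {v c : Exp} (rep : Rep I s) (hm : I.m ≤ N) (ha : a ∉ [60, 61, 26, 27])
    (hc : c.eval (s.write 60 0 0 (v.eval s)) = c.eval s) :
    Does N (findP a v c) s fun s' =>
      s' 26 0 0 = I.find (fun e => s a e 0) (v.eval s) (c.eval s) := by
  unfold findP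
  apply does_set_seq
  apply does_set_seq
  rw [hc]
  apply does_set_seq
  simp only [List.mem_cons, not_or] at ha
  set s₁ := Mem.write (Mem.write (s.write 60 0 0 (v.eval s)) 61 0 0 (c.eval s)) 26 0 0
    (Exp.eval _ (.lit 0)) with hs₁
  have rep₁ : Rep I s₁ := ((rep.write (by omega)).write (by omega)).write (by omega)
  refine does_for (k := I.m) (fun i s' => s' 26 0 0 =
    I.findBelow (fun e => s a e 0) (v.eval s) (c.eval s) i) (by simp [Prog.writes]) hm
    (fun s' hs => (rep₁.of_sameOff hs (by simp [Prog.writes])).eval_m)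
    (fun i s' x h => by rwa [Mem.write_of_ne (by decide)]) ?_ ?_
  · simp [hs₁, Mem.write_same, eval, Inst.findBelow]
  · intro i hi s' hs hv hJ
    have rep' := rep₁.of_sameOff hs (by simp [Prog.writes])
    have h60 : s' 60 0 0 = v.eval s := by
      rw [hs 60 (by simp [Prog.writes])]; simp [hs₁, Mem.write_of_ne, Mem.write_same]
    have h61 : s' 61 0 0 = c.eval s := by
      rw [hs 61 (by simp [Prog.writes])]; simp [hs₁, Mem.write_of_ne, Mem.write_same]
    have ha' : s' a = s a := by
      rw [hs a (by simp [Prog.writes]; omega), hs₁, Mem.write_of_ne (by omega),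
        Mem.write_of_ne (by omega), Mem.write_of_ne (by omega)]
    have hb : (Exp.and (atE (.var 27) (.var 60)) (eq (cellE a (.var 27)) (.var 61))).eval s' ≠ 0 ↔
        I.Inc i (v.eval s) ∧ s a i 0 = c.eval s := by
      rw [eval_and, rep'.eval_at, eval_eq]
      simp only [cellE, eval, hv, h60, h61, ha']
    refine does_cond (fun h => does_set ?_) (fun h => does_skip ?_)
    · rw [hb] at h
      rw [Inst.findBelow, if_pos h]
      simp [Mem.write_same, eval, hv]
    · rw [Inst.findBelow, if_neg (fun h' => (hb.2 h') h)]
      exact hJ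

/-- The table of weights and the table of common colors have been computed. -/
structure Env (I : Inst) (s : Mem) : Prop extends Rep I s where
  weight : ∀ e < I.m, ∀ c, s 5 e c = I.W e c
  table : ∀ v < I.n, ∀ c, s 6 v c = I.F v c

theorem Env.of_sameOff {s' : Mem} {l : List ℕ} (h : Env I s) (hs : SameOff l s s')
    (hl : ∀ a ∈ l, 7 ≤ a ∨ a = 3 ∨ a = 4) : Env I s' := by
  refine ⟨h.toRep.of_sameOff hs fun a ha => by have := hl a ha; omega, ?_, ?_⟩
  · rw [hs 5 fun h => by have := hl 5 h; omega]; exact h.weight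
  · rw [hs 6 fun h => by have := hl 6 h; omega]; exact h.table

theorem Env.write {a i j x : ℕ} (h : Env I s) (ha : 7 ≤ a ∨ a = 3 ∨ a = 4) :
    Env I (s.write a i j x) :=
  h.of_sameOff SameOff.write (by simpa using ha)

/-- The column `0` of an array, as a function on edges. -/
def row (s : Mem) (a : ℕ) : ℕ → ℕ := fun e => s a e 0

theorem row_congr {s' : Mem} {a : ℕ} (h : s' a = s a) : row s' a = row s a := by
  unfold row; rw [h]

theorem row_write {a b i j x : ℕ} (h : a ≠ b) : row (s.write b i j x) a = row s a :=
  row_congr (Mem.write_of_ne h)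

/-- The configuration of a move that is held by the memory. -/
def cfg (s : Mem) : Inst.Cfg :=
  ⟨row s 4, s 20 0 0, s 21 0 0, s 22 0 0, s 23 0 0, s 24 0 0, s 25 0 0⟩

theorem cfg_congr {s' : Mem} {l : List ℕ} (hs : SameOff l s s')
    (hl : ∀ a ∈ l, a ≠ 4 ∧ (a < 20 ∨ 25 < a)) : cfg s' = cfg s := by
  have key : ∀ a, a = 4 ∨ 20 ≤ a ∧ a ≤ 25 → s' a = s a := fun a ha => hs a fun h => by
    have := hl a h; omega
  unfold cfg row
  rw [key 4 (by omega), key 20 (by omega), key 21 (by omega), key 22 (by omega),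
    key 23 (by omega), key 24 (by omega), key 25 (by omega)]

/-- Performs `Inst.push`. By its first test it relies on the table of weights. -/
def pushP : Prog :=
  .cond (Exp.and (.var 25) (Exp.and (eq (cellE 4 (.var 20)) (.lit 0)) (.read 5 (.var 20) (.var 23))))
    (.seq (findP 4 (.var 21) (.var 23)) (.cond (.var 26) (set 25 (.lit 0))
      (.seq (findP 4 (.var 22) (.var 23))
        (.seq (.cond (.var 26) (.assign 4 (.sub (.var 26) (.lit 1)) (.lit 0) (.lit 0)) .skip)
          (.seq (.assign 4 (.var 20) (.lit 0) (.var 23))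
            (.seq (set 25 (.var 26)) (set 20 (.sub (.var 26) (.lit 1)))))))))
    (set 25 (.lit 0))

theorem does_push (env : Env I s) (hm : I.m ≤ N) (ok : (cfg s).Ok I) :
    Does N pushP s fun s' => cfg s' = I.push (cfg s) := by
  have hdead : ∀ s', SameOff [60, 61, 26, 27] s s' → ¬ I.CanPush (cfg s) →
      Does N (set 25 (.lit 0)) s' fun s' => cfg s' = I.push (cfg s) := by
    intro s' hs hn
    apply does_set
    have h1 := cfg_congr hs (by decide)
    rw [Inst.push, if_neg hn, ← h1]
    simp [cfg, row_write, Mem.write_of_ne, Mem.write_same, eval]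
  have hb : (Exp.and (.var 25) (Exp.and (eq (cellE 4 (.var 20)) (.lit 0))
      (.read 5 (.var 20) (.var 23)))).eval s ≠ 0 ↔
      (cfg s).live ≠ 0 ∧ (cfg s).B (cfg s).E = 0 ∧ s 5 (cfg s).E (cfg s).C ≠ 0 := by
    rw [eval_and, eval_and, eval_eq]
    rfl
  unfold pushP
  refine does_cond (fun h => ?_) (fun h => hdead s .refl fun hcan => hb.2 ?_ h)
  swap
  · exact ⟨hcan.1, hcan.2.1, by rw [env.weight _ (ok.edge hcan.1).1]; exact hcan.2.2.1⟩
  obtain ⟨h1, h2, h3⟩ := hb.1 h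
  rw [env.weight _ (ok.edge h1).1] at h3
  refine does_seq (does_find env.toRep hm (by decide) (by simp [eval, Mem.write_of_ne]))
    fun s₁ hs₁ h26 => ?_
  have hs₁ := findP_sameOff hs₁
  have h26' : s₁ 26 0 0 = I.find (cfg s).B (cfg s).U (cfg s).C := h26
  have hcfg₁ := cfg_congr hs₁ (by decide)
  refine does_cond (fun h4 => hdead s₁ hs₁ fun hcan => h4 ?_) (fun h4 => ?_)
  · change s₁ 26 0 0 = 0
    rw [h26']; exact hcan.2.2.2
  have hcan : I.CanPush (cfg s) := ⟨h1, h2, h3, by rw [← h26']; exact h4⟩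
  have env₁ := env.of_sameOff hs₁ (by decide)
  refine does_seq (does_find env₁.toRep hm (by decide) (by simp [eval, Mem.write_of_ne]))
    fun s₂ hs₂ h26 => ?_
  have hs₂ := findP_sameOff hs₂
  have hcfg₂ := (cfg_congr hs₂ (by decide)).trans hcfg₁
  have h26₂ : s₂ 26 0 0 = I.find (cfg s).B (cfg s).V (cfg s).C := by
    rw [← hcfg₁]; exact h26
  rw [← hcfg₂] at h26₂ hcan ⊢
  rw [Inst.push, if_pos hcan, ← h26₂]
  refine does_seq (Q := fun s₃ => SameOff [4] s₂ s₃ ∧ row s₃ 4 =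
    fun e => if e + 1 = s₂ 26 0 0 then 0 else row s₂ 4 e) ?_ fun s₃ _ hs₃ => ?_
  · refine does_cond (fun h5 => does_assign ⟨.write, ?_⟩) (fun h5 => does_skip ⟨.refl, ?_⟩)
    · change s₂ 26 0 0 ≠ 0 at h5
      funext e
      simp only [row, Mem.write_same, eval]
      simp only [and_true]
      congr 1
      apply propext
      omega
    · change s₂ 26 0 0 = 0 at h5
      funext e
      rw [h5, if_neg (by omega)]
  obtain ⟨hs₃, hrow⟩ := hs₃
  apply does_assign_seq
  apply does_set_seq
  apply does_set
  have h20 : s₃ 20 = s₂ 20 := hs₃ 20 (by decide)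
  have h21 : s₃ 21 = s₂ 21 := hs₃ 21 (by decide)
  have h22 : s₃ 22 = s₂ 22 := hs₃ 22 (by decide)
  have h23 : s₃ 23 = s₂ 23 := hs₃ 23 (by decide)
  have h24 : s₃ 24 = s₂ 24 := hs₃ 24 (by decide)
  have h26 : s₃ 26 = s₂ 26 := hs₃ 26 (by decide)
  have hrow' : ∀ e, s₃ 4 e 0 = if e + 1 = s₂ 26 0 0 then 0 else s₂ 4 e 0 := fun e =>
    congrFun hrow e
  ext
  · simp [cfg, row, Mem.write_of_ne, Mem.write_same, eval, h20, h23, hrow', Inst.recolor]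
    congr
  all_goals simp [cfg, Mem.write_of_ne, Mem.write_same, eval, h21, h22, h23, h24, h26]

/-- Computes the score of the coloring in the array `a` into the variable `dst`. -/
def scoreP (a dst : ℕ) : Prog :=
  .seq (set dst (.lit 0)) (forP 31 mE (set dst (.add (.var dst)
    (.read 5 (.var 31) (cellE a (.var 31))))))

theorem does_score {a dst : ℕ} (env : Env I s) (hm : I.m ≤ N) (ha : a ≠ dst ∧ a ≠ 31)
    (hdst : dst ≠ 31 ∧ 7 ≤ dst) :
    Does N (scoreP a dst) s fun s' => s' dst 0 0 = I.score (row s a) := by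
  unfold scoreP
  apply does_set_seq
  have env₁ : Env I (s.write dst 0 0 (Exp.eval s (.lit 0))) := env.write (by omega)
  have hl : ∀ a ∈ 31 :: (set dst (.add (.var dst)
      (.read 5 (.var 31) (cellE a (.var 31))))).writes, 7 ≤ a ∨ a = 3 ∨ a = 4 := by
    simp [Prog.writes]; omega
  refine does_for (k := I.m) (fun i s' => s' dst 0 0 =
    ∑ e ∈ Finset.range i, I.W e (row s a e)) (by simp [Prog.writes]; omega) hm
    (fun s' hs => (env₁.of_sameOff hs hl).eval_m)
    (fun i s' x h => by rwa [Mem.write_of_ne hdst.1]) ?_ ?_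
  · simp [Mem.write_same, eval]
  · intro i hi s' hs hv hJ
    apply does_set
    have ha' : s' a = s a := by
      rw [hs a (by simp [Prog.writes]; omega), Mem.write_of_ne ha.1]
    simp only [Mem.write_same, and_self, if_true, eval, cellE, hJ, hv, ha',
      (env₁.of_sameOff hs hl).weight i hi, Finset.sum_range_succ]
    rfl

/-- Copies the coloring in the array `a` to the array `b`. -/
def copyP (a b : ℕ) : Prog := forP 32 mE (.assign b (.var 32) (.lit 0) (cellE a (.var 32)))

theorem does_copy {a b : ℕ} (rep : Rep I s) (hm : I.m ≤ N) (hab : a ≠ b) (ha : a ≠ 32)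
    (hb : b ≠ 32 ∧ 3 ≤ b) (h0 : ∀ e, I.m ≤ e → s a e 0 = 0) (h0' : ∀ e, I.m ≤ e → s b e 0 = 0) :
    Does N (copyP a b) s fun s' => row s' b = row s a := by
  have hl : ∀ a' ∈ 32 :: (Prog.assign b (.var 32) (.lit 0) (cellE a (.var 32))).writes,
      3 ≤ a' := by
    simp [Prog.writes]; omega
  refine (does_for (k := I.m) (fun i s' => ∀ e, (e < i → s' b e 0 = s a e 0) ∧
    (i ≤ e → s' b e 0 = s b e 0)) (by simp [Prog.writes]; omega) hm
    (fun s' hs => (rep.of_sameOff hs hl).eval_m)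
    (fun i s' x h => by rwa [Mem.write_of_ne hb.1]) ?_ ?_).mono fun s' _ h => ?_
  · exact fun e => ⟨fun h => absurd h (by omega), fun _ => rfl⟩
  · intro i hi s' hs hv hJ
    apply does_assign
    intro e
    have ha' : s' a = s a := hs a (by simp [Prog.writes]; omega)
    simp only [Mem.write_same, eval, cellE, hv, ha', and_true]
    split_ifs with h
    · subst h; exact ⟨fun _ => rfl, fun h => absurd h (by omega)⟩
    · exact ⟨fun h' => (hJ e).1 (by omega), fun h' => (hJ e).2 (by omega)⟩
  · funext e
    unfold row
    by_cases he : e < I.m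
    · exact (h e).1 he
    · rw [(h e).2 (by omega), h0 e (by omega), h0' e (by omega)]

end RAM

/-! ### The local search -/

namespace RAM

open Exp Prog

variable {I : Inst} {N : ℕ} {s : Mem}

/-- The state within a round of the local search that started with the coloring `φ`: either the
current coloring is still `φ` and `X` holds (which says that the moves tried so far do not improve
`φ`), or it has a larger score, and the changed flag is set. -/
structure SearchState (I : Inst) (φ : ℕ → ℕ) (X : Prop) (s : Mem) : Prop where
  env : Env I s
  current : I.IsPartial (row s 9)
  trial : I.IsPartial (row s 4)
  cases : (s 11 0 0 = 0 ∧ row s 9 = φ ∧ X) ∨ (s 11 0 0 ≠ 0 ∧ I.score φ < I.score (row s 9))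

variable {φ : ℕ → ℕ} {X Y : Prop}

theorem SearchState.imp (h : SearchState I φ X s) (hXY : X → Y) : SearchState I φ Y s :=
  ⟨h.env, h.current, h.trial, h.cases.imp_left fun h => ⟨h.1, h.2.1, hXY h.2.2⟩⟩

theorem SearchState.of_sameOff {s' : Mem} {l : List ℕ} (h : SearchState I φ X s) (hs : SameOff l s s')
    (hl : ∀ a ∈ l, a = 4 ∨ a = 8 ∨ 12 ≤ a) (ht : I.IsPartial (row s' 4)) : SearchState I φ X s' := by
  have key : ∀ a, a = 9 ∨ a = 11 → s' a = s a := fun a ha => hs a fun h => by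
    have := hl a h; omega
  have h9 := row_congr (key 9 (by omega))
  refine ⟨h.env.of_sameOff hs fun a ha => ?_, by rw [h9]; exact h.current, ht, ?_⟩
  · have := hl a ha; omega
  · rw [h9, key 11 (by omega)]; exact h.cases

theorem SearchState.of_sameOff' {s' : Mem} {l : List ℕ} (h : SearchState I φ X s) (hs : SameOff l s s')
    (hl : ∀ a ∈ l, a = 8 ∨ 12 ≤ a) : SearchState I φ X s' := by
  refine h.of_sameOff hs (fun a ha => Or.inr (hl a ha)) ?_
  rw [row_congr (hs 4 fun h => by have := hl 4 h; omega)]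
  exact h.trial

theorem SearchState.write {a i j x : ℕ} (h : SearchState I φ X s) (ha : a = 8 ∨ 12 ≤ a) :
    SearchState I φ X (s.write a i j x) :=
  h.of_sameOff' SameOff.write (by simpa using ha)

/-- Replaces the current coloring by the trial coloring if the latter has a larger score. -/
def acceptP : Prog :=
  .seq (scoreP 4 29) (.seq (scoreP 9 30) (.cond (.sub (.var 29) (.var 30))
    (.seq (copyP 4 9) (set 11 (.lit 1))) .skip))

theorem does_accept (hZ : SearchState I φ X s) (hm : I.m ≤ N) :
    Does N acceptP s (SearchState I φ (X ∧ I.score (row s 4) ≤ I.score φ)) := by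
  unfold acceptP
  refine does_seq (does_score hZ.env hm (by decide) (by decide)) fun s₁ hs₁ h₁ => ?_
  have hZ₁ := hZ.of_sameOff' hs₁ (by decide)
  refine does_seq (does_score hZ₁.env hm (by decide) (by decide)) fun s₂ hs₂ h₂ => ?_
  have hZ₂ := hZ₁.of_sameOff' hs₂ (by decide)
  have h4 : row s₂ 4 = row s 4 := by
    rw [row_congr (hs₂ 4 (by decide)), row_congr (hs₁ 4 (by decide))]
  have h9 : row s₂ 9 = row s₁ 9 := row_congr (hs₂ 9 (by decide))
  have h29 : s₂ 29 0 0 = I.score (row s 4) := by rw [hs₂ 29 (by decide), h₁]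
  rw [← h9] at h₂
  have hcases := hZ₂.cases
  refine does_cond (fun hb => ?_) (fun hb => does_skip ?_)
  · simp only [eval, h29, h₂] at hb
    refine does_seq (does_copy hZ₂.env.toRep hm (by decide) (by decide) (by decide)
      hZ₂.trial.zero hZ₂.current.zero) fun s₃ hs₃ h₃ => does_set ?_
    have h43 : row s₃ 4 = row s₂ 4 := row_congr (hs₃ 4 (by decide))
    refine ⟨(hZ₂.env.of_sameOff hs₃ (by decide)).write (by decide), ?_, ?_, Or.inr ⟨?_, ?_⟩⟩
    · rw [row_write (by decide), h₃]; exact hZ₂.trial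
    · rw [row_write (by decide), h43]; exact hZ₂.trial
    · simp [Mem.write_same, eval]
    · rw [row_write (by decide), h₃, h4]
      rcases hcases with ⟨-, h, -⟩ | ⟨-, h⟩
      · rw [h] at hb; omega
      · omega
  · simp only [eval, h29, h₂] at hb
    refine ⟨hZ₂.env, hZ₂.current, hZ₂.trial, ?_⟩
    rcases hcases with ⟨h5, h6, h7⟩ | h
    · refine Or.inl ⟨h5, h6, h7, ?_⟩
      rw [h6] at hb; omega
    · exact Or.inr h

/-- A fan step, followed by the test of the resulting coloring. -/
def fanP : Prog :=
  .seq (set 23 (cellE 8 (.var 20))) (.seq pushP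
    (.seq (set 21 (otherE (.var 20) (.var 22))) acceptP))

theorem does_fan (hZ : SearchState I φ X s) (hm : I.m ≤ N) (ok : (cfg s).Ok I) :
    Does N fanP s fun s' => cfg s' = I.fanStep (row s 8) (cfg s) ∧
      SearchState I φ (X ∧ I.score (I.fanStep (row s 8) (cfg s)).B ≤ I.score φ) s' := by
  unfold fanP
  apply does_set_seq
  set s₁ := s.write 23 0 0 ((cellE 8 (.var 20)).eval s) with hs₁
  have hc₁ : cfg s₁ = { cfg s with C := row s 8 (cfg s).E } := by
    simp [hs₁, cfg, row_write, Mem.write_of_ne, Mem.write_same, eval, cellE, row]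
  have hZ₁ : SearchState I φ X s₁ := hZ.write (by decide)
  have ok₁ : (cfg s₁).Ok I := by rw [hc₁]; exact ⟨ok.1, ok.2⟩
  refine does_seq (does_push hZ₁.env hm ok₁) fun s₂ hs₂ h₂ => ?_
  have hZ₂ : SearchState I φ X s₂ := by
    refine hZ₁.of_sameOff hs₂ (by decide) ?_
    change I.IsPartial (cfg s₂).B
    rw [h₂]; exact ok₁.push.1
  apply does_set_seq
  set s₃ := s₂.write 21 0 0 ((otherE (.var 20) (.var 22)).eval s₂) with hs₃
  have hV : (cfg s₂).V = (cfg s).V := by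
    rw [h₂, hc₁]; simp only [Inst.push]; split_ifs <;> rfl
  have hc₃ : cfg s₃ = I.fanStep (row s 8) (cfg s) := by
    have : cfg s₃ = { cfg s₂ with U := I.other (cfg s₂).E (cfg s₂).V } := by
      rw [hs₃, hZ₂.env.eval_other]
      simp [cfg, row_write, Mem.write_of_ne, Mem.write_same, eval]
    rw [this, hV, h₂, hc₁]
    rfl
  have hZ₃ : SearchState I φ X s₃ := hZ₂.write (by decide)
  refine (does_accept hZ₃ hm).mono fun s₄ hs₄ h₄ => ?_
  have hc₄ := (cfg_congr hs₄ (by decide)).trans hc₃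
  refine ⟨hc₄, ?_⟩
  rw [← hc₃]
  exact h₄

/-- A step of a Kempe chain, followed by the test of the resulting coloring. -/
def chainP : Prog :=
  .seq pushP (.seq (set 21 (.var 22)) (.seq (set 22 (otherE (.var 20) (.var 22)))
    (.seq (set 62 (.var 23)) (.seq (set 23 (.var 24)) (.seq (set 24 (.var 62)) acceptP)))))

theorem does_chain (hZ : SearchState I φ X s) (hm : I.m ≤ N) (ok : (cfg s).Ok I) :
    Does N chainP s fun s' => cfg s' = I.chainStep (cfg s) ∧
      SearchState I φ (X ∧ I.score (I.chainStep (cfg s)).B ≤ I.score φ) s' := by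
  unfold chainP
  refine does_seq (does_push hZ.env hm ok) fun s₂ hs₂ h₂ => ?_
  have hZ₂ : SearchState I φ X s₂ := by
    refine hZ.of_sameOff hs₂ (by decide) ?_
    change I.IsPartial (cfg s₂).B
    rw [h₂]; exact ok.push.1
  apply does_set_seq
  apply does_set_seq
  apply does_set_seq
  apply does_set_seq
  apply does_set_seq
  rw [(hZ₂.write (by decide)).env.eval_other]
  set s₃ : Mem := Mem.write _ 24 0 0 _ with hs₃
  have hpush : (I.push (cfg s)).V = (cfg s).V ∧ (I.push (cfg s)).C = (cfg s).C ∧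
      (I.push (cfg s)).D = (cfg s).D := by
    simp only [Inst.push]; split_ifs <;> exact ⟨rfl, rfl, rfl⟩
  have hc₃ : cfg s₃ = I.chainStep (cfg s) := by
    have : cfg s₃ = { cfg s₂ with
        U := (cfg s₂).V, V := I.other (cfg s₂).E (cfg s₂).V, C := (cfg s₂).D,
        D := (cfg s₂).C } := by
      simp [hs₃, cfg, row_write, Mem.write_of_ne, Mem.write_same, eval]
    rw [this, h₂, hpush.1, hpush.2.1, hpush.2.2]
    rfl
  have hZ₃ : SearchState I φ X s₃ := ((((hZ₂.write (by decide)).write (by decide)).write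
    (by decide)).write (by decide)).write (by decide)
  refine (does_accept hZ₃ hm).mono fun s₄ hs₄ h₄ => ?_
  have hc₄ := (cfg_congr hs₄ (by decide)).trans hc₃
  refine ⟨hc₄, ?_⟩
  rw [← hc₃]
  exact h₄

/-- Starting from the current coloring, makes the number of fan steps in the variable `45` and then
goes along a Kempe chain, testing each coloring on the way. -/
def candidateP : Prog :=
  .seq (copyP 9 4) (.seq (set 20 (.var 40)) (.seq (set 21 (endE (.var 40) (.sub (.lit 1) (.var 41))))
    (.seq (set 22 (endE (.var 40) (.var 41))) (.seq (set 23 (.lit 0)) (.seq (set 24 (.lit 0))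
      (.seq (set 25 (.lit 1)) (.seq (forP 53 (.var 45) fanP)
        (.seq (.cond (.var 46)
            (.seq (set 62 (.var 21)) (.seq (set 21 (.var 22)) (set 22 (.var 62)))) .skip)
          (.seq (set 23 (.var 49)) (.seq (set 24 (.var 52))
            (forP 54 (.add nE (.lit 1)) chainP)))))))))))

/-- None of the colorings visited by `candidateP` from the coloring `ψ` has a larger score than `φ`.
-/
def Visited (I : Inst) (ψ φ : ℕ → ℕ) (e₀ o : ℕ) (cand : ℕ → ℕ) (t sw c d : ℕ) : Prop :=
  (∀ i ≤ t, I.score (I.fanCfg ψ e₀ o cand i).B ≤ I.score φ) ∧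
    ∀ k ≤ I.n + 1, I.score
      (I.chainStep^[k] (Inst.chainStart (I.fanCfg ψ e₀ o cand t) sw c d)).B ≤ I.score φ

theorem fanCfg_ok {ψ : ℕ → ℕ} (hψ : I.IsPartial ψ) {e₀ o : ℕ} (he : e₀ < I.m) (ho : o < 2)
    (cand : ℕ → ℕ) (i : ℕ) : (I.fanCfg ψ e₀ o cand i).Ok I := by
  induction i with
  | zero =>
    refine ⟨hψ, fun _ => ⟨he, Inst.inc_ends (by omega), Inst.inc_ends ho, ?_⟩⟩
    change I.ends e₀ (1 - o) ≠ _
    rw [← Inst.other_ends ho]; exact Inst.other_ne he (Inst.inc_ends ho)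
  | succ i ih =>
    unfold Inst.fanCfg
    rw [Function.iterate_succ_apply']
    exact ih.fanStep cand

/-- The move starts from the coloring that is current at this point, whether or not it is still `φ`. -/
theorem does_candidate_aux (hZ : SearchState I φ X s) (hN : I.n + I.m + 2 ≤ N) (he : s 40 0 0 < I.m)
    (ho : s 41 0 0 < 2) (ht : s 45 0 0 ≤ I.m) :
    Does N candidateP s (SearchState I φ (X ∧ Visited I (row s 9) φ (s 40 0 0) (s 41 0 0) (row s 8)
      (s 45 0 0) (s 46 0 0) (s 49 0 0) (s 52 0 0))) := by
  have hm : I.m ≤ N := by omega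
  unfold candidateP
  refine does_seq (does_copy hZ.env.toRep hm (by decide) (by decide) (by decide)
    hZ.current.zero hZ.trial.zero) fun s₁ hs₁ h₁ => ?_
  have hZ₁ : SearchState I φ X s₁ := hZ.of_sameOff hs₁ (by decide) (by rw [h₁]; exact hZ.current)
  iterate 6 apply does_set_seq
  set s₂ : Mem := Mem.write _ 25 0 0 _ with hs₂
  have hZ₂ : SearchState I φ X s₂ := (((((hZ₁.write (by decide)).write (by decide)).write
    (by decide)).write (by decide)).write (by decide)).write (by decide)
  have hsame : SameOff [4, 20, 21, 22, 23, 24, 25, 32] s s₂ := by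
    intro a ha
    simp only [List.mem_cons, not_or] at ha
    simp only [hs₂]
    rw [Mem.write_of_ne (by omega), Mem.write_of_ne (by omega), Mem.write_of_ne (by omega),
      Mem.write_of_ne (by omega), Mem.write_of_ne (by omega), Mem.write_of_ne (by omega)]
    exact hs₁ a (by
      have : (copyP 9 4).writes = [32, 4, 32] := by decide
      rw [this]; simp; omega)
  set e₀ := s 40 0 0 with he₀
  set o := s 41 0 0 with ho₀
  set cand := row s 8 with hcand
  set ψ := row s 9 with hψ
  have hc₂ : cfg s₂ = I.fanCfg ψ e₀ o cand 0 := by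
    have h40 : s₁ 40 = s 40 := hs₁ 40 (by decide)
    have h41 : s₁ 41 = s 41 := hs₁ 41 (by decide)
    have h4 : row s₁ 4 = ψ := h₁
    have hE := hZ₁.env.ends
    simp [hs₂, cfg, row_write, Mem.write_of_ne, Mem.write_same, eval, endE, h40, h41, h4, hE,
      Inst.fanCfg, ← he₀, ← ho₀]
  have hok : ∀ i, (I.fanCfg ψ e₀ o cand i).Ok I := fanCfg_ok hZ.current he ho cand
  set P : ℕ → Prop := fun i => I.score (I.fanCfg ψ e₀ o cand i).B ≤ I.score φ with hP
  have hZ₂' : SearchState I φ (X ∧ ∀ i ≤ 0, P i) s₂ := by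
    refine ⟨hZ₂.env, hZ₂.current, hZ₂.trial, hZ₂.cases.imp_left fun ⟨h1, h2, h3⟩ =>
      ⟨h1, h2, h3, fun i hi => ?_⟩⟩
    obtain rfl : i = 0 := by omega
    have : ψ = φ := by rw [← h2, row_congr (hsame 9 (by decide))]
    simp only [hP, ← this]
    exact le_rfl
  have h45 : s₂ 45 0 0 = s 45 0 0 := by rw [hsame 45 (by decide)]
  refine does_seq (does_for (k := s 45 0 0) (fun i s' => cfg s' = I.fanCfg ψ e₀ o cand i ∧
    SearchState I φ (X ∧ ∀ i' ≤ i, P i') s') (by decide) (by omega)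
    (fun s' hs => by
      change s' 45 0 0 = _
      rw [hs 45 (by decide), h45])
    (fun i s' x h => ⟨(cfg_congr .write (by decide)).trans h.1, h.2.write (by decide)⟩)
    ⟨hc₂, hZ₂'⟩ fun i hi s' hs hv hJ => ?_) fun s₃ hs₃ ⟨hc₃, hZ₃⟩ => ?_
  · have h8 : row s' 8 = cand := by
      rw [row_congr (hs 8 (by decide)), row_congr (hsame 8 (by decide))]
    refine (does_fan hJ.2 hm (by rw [hJ.1]; exact hok i)).mono fun s'' _ ⟨h1, h2⟩ => ?_
    have hstep : I.fanStep (row s' 8) (cfg s') = I.fanCfg ψ e₀ o cand (i + 1) := by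
      rw [h8, hJ.1]; exact (Function.iterate_succ_apply' _ _ _).symm
    rw [hstep] at h1 h2
    refine ⟨h1, h2.imp fun ⟨⟨h3, h4⟩, h5⟩ => ⟨h3, fun i' hi' => ?_⟩⟩
    rcases Nat.le_succ_iff.1 hi' with hi' | rfl
    · exact h4 i' hi'
    · exact h5
  set t := s 45 0 0 with ht₀
  set κ := I.fanCfg ψ e₀ o cand t with hκ
  have h46 : s₃ 46 = s 46 := (hs₃ 46 (by decide)).trans (hsame 46 (by decide))
  have h49 : s₃ 49 = s 49 := (hs₃ 49 (by decide)).trans (hsame 49 (by decide))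
  have h52 : s₃ 52 = s 52 := (hs₃ 52 (by decide)).trans (hsame 52 (by decide))
  refine does_seq (Q := fun s₄ => SameOff [62, 21, 22] s₃ s₄ ∧ cfg s₄ = { κ with
      U := if s 46 0 0 = 0 then κ.U else κ.V, V := if s 46 0 0 = 0 then κ.V else κ.U }) ?_
    fun s₄ _ ⟨hs₄, hc₄⟩ => ?_
  · refine does_cond (fun h => ?_) (fun h => does_skip ⟨.refl, ?_⟩)
    · simp only [eval, h46] at h
      apply does_set_seq
      apply does_set_seq
      apply does_set
      refine ⟨(SameOff.write.trans SameOff.write).trans SameOff.write, ?_⟩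
      rw [if_neg h, if_neg h, ← hc₃]
      simp [cfg, row_write, Mem.write_of_ne, Mem.write_same, eval]
    · simp only [eval, h46] at h
      rw [if_pos h, if_pos h, hc₃]
  apply does_set_seq
  apply does_set_seq
  set s₅ : Mem := Mem.write _ 24 0 0 _ with hs₅
  set κ₁ := Inst.chainStart κ (s 46 0 0) (s 49 0 0) (s 52 0 0) with hκ₁
  have hc₅ : cfg s₅ = κ₁ := by
    have h49' : s₄ 49 = s 49 := (hs₄ 49 (by decide)).trans h49
    have h52' : s₄ 52 = s 52 := (hs₄ 52 (by decide)).trans h52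
    have : cfg s₅ = { cfg s₄ with C := s 49 0 0, D := s 52 0 0 } := by
      simp [hs₅, cfg, row_write, Mem.write_of_ne, Mem.write_same, eval, h49', h52']
    rw [this, hc₄]
    rfl
  have hZ₅ : SearchState I φ (X ∧ ∀ i ≤ t, P i) s₅ :=
    ((hZ₃.of_sameOff' hs₄ (by decide)).write (by decide)).write (by decide)
  have hok₁ : ∀ k, (I.chainStep^[k] κ₁).Ok I :=
    Inst.chain_ok (Inst.chainStart_ok (hok t) _ _ _)
  refine (does_for (k := I.n + 1) (fun i s' => cfg s' = I.chainStep^[i] κ₁ ∧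
    SearchState I φ ((X ∧ ∀ i ≤ t, P i) ∧ ∀ i' ≤ i, I.score (I.chainStep^[i'] κ₁).B ≤ I.score φ) s')
    (by decide) (by omega)
    (fun s' hs => by
      change s' 0 0 0 + 1 = _
      rw [hs 0 (by decide), hZ₅.env.n])
    (fun i s' x h => ⟨(cfg_congr .write (by decide)).trans h.1, h.2.write (by decide)⟩)
    ⟨hc₅, hZ₅.imp fun h => ⟨h, fun i hi => ?_⟩⟩ fun i hi s' hs hv hJ => ?_).mono
    fun s₆ _ ⟨_, h6⟩ => h6.imp fun ⟨⟨h1, h2⟩, h3⟩ => ⟨h1, h2, h3⟩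
  · obtain rfl : i = 0 := by omega
    exact h.2 t le_rfl
  · refine (does_chain hJ.2 hm (by rw [hJ.1]; exact hok₁ i)).mono fun s'' _ ⟨h1, h2⟩ => ?_
    rw [hJ.1, ← Function.iterate_succ_apply' I.chainStep] at h1 h2
    refine ⟨h1, h2.imp fun ⟨⟨h3, h4⟩, h5⟩ => ⟨h3, fun i' hi' => ?_⟩⟩
    rcases Nat.le_succ_iff.1 hi' with hi' | rfl
    · exact h4 i' hi'
    · exact h5

/-- The current coloring may be replaced while the move is under way; then nothing is left to prove,
and otherwise the start of the move was `φ`. -/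
theorem does_candidate (hZ : SearchState I φ X s) (hN : I.n + I.m + 2 ≤ N) (he : s 40 0 0 < I.m)
    (ho : s 41 0 0 < 2) (ht : s 45 0 0 ≤ I.m) :
    Does N candidateP s (SearchState I φ (X ∧ Visited I φ φ (s 40 0 0) (s 41 0 0) (row s 8)
      (s 45 0 0) (s 46 0 0) (s 49 0 0) (s 52 0 0))) := by
  rcases hZ.cases with ⟨h1, h2, h3⟩ | h
  · have := does_candidate_aux hZ hN he ho ht
    rwa [h2] at this
  · have hZ' : SearchState I φ False s := ⟨hZ.env, hZ.current, hZ.trial, Or.inr h⟩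
    exact (does_candidate_aux hZ' hN he ho ht).mono fun s' _ h => h.imp fun h => h.1.elim

end RAM

namespace Inst

variable {I : Inst}

variable (I) in
/-- The state of the computation of candidates for the center `x`: the edges before `i` are done,
and those from `k` on, except for `e₀`, have no candidate yet. -/
structure CandInv (φ : ℕ → ℕ) (e₀ x a k i : ℕ) (cand : ℕ → ℕ) : Prop where
  first : cand e₀ = a
  supp : ∀ e < I.m, cand e ≠ 0 → (e = e₀ ∨ e < k) ∧ I.Inc e x
  mem : ∀ e < I.m, e ≠ e₀ → I.Inc e x → cand e ≠ 0 → cand e ∈ I.missing φ (I.other e x)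
  inj : ∀ e < I.m, ∀ e' < I.m, I.Inc e x → I.Inc e' x → I.other e x = I.other e' x →
    cand e = cand e' → cand e ≠ 0 → e = e'
  total : ∀ e < I.m, e < i → e ≠ e₀ → I.Inc e x →
    I.mult x (I.other e x) ≤ (I.missing φ (I.other e x)).card → cand e ≠ 0

variable {φ cand : ℕ → ℕ} {e₀ x a k i c : ℕ}

theorem CandInv.assign (h : I.CandInv φ e₀ x a (i + 1) i cand) (hi : i ≠ e₀)
    (hx : I.Inc i x) (hc : c ∈ I.missing φ (I.other i x)) (hf : I.Free cand (I.other i x) c)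
    (h0 : cand i = 0) :
    I.CandInv φ e₀ x a (i + 1) i (Function.update cand i c) := by
  constructor
  · rw [Function.update_of_ne hi.symm]; exact h.first
  · intro e he hne
    by_cases hei : e = i
    · subst hei; exact ⟨Or.inr (by omega), hx⟩
    · rw [Function.update_of_ne hei] at hne; exact h.supp e he hne
  · intro e he hee hex hne
    by_cases hei : e = i
    · subst hei; rw [Function.update_self]; exact hc
    · rw [Function.update_of_ne hei] at hne ⊢; exact h.mem e he hee hex hne
  · intro e he e' he' hex hex' ho heq hne
    by_cases hei : e = i
    · subst hei
      by_cases hei' : e' = e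
      · exact hei'.symm
      · rw [Function.update_self, Function.update_of_ne hei'] at heq
        exact absurd heq.symm (hf e' he' (ho ▸ inc_other hex'))
    · by_cases hei' : e' = i
      · subst hei'
        rw [Function.update_self, Function.update_of_ne hei] at heq
        exact absurd heq (hf e he (ho ▸ inc_other hex))
      · rw [Function.update_of_ne hei] at heq hne
        rw [Function.update_of_ne hei'] at heq
        exact h.inj e he e' he' hex hex' ho heq hne
  · intro e he hlt hee hex hle
    rw [Function.update_of_ne (by omega)]
    exact h.total e he hlt hee hex hle

/-- If no color was found for the edge `i`, then all colors missing at its other end are already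
candidates of edges parallel to `i`, so that there are fewer than `mult` of them. -/
theorem CandInv.finish (h : I.CandInv φ e₀ x a (i + 1) i cand) (him : i < I.m)
    (hx : I.Inc i x)
    (hs : cand i ≠ 0 ∨ ∀ c ∈ I.colors, c ∈ I.missing φ (I.other i x) →
      ¬ I.Free cand (I.other i x) c) :
    I.CandInv φ e₀ x a (i + 1) (i + 1) cand := by
  refine ⟨h.first, h.supp, h.mem, h.inj, fun e he hlt hee hex hle => ?_⟩
  rcases Nat.lt_succ_iff_lt_or_eq.1 hlt with hlt | rfl
  · exact h.total e he hlt hee hex hle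
  rcases hs with hs | hs
  · exact hs
  intro h0
  have hsub : I.missing φ (I.other e x) ⊆
      (((Finset.range I.m).filter fun e' => I.Inc e' x ∧ I.Inc e' (I.other e x)).erase e).image
        cand := by
    intro c hc
    have hcom := (mem_missing.1 hc).1
    have hf := hs c (mem_colors (Finset.filter_subset _ _ hcom)) hc
    unfold Free at hf
    push Not at hf
    obtain ⟨e', he', hi', hec⟩ := hf
    have hc0 : cand e' ≠ 0 := by
      rw [hec]; rintro rfl; exact zero_notMem_common _ _ hcom
    refine Finset.mem_image.2 ⟨e', ?_, hec⟩
    simp only [Finset.mem_erase, Finset.mem_filter, Finset.mem_range]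
    refine ⟨?_, he', (h.supp e' he' hc0).2, hi'⟩
    rintro rfl; exact hc0 h0
  have h1 := (Finset.card_le_card hsub).trans Finset.card_image_le
  have h2 : e ∈ (Finset.range I.m).filter fun e' => I.Inc e' x ∧ I.Inc e' (I.other e x) := by
    simp only [Finset.mem_filter, Finset.mem_range]
    exact ⟨he, hex, inc_other hex⟩
  rw [Finset.card_erase_of_mem h2] at h1
  have h3 := Finset.card_pos.2 ⟨e, h2⟩
  unfold mult at hle
  omega

end Inst

namespace RAM

open Exp Prog

variable {I : Inst} {N : ℕ} {s : Mem} {φ : ℕ → ℕ} {X : Prop}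

theorem row_write_self {a i x : ℕ} : row (s.write a i 0 x) a = Function.update (row s a) i x := by
  funext e
  simp only [row, Mem.write_same, and_true, Function.update_apply]

/-- Makes the color in the variable `68` the candidate of the edge in the variable `63` if this edge
has no candidate yet, the color is missing at the other end `65`, and no parallel edge has it as a
candidate. -/
def assignColorP : Prog :=
  .cond (Exp.and (eq (cellE 8 (.var 63)) (.lit 0)) (.read 6 (.var 65) (.var 68)))
    (.seq (findP 9 (.var 65) (.var 68)) (.cond (.var 26) .skip
      (.seq (findP 8 (.var 65) (.var 68)) (.cond (.var 26) .skip
        (.assign 8 (.var 63) (.lit 0) (.var 68))))))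
    .skip

/-- Computes candidates for the fan with the first edge `40`, the center number `41`, and the first
color `44`. An edge between the same ends as the first edge also avoids the color of the latter,
since `assignColorP` searches among all candidates at its other end. -/
def candP : Prog :=
  .seq (forP 63 mE (.assign 8 (.var 63) (.lit 0) (.lit 0)))
    (.seq (.assign 8 (.var 40) (.lit 0) (.var 44)) (.seq (set 64 (endE (.var 40) (.var 41)))
      (forP 63 mE (.cond (eq (.var 63) (.var 40)) .skip (.cond (atE (.var 63) (.var 64))
        (.seq (set 65 (otherE (.var 63) (.var 64))) (forColor 66 67 68 assignColorP)) .skip)))))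

theorem does_assignColor (env : Env I s) (hm : I.m ≤ N) {e₀ x a i c : ℕ} {S : Set ℕ}
    (him : i < I.m) (hi : i ≠ e₀) (hx : I.Inc i x) (h63 : s 63 0 0 = i)
    (h65 : s 65 0 0 = I.other i x) (h68 : s 68 0 0 = c)
    (hinv : I.CandInv (row s 9) e₀ x a (i + 1) i (row s 8))
    (hS : row s 8 i ≠ 0 ∨ ∀ c ∈ S, c ∈ I.missing (row s 9) (I.other i x) →
      ¬ I.Free (row s 8) (I.other i x) c) :
    Does N assignColorP s fun s' => I.CandInv (row s 9) e₀ x a (i + 1) i (row s' 8) ∧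
      (row s' 8 i ≠ 0 ∨ ∀ c' ∈ insert c S, c' ∈ I.missing (row s 9) (I.other i x) →
        ¬ I.Free (row s' 8) (I.other i x) c') := by
  have hskip : ∀ s', row s' 8 = row s 8 →
      (row s 8 i = 0 → c ∈ I.missing (row s 9) (I.other i x) →
        ¬ I.Free (row s 8) (I.other i x) c) →
      Does N .skip s' fun s' => I.CandInv (row s 9) e₀ x a (i + 1) i (row s' 8) ∧
      (row s' 8 i ≠ 0 ∨ ∀ c' ∈ insert c S, c' ∈ I.missing (row s 9) (I.other i x) →
        ¬ I.Free (row s' 8) (I.other i x) c') := by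
    intro s' h1 h2
    apply does_skip
    rw [h1]
    refine ⟨hinv, ?_⟩
    by_cases h0 : row s 8 i = 0
    · right
      rintro c' (rfl | hc')
      · exact h2 h0
      · exact hS.resolve_left (not_not.2 h0) c' hc'
    · exact Or.inl h0
  have hb : (Exp.and (eq (cellE 8 (.var 63)) (.lit 0)) (.read 6 (.var 65) (.var 68))).eval s ≠ 0 ↔
      row s 8 i = 0 ∧ c ∈ I.common (I.other i x) := by
    rw [eval_and, eval_eq]
    simp only [cellE, eval, h63, h65, h68, env.table _ (Inst.inc_lt him (Inst.inc_other hx)), row]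
    refine and_congr_right fun _ => ?_
    have := I.K_pos
    unfold Inst.F
    split_ifs with h <;> simp [h]
    omega
  unfold assignColorP
  refine does_cond (fun h => ?_) (fun h => hskip s rfl fun h0 hc =>
    absurd h (hb.2 ⟨h0, (Inst.mem_missing.1 hc).1⟩))
  obtain ⟨h0, hcom⟩ := hb.1 h
  refine does_seq (does_find env.toRep hm (by decide) (by simp [eval, Mem.write_of_ne]))
    fun s₁ hs₁ h26 => ?_
  have hs₁ := findP_sameOff hs₁
  simp only [eval, h65, h68] at h26
  have h8 : row s₁ 8 = row s 8 := row_congr (hs₁ 8 (by decide))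
  refine does_cond (fun h1 => hskip s₁ h8 fun _ hc => ?_) (fun h1 => ?_)
  · simp only [eval] at h1
    rw [h26] at h1
    exact absurd (Inst.find_eq_zero.2 (Inst.mem_missing.1 hc).2) h1
  simp only [eval] at h1
  rw [h26, Inst.find_eq_zero] at h1
  have env₁ := env.of_sameOff hs₁ (by decide)
  refine does_seq (does_find env₁.toRep hm (by decide) (by simp [eval, Mem.write_of_ne]))
    fun s₂ hs₂ h26₂ => ?_
  have hs₂ := findP_sameOff hs₂
  have h65₁ : s₁ 65 = s 65 := hs₁ 65 (by decide)
  have h68₁ : s₁ 68 = s 68 := hs₁ 68 (by decide)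
  have h63₂ : s₂ 63 0 0 = i := by rw [hs₂ 63 (by decide), hs₁ 63 (by decide), h63]
  have h68₂ : s₂ 68 0 0 = c := by rw [hs₂ 68 (by decide), h68₁, h68]
  have h26' : s₂ 26 0 0 = I.find (row s 8) (I.other i x) c := by
    rw [h26₂, ← h8]
    simp only [eval, h65₁, h68₁, h65, h68]
    rfl
  have h82 : row s₂ 8 = row s 8 := (row_congr (hs₂ 8 (by decide))).trans h8
  refine does_cond (fun h2 => hskip s₂ h82 fun _ _ hf => ?_) (fun h2 => does_assign ?_)
  · simp only [eval] at h2
    rw [h26'] at h2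
    exact h2 (Inst.find_eq_zero.2 hf)
  · simp only [eval] at h2
    rw [h26', Inst.find_eq_zero] at h2
    simp only [eval]
    rw [row_write_self, h82, h63₂, h68₂]
    refine ⟨hinv.assign hi hx (Inst.mem_missing.2 ⟨hcom, h1⟩) h2 h0, Or.inl ?_⟩
    rw [Function.update_self]
    rintro rfl; exact Inst.zero_notMem_common _ _ hcom

theorem does_cand (env : Env I s) (hm : I.m ≤ N) (ho : s 41 0 0 < 2) :
    Does N candP s fun s' => I.IsCand (row s 9) (s 40 0 0) (I.ends (s 40 0 0) (s 41 0 0))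
      (s 44 0 0) (row s' 8) := by
  unfold candP
  refine does_seq (does_for (k := I.m) (fun i s' => ∀ e < i, row s' 8 e = 0) (by decide) hm
    (fun s' hs => (env.of_sameOff hs (by decide)).eval_m)
    (fun i s' y h => by rwa [row_write (by decide)]) (by omega)
    fun i hi s' hs hv hJ => does_assign ?_) fun s₁ hs₁ h₁ => ?_
  · intro e hlt
    simp only [eval, hv]
    rw [row_write_self]
    by_cases hei : e = i
    · rw [hei, Function.update_self]
    · rw [Function.update_of_ne hei]; exact hJ e (by omega)
  have h40 : s₁ 40 = s 40 := hs₁ 40 (by decide)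
  have h41 : s₁ 41 = s 41 := hs₁ 41 (by decide)
  have h44 : s₁ 44 = s 44 := hs₁ 44 (by decide)
  apply does_assign_seq
  apply does_set_seq
  set s₂ : Mem := Mem.write _ 64 0 0 _ with hs₂
  have env₁ := env.of_sameOff hs₁ (by decide)
  have env₂ : Env I s₂ := (env₁.write (by decide)).write (by decide)
  set e₀ := s 40 0 0 with he₀
  set x := I.ends e₀ (s 41 0 0) with hx
  have hex : I.Inc e₀ x := Inst.inc_ends ho
  have h64 : s₂ 64 0 0 = x := by
    have := env₁.ends
    simp [hs₂, Mem.write_same, Mem.write_of_ne, eval, endE, this, h40, h41, hx, ← he₀]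
  have h40₂ : s₂ 40 0 0 = e₀ := by simp [hs₂, Mem.write_of_ne, h40, ← he₀]
  have h9 : row s₂ 9 = row s 9 := by
    rw [hs₂, row_write (by decide), row_write (by decide), row_congr (hs₁ 9 (by decide))]
  have h8 : row s₂ 8 = Function.update (row s₁ 8) e₀ (s 44 0 0) := by
    rw [hs₂, row_write (by decide)]
    simp only [eval]
    rw [row_write_self, h40, h44]
  refine (does_for (k := I.m) (fun i s' => I.CandInv (row s 9) e₀ x (s 44 0 0) i i (row s' 8))
    (by decide) hm (fun s' hs => (env₂.of_sameOff hs (by decide)).eval_m)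
    (fun i s' y h => by rwa [row_write (by decide)]) ?_ fun i hi s₃ hs₃ hv hJ => ?_).mono
    fun s' _ h => ⟨h.first, h.mem, h.inj, fun e hem => h.total e hem hem⟩
  · have hz : ∀ e < I.m, e ≠ e₀ → row s₂ 8 e = 0 := fun e hem hee => by
      rw [h8, Function.update_of_ne hee]; exact h₁ e hem
    refine ⟨by rw [h8, Function.update_self], ?_, ?_, ?_, by omega⟩
    · intro e hem hne
      by_cases hee : e = e₀
      · exact ⟨Or.inl hee, hee ▸ hex⟩
      · exact absurd (hz e hem hee) hne
    · exact fun e hem hee _ hne => absurd (hz e hem hee) hne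
    · intro e hem e' hem' _ _ _ heq hne
      by_cases hee : e = e₀
      · by_cases hee' : e' = e₀
        · rw [hee, hee']
        · rw [hz e' hem' hee'] at heq; exact absurd heq hne
      · exact absurd (hz e hem hee) hne
  have env₃ := env₂.of_sameOff hs₃ (by decide)
  have h64₃ : s₃ 64 0 0 = x := by rw [hs₃ 64 (by decide), h64]
  have h40₃ : s₃ 40 0 0 = e₀ := by rw [hs₃ 40 (by decide), h40₂]
  have h9₃ : row s₃ 9 = row s 9 := by rw [row_congr (hs₃ 9 (by decide)), h9]
  have hup : I.CandInv (row s 9) e₀ x (s 44 0 0) (i + 1) i (row s₃ 8) :=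
    ⟨hJ.first, fun e hem hne => ⟨(hJ.supp e hem hne).1.imp_right (by omega),
      (hJ.supp e hem hne).2⟩, hJ.mem, hJ.inj, hJ.total⟩
  have htriv : (i = e₀ ∨ ¬ I.Inc i x) →
      I.CandInv (row s 9) e₀ x (s 44 0 0) (i + 1) (i + 1) (row s₃ 8) := fun h =>
    ⟨hup.first, hup.supp, hup.mem, hup.inj, fun e hem hlt hee hex hle => by
      rcases Nat.lt_succ_iff_lt_or_eq.1 hlt with hlt | rfl
      · exact hJ.total e hem hlt hee hex hle
      · rcases h with h | h
        · exact absurd h hee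
        · exact absurd hex h⟩
  refine does_cond (fun h => does_skip (htriv (Or.inl ?_))) fun h => ?_
  · rw [eval_eq] at h
    simpa only [eval, hv, h40₃] using h
  have hne : i ≠ e₀ := fun heq => (eval_eq (s := s₃) (x := .var 63) (y := .var 40)).2
    (by simp only [eval, hv, h40₃, heq]) h
  have hat := env₃.eval_at (.var 63) (.var 64)
  simp only [eval, hv, h64₃] at hat
  refine does_cond (fun h => ?_) fun h => does_skip (htriv (Or.inr fun hinc => hat.2 hinc h))
  have hinc := hat.1 h
  apply does_set_seq
  rw [env₃.eval_other]
  simp only [eval, hv, h64₃]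
  set s₄ := s₃.write 65 0 0 (I.other i x) with hs₄
  have env₄ : Env I s₄ := env₃.write (by decide)
  have h8₄ : row s₄ 8 = row s₃ 8 := row_write (by decide)
  have h9₄ : row s₄ 9 = row s 9 := by rw [hs₄, row_write (by decide), h9₃]
  refine (does_forColor (fun S s' => I.CandInv (row s 9) e₀ x (s 44 0 0) (i + 1) i (row s' 8) ∧
    (row s' 8 i ≠ 0 ∨ ∀ c ∈ S, c ∈ I.missing (row s 9) (I.other i x) →
      ¬ I.Free (row s' 8) (I.other i x) c)) env₄.toRep hm (by decide) (by decide) (by decide)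
    (fun S s' a y ha h => by rwa [row_write (by omega)]) ⟨by rw [h8₄]; exact hup, Or.inr (by simp)⟩
    fun S s₅ _ j hs₅ hc hJ₅ => ?_).mono fun s' _ h => h.1.finish hi hinc h.2
  have h9₅ : row s₅ 9 = row s 9 := by rw [row_congr (hs₅ 9 (by decide)), h9₄]
  have := does_assignColor (S := S) (env₄.of_sameOff hs₅ (by decide)) hm hi hne hinc
    (a := s 44 0 0) (by rw [hs₅ 63 (by decide), hs₄, Mem.write_of_ne (by decide), hv])
    (by rw [hs₅ 65 (by decide), hs₄, Mem.write_same]; simp) hc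
    (by rw [h9₅]; exact hJ₅.1) (by rw [h9₅]; exact hJ₅.2)
  rwa [h9₅] at this

/-- Tries all moves for a given fan. -/
def trialsP : Prog :=
  forP 45 (.add mE (.lit 1)) (forP 46 (.lit 2)
    (forColor 47 48 49 (forColor 50 51 52 candidateP)))

theorem does_trials (hZ : SearchState I φ X s) (hN : I.n + I.m + 2 ≤ N) (he : s 40 0 0 < I.m)
    (ho : s 41 0 0 < 2) :
    Does N trialsP s (SearchState I φ (X ∧ ∀ t < I.m + 1, ∀ sw < 2, ∀ c ∈ I.colors, ∀ d ∈ I.colors,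
      Visited I φ φ (s 40 0 0) (s 41 0 0) (row s 8) t sw c d)) := by
  have hm : I.m ≤ N := by omega
  set V := Visited I φ φ (s 40 0 0) (s 41 0 0) (row s 8) with hV
  unfold trialsP
  refine does_for (k := I.m + 1) (fun i s' => SearchState I φ (X ∧ ∀ t < i, ∀ sw < 2, ∀ c ∈ I.colors,
    ∀ d ∈ I.colors, V t sw c d) s') (by decide) (by omega)
    (fun s' hs => by change s' 0 0 1 + 1 = _; rw [hs 0 (by decide), hZ.env.m])
    (fun i s' y h => h.write (by decide)) (hZ.imp fun h => ⟨h, by omega⟩)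
    fun t ht s₁ hs₁ hv₁ hZ₁ => ?_
  refine (does_for (k := 2) (fun i s' => SearchState I φ ((X ∧ ∀ t' < t, ∀ sw < 2, ∀ c ∈ I.colors,
    ∀ d ∈ I.colors, V t' sw c d) ∧ ∀ sw < i, ∀ c ∈ I.colors,
    ∀ d ∈ I.colors, V t sw c d) s') (by decide) (by omega)
    (fun s' hs => rfl)
    (fun i s' y h => h.write (by decide)) (hZ₁.imp fun h => ⟨h, by omega⟩)
    fun sw hsw s₂ hs₂ hv₂ hZ₂ => ?_).mono fun s' _ h => h.imp fun ⟨⟨h1, h2⟩, h3⟩ => ⟨h1, ?_⟩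
  swap
  · intro t' ht'
    rcases Nat.lt_succ_iff_lt_or_eq.1 ht' with ht' | rfl
    · exact h2 t' ht'
    · exact h3
  refine (does_forColor (fun S s' => SearchState I φ (((X ∧ ∀ t' < t, ∀ sw < 2, ∀ c ∈ I.colors,
    ∀ d ∈ I.colors, V t' sw c d) ∧ ∀ sw' < sw, ∀ c ∈ I.colors,
    ∀ d ∈ I.colors, V t sw' c d) ∧ ∀ c ∈ S, ∀ d ∈ I.colors, V t sw c d) s')
    hZ₂.env.toRep hm (by decide) (by decide) (by decide)
    (fun S s' a y ha h => h.write (by omega)) (hZ₂.imp fun h => ⟨h, by simp⟩)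
    fun S s₃ e j hs₃ hc₃ hZ₃ => ?_).mono fun s' _ h => h.imp fun ⟨⟨h1, h2⟩, h3⟩ => ⟨h1, ?_⟩
  swap
  · intro sw' hsw'
    rcases Nat.lt_succ_iff_lt_or_eq.1 hsw' with hsw' | rfl
    · exact h2 sw' hsw'
    · exact h3
  refine (does_forColor (fun S' s' => SearchState I φ ((((X ∧ ∀ t' < t, ∀ sw < 2, ∀ c ∈ I.colors,
    ∀ d ∈ I.colors, V t' sw c d) ∧ ∀ sw' < sw, ∀ c ∈ I.colors,
    ∀ d ∈ I.colors, V t sw' c d) ∧ ∀ c ∈ S, ∀ d ∈ I.colors, V t sw c d) ∧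
    ∀ d ∈ S', V t sw (I.lst e j) d) s')
    hZ₃.env.toRep hm (by decide) (by decide) (by decide)
    (fun S s' a y ha h => h.write (by omega)) (hZ₃.imp fun h => ⟨h, by simp⟩)
    fun S' s₄ e' j' hs₄ hc₄ hZ₄ => ?_).mono fun s' _ h => h.imp fun ⟨⟨h1, h2⟩, h3⟩ => ⟨h1, ?_⟩
  swap
  · rintro c (rfl | hc)
    · exact h3
    · exact h2 c hc
  have hsame : ∀ a, a = 40 ∨ a = 41 ∨ a = 8 → s₄ a = s a := by
    rintro a (rfl | rfl | rfl) <;>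
    rw [hs₄ _ (by decide), hs₃ _ (by decide), hs₂ _ (by decide), hs₁ _ (by decide)]
  have h40 := hsame 40 (by omega)
  have h41 := hsame 41 (by omega)
  have h8 := row_congr (hsame 8 (by omega))
  have h45 : s₄ 45 0 0 = t := by
    rw [hs₄ _ (by decide), hs₃ _ (by decide), hs₂ _ (by decide), hv₁]
  have h46 : s₄ 46 0 0 = sw := by rw [hs₄ _ (by decide), hs₃ _ (by decide), hv₂]
  have h49 : s₄ 49 0 0 = I.lst e j := by rw [hs₄ _ (by decide), hc₃]
  refine (does_candidate hZ₄ hN (by rw [h40]; exact he) (by rw [h41]; exact ho)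
    (by omega)).mono fun s' _ h => h.imp fun ⟨⟨h1, h2⟩, h3⟩ => ⟨h1, ?_⟩
  rw [h40, h41, h8, h45, h46, h49, hc₄] at h3
  rintro d (rfl | hd)
  · exact h3
  · exact h2 d hd

/-- A round of the local search: tries all fans, and records in the variable `11` whether the
current coloring was changed. -/
def roundP : Prog :=
  .seq (set 11 (.lit 0)) (forP 40 mE (forP 41 (.lit 2) (forColor 42 43 44 (.seq candP trialsP))))

set_option maxRecDepth 10000 in
theorem does_round (env : Env I s) (hN : I.n + I.m + 2 ≤ N) (h9 : I.IsPartial (row s 9))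
    (h4 : I.IsPartial (row s 4)) :
    Does N roundP s (SearchState I (row s 9) (I.LocalMax (row s 9))) := by
  have hm : I.m ≤ N := by omega
  unfold roundP
  apply does_set_seq
  set φ := row s 9 with hφ
  set s₀ : Mem := Mem.write _ 11 0 0 _ with hs₀
  have h9₀ : row s₀ 9 = φ := row_write (by decide)
  have hZ : SearchState I φ True s₀ := ⟨env.write (by decide), by rw [h9₀]; exact h9,
    by rw [hs₀, row_write (by decide)]; exact h4, Or.inl ⟨by simp [hs₀, Mem.write_same, eval],
      h9₀, trivial⟩⟩
  set R : ℕ → ℕ → ℕ → Prop := fun e₀ o a => ∃ cand,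
    I.IsCand φ e₀ (I.ends e₀ o) a cand ∧ I.NoGain φ e₀ o cand with hR
  refine (does_for (k := I.m) (fun i s' => SearchState I φ (∀ e < i, ∀ o < 2, ∀ a ∈ I.colors, R e o a) s')
    (by decide) hm (fun s' hs => by change s' 0 0 1 = _; rw [hs 0 (by decide), hZ.env.m])
    (fun i s' y h => h.write (by decide)) (hZ.imp fun _ => by omega)
    fun e he s₁ hs₁ hv₁ hZ₁ => ?_).mono fun s' _ h => h.imp fun h e he o ho a ha =>
      h e he o ho a (Inst.mem_colors ha)
  refine (does_for (k := 2) (fun i s' => SearchState I φ ((∀ e' < e, ∀ o < 2, ∀ a ∈ I.colors, R e' o a) ∧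
    ∀ o < i, ∀ a ∈ I.colors, R e o a) s') (by decide) (by omega) (fun s' hs => rfl)
    (fun i s' y h => h.write (by decide)) (hZ₁.imp fun h => ⟨h, by omega⟩)
    fun o ho s₂ hs₂ hv₂ hZ₂ => ?_).mono fun s' _ h => h.imp fun ⟨h1, h2⟩ => ?_
  swap
  · intro e' he'
    rcases Nat.lt_succ_iff_lt_or_eq.1 he' with he' | rfl
    · exact h1 e' he'
    · exact h2
  refine (does_forColor (fun S s' => SearchState I φ (((∀ e' < e, ∀ o < 2, ∀ a ∈ I.colors, R e' o a) ∧
    ∀ o' < o, ∀ a ∈ I.colors, R e o' a) ∧ ∀ a ∈ S, R e o a) s')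
    hZ₂.env.toRep hm (by decide) (by decide) (by decide)
    (fun S s' a y ha h => h.write (by omega)) (hZ₂.imp fun h => ⟨h, by simp⟩)
    fun S s₃ e' j hs₃ hc₃ hZ₃ => ?_).mono fun s' _ h => h.imp fun ⟨⟨h1, h2⟩, h3⟩ => ⟨h1, ?_⟩
  swap
  · intro o' ho'
    rcases Nat.lt_succ_iff_lt_or_eq.1 ho' with ho' | rfl
    · exact h2 o' ho'
    · exact h3
  have h40 : s₃ 40 0 0 = e := by rw [hs₃ _ (by decide), hs₂ _ (by decide), hv₁]
  have h41 : s₃ 41 0 0 = o := by rw [hs₃ _ (by decide), hv₂]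
  refine does_seq (does_cand hZ₃.env hm (by omega)) fun s₄ hs₄ h₄ => ?_
  have hZ₄ := hZ₃.of_sameOff' hs₄ (by decide)
  have h40₄ : s₄ 40 0 0 = e := by rw [hs₄ 40 (by decide), h40]
  have h41₄ : s₄ 41 0 0 = o := by rw [hs₄ 41 (by decide), h41]
  rw [h40, h41, hc₃] at h₄
  refine (does_trials (φ := φ) (X := I.IsCand φ e (I.ends e o) (I.lst e' j) (row s₄ 8) ∧
    (((∀ e' < e, ∀ o < 2, ∀ a ∈ I.colors, R e' o a) ∧ ∀ o' < o, ∀ a ∈ I.colors, R e o' a) ∧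
      ∀ a ∈ S, R e o a))
    ⟨hZ₄.env, hZ₄.current, hZ₄.trial, ?_⟩ hN (by omega) (by omega)).mono
    fun s' _ h => h.imp fun ⟨⟨h1, ⟨h2, h5⟩⟩, h3⟩ => ⟨h2, ?_⟩
  · refine hZ₄.cases.imp_left fun ⟨h1, h2, h3⟩ => ⟨h1, h2, ?_, h3⟩
    have : row s₃ 9 = φ := by rw [← h2, row_congr (hs₄ 9 (by decide))]
    rwa [this] at h₄
  · rw [h40₄, h41₄] at h3
    rintro a (rfl | ha)
    · refine ⟨_, h1, fun i hi => ?_, fun t ht sw hsw c hc d hd => ?_⟩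
      · have hc : I.lst e 0 ∈ I.colors := ⟨e, he, 0, by omega, rfl⟩
        exact (h3 i (by omega) 0 (by omega) _ hc _ hc).1 i le_rfl
      · exact (h3 t (by omega) sw hsw c (Inst.mem_colors hc) d (Inst.mem_colors hd)).2
    · exact h5 a ha

end RAM

/-! ### Bounds for the score, and proper colorings -/

namespace Inst

variable {I : Inst}

theorem deg_le (v : ℕ) : I.deg v ≤ I.m := by
  simpa [deg] using Finset.card_filter_le (Finset.range I.m) fun e => I.Inc e v

variable (I) in
/-- A polynomial upper bound for the score, and so for the number of rounds of the local search. -/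
def scoreBound : ℕ := I.m * (2 * (1 + 2 * I.m * I.m) + 2 * I.m)

theorem K_le : I.K ≤ 1 + 2 * I.m * I.m := by
  have : ∑ e ∈ Finset.range I.m, (I.deg (I.ends e 0) + I.deg (I.ends e 1)) ≤
      ∑ _e ∈ Finset.range I.m, 2 * I.m :=
    Finset.sum_le_sum fun e _ => by
      have h0 := deg_le (I := I) (I.ends e 0)
      have h1 := deg_le (I := I) (I.ends e 1)
      omega
  simp only [Finset.sum_const, Finset.card_range, smul_eq_mul] at this
  unfold K
  linarith [mul_comm I.m (2 * I.m)]

theorem score_le (φ : ℕ → ℕ) : I.score φ ≤ I.scoreBound := by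
  have hF : ∀ v c, I.F v c ≤ I.K := fun v c => by unfold F; split_ifs <;> omega
  have : I.score φ ≤ ∑ _e ∈ Finset.range I.m, (2 * (1 + 2 * I.m * I.m) + 2 * I.m) := by
    refine Finset.sum_le_sum fun e _ => ?_
    have h0 := deg_le (I := I) (I.ends e 0)
    have h1 := deg_le (I := I) (I.ends e 1)
    have h2 := hF (I.ends e 0) (φ e)
    have h3 := hF (I.ends e 1) (φ e)
    have h4 := I.K_le
    unfold W
    split_ifs <;> omega
  simpa [scoreBound] using this

variable (I) in
/-- A proper coloring of some of the edges from their lists, the value `0` standing for uncolored.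
-/
structure IsProper (φ : ℕ → ℕ) : Prop where
  mem : ∀ e < I.m, φ e ≠ 0 → ∃ j, I.lst e j = φ e
  inj : ∀ e < I.m, ∀ e' < I.m, ∀ v, I.Inc e v → I.Inc e' v → φ e = φ e' → φ e ≠ 0 → e = e'

theorem IsPartial.isProper {φ : ℕ → ℕ} (h : I.IsPartial φ) : I.IsProper φ := by
  refine ⟨fun e he hne => ?_, h.inj⟩
  obtain ⟨hs, hc⟩ := W_ne_zero.1 (h.weight e he hne)
  have key : ∀ v, I.Inc e v → φ e ∈ I.common v → ∃ j, I.lst e j = φ e := fun v hv hc => by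
    obtain ⟨j, -, hj⟩ := (Finset.mem_filter.1 hc).2 e he hv hs
    exact ⟨j, hj⟩
  rcases hc with hc | hc
  · exact key _ (Or.inl rfl) hc
  · exact key _ (Or.inr rfl) hc

theorem IsPartial.zero_coloring : I.IsPartial fun _ => 0 :=
  ⟨fun _ _ => rfl, fun _ _ h => absurd rfl h, fun _ _ _ _ _ _ _ _ h => absurd rfl h⟩

theorem IsProper.update {φ : ℕ → ℕ} (h : I.IsProper φ) {i j : ℕ} (h0 : φ i = 0)
    (h1 : I.Free φ (I.ends i 0) (I.lst i j)) (h2 : I.Free φ (I.ends i 1) (I.lst i j)) :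
    I.IsProper (Function.update φ i (I.lst i j)) := by
  have hfree : ∀ e < I.m, ∀ v, I.Inc i v → I.Inc e v → φ e ≠ I.lst i j := by
    rintro e he v (rfl | rfl) hv
    · exact h1 e he hv
    · exact h2 e he hv
  constructor
  · intro e he hne
    by_cases hei : e = i
    · subst hei; exact ⟨j, by rw [Function.update_self]⟩
    · rw [Function.update_of_ne hei] at hne ⊢; exact h.mem e he hne
  · intro e he e' he' v hv hv' heq hne
    by_cases hei : e = i
    · subst hei
      by_cases hei' : e' = e
      · exact hei'.symm
      · rw [Function.update_self, Function.update_of_ne hei'] at heq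
        exact absurd heq.symm (hfree e' he' v hv hv')
    · by_cases hei' : e' = i
      · subst hei'
        rw [Function.update_self, Function.update_of_ne hei] at heq
        exact absurd heq (hfree e he v hv' hv)
      · rw [Function.update_of_ne hei] at heq hne
        rw [Function.update_of_ne hei'] at heq
        exact h.inj e he e' he' v hv hv' heq hne

variable (I) in
/-- The rows of colors have no repetitions and no entries after their ends. -/
structure ListsOk : Prop where
  nodup : ∀ e < I.m, ∀ i j, I.lst e i ≠ 0 → I.lst e i = I.lst e j → i = j
  zero_of_le : ∀ e < I.m, ∀ i j, i ≤ j → I.lst e i = 0 → I.lst e j = 0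

/-- A list of at least `m` colors contains a color that none of the other `m - 1` edges has. -/
theorem ListsOk.ne_zero_of_tried (h : I.ListsOk) {φ : ℕ → ℕ} {i : ℕ} (hi : i < I.m)
    (hs : ¬ I.IsShort i)
    (ht : φ i ≠ 0 ∨ ∀ j < I.m, I.lst i j = 0 ∨ ∃ e < I.m, e ≠ i ∧ φ e = I.lst i j) :
    φ i ≠ 0 := by
  rcases ht with ht | ht
  · exact ht
  exfalso
  have hne : ∀ j < I.m, I.lst i j ≠ 0 := fun j hj h0 =>
    hs (h.zero_of_le i hi j _ (by omega) h0)
  have hsub : (Finset.range I.m).image (I.lst i) ⊆ ((Finset.range I.m).erase i).image φ := by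
    intro c hc
    obtain ⟨j, hj, rfl⟩ := Finset.mem_image.1 hc
    rw [Finset.mem_range] at hj
    obtain ⟨e, he, hei, heq⟩ := (ht j hj).resolve_left (hne j hj)
    exact Finset.mem_image.2 ⟨e, by simp [hei, he], heq⟩
  have h1 := Finset.card_le_card hsub
  rw [Finset.card_image_of_injOn] at h1
  · have h2 := h1.trans Finset.card_image_le
    rw [Finset.card_erase_of_mem (by simpa using hi), Finset.card_range] at h2
    omega
  · intro j hj j' hj' heq
    simp only [Finset.coe_range, Set.mem_Iio] at hj hj'
    exact h.nodup i hi j j' (hne j hj) heq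

end Inst

/-! ### The complete program -/

namespace RAM

open Exp Prog

variable {I : Inst} {N : ℕ} {s : Mem}

/-- The local search: rounds until nothing changes any more. -/
def searchP : Prog := .seq (set 11 (.lit 1)) (.loop (.var 11) roundP)

theorem does_search (env : Env I s) (hN : I.n + I.m + 2 ≤ N) (hB : I.scoreBound + 1 ≤ N)
    (h9 : I.IsPartial (row s 9)) (h4 : I.IsPartial (row s 4)) :
    Does N searchP s fun s' => Env I s' ∧ I.IsPartial (row s' 9) ∧ I.LocalMax (row s' 9) := by
  unfold searchP
  apply does_set_seq
  refine (does_loop (fun s' => Env I s' ∧ I.IsPartial (row s' 9) ∧ I.IsPartial (row s' 4) ∧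
      (s' 11 0 0 = 0 → I.LocalMax (row s' 9)))
    (fun s' => if s' 11 0 0 = 0 then 0 else I.scoreBound - I.score (row s' 9) + 1)
    ?_ ⟨env.write (by decide), ?_, ?_, ?_⟩ ?_).mono fun s' _ ⟨⟨h1, h2, _, h3⟩, h4⟩ =>
      ⟨h1, h2, h3 h4⟩
  · rintro s' ⟨h1, h2, h3, -⟩ h5
    change s' 11 0 0 ≠ 0 at h5
    simp only [if_neg h5]
    refine ⟨by omega, (does_round h1 hN h2 h3).mono fun s'' _ h => ⟨⟨h.env, h.current, h.trial,
      fun h0 => ?_⟩, ?_⟩⟩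
    · rcases h.cases with ⟨-, h6, h7⟩ | ⟨h6, -⟩
      · rw [h6]; exact h7
      · exact absurd h0 h6
    · rcases h.cases with ⟨h6, -, -⟩ | ⟨h6, h7⟩
      · rw [if_pos h6]; omega
      · rw [if_neg h6]
        have := Inst.score_le (I := I) (row s'' 9)
        omega
  · rw [row_write (by decide)]; exact h9
  · rw [row_write (by decide)]; exact h4
  · intro h; simp [Mem.write_same, eval] at h
  · split_ifs
    · omega
    · omega

/-- Increases the entry of the vertex `x` in the table of degrees. -/
def incrP (x : Exp) : Prog := .assign 7 x (.lit 0) (.add (cellE 7 x) (.lit 1))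

/-- Computes the table of degrees. -/
def degP : Prog := forP 33 mE (.seq (incrP (endE (.var 33) (.lit 0)))
  (incrP (endE (.var 33) (.lit 1))))

theorem does_deg (rep : Rep I s) (hm : I.m ≤ N) (h0 : ∀ v, s 7 v 0 = 0) :
    Does N degP s fun s' => ∀ v, s' 7 v 0 = I.deg v := by
  unfold degP
  refine does_for (k := I.m) (fun i s' => ∀ v, s' 7 v 0 =
    ((Finset.range i).filter fun e => I.Inc e v).card) (by decide) hm
    (fun s' hs => (rep.of_sameOff hs (by decide)).eval_m)
    (fun i s' x h => by rwa [Mem.write_of_ne (by decide)]) (by simpa using h0)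
    fun i hi s' hs hv hJ => ?_
  have rep' := rep.of_sameOff hs (by decide)
  have hne := I.ends_ne i hi
  unfold incrP
  apply does_assign_seq
  apply does_assign
  intro v
  have h1 := rep'.ends
  simp only [eval, endE, cellE, Mem.write_same, Mem.write_of_ne (show (33 : ℕ) ≠ 7 by decide),
    Mem.write_of_ne (show (1 : ℕ) ≠ 7 by decide), hv, h1, and_true, hJ]
  rw [Finset.range_add_one, Finset.filter_insert]
  unfold Inst.Inc
  split_ifs with h2 h3 h4 h5 <;> first | omega | rw [Finset.card_insert_of_notMem (by simp)]
  all_goals first | omega | (subst_vars; rfl)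

/-- Computes `Inst.K`. -/
def bonusP : Prog := .seq (set 10 (.lit 1)) (forP 33 mE (set 10 (.add (.var 10)
  (.add (cellE 7 (endE (.var 33) (.lit 0))) (cellE 7 (endE (.var 33) (.lit 1)))))))

theorem does_bonus (rep : Rep I s) (hm : I.m ≤ N) (h7 : ∀ v, s 7 v 0 = I.deg v) :
    Does N bonusP s fun s' => s' 10 0 0 = I.K := by
  unfold bonusP
  apply does_set_seq
  have rep₁ : Rep I (s.write 10 0 0 (Exp.eval s (.lit 1))) := rep.write (by decide)
  refine does_for (k := I.m) (fun i s' => s' 10 0 0 =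
    1 + ∑ e ∈ Finset.range i, (I.deg (I.ends e 0) + I.deg (I.ends e 1))) (by decide) hm
    (fun s' hs => (rep₁.of_sameOff hs (by decide)).eval_m)
    (fun i s' x h => by rwa [Mem.write_of_ne (by decide)]) (by simp [Mem.write_same, eval])
    fun i hi s' hs hv hJ => ?_
  have rep' := rep₁.of_sameOff hs (by decide)
  have h7' : ∀ v, s' 7 v 0 = I.deg v := by
    rw [hs 7 (by decide), Mem.write_of_ne (by decide)]; exact h7
  apply does_set
  simp only [eval, endE, cellE, Mem.write_same, hv, rep'.ends, h7', hJ, and_self, if_true,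
    Finset.sum_range_succ]
  omega

/-- Determines whether the color `44` is in the list of the edge `33`. -/
def listsP : Prog :=
  .seq (set 34 (.lit 0)) (forP 35 mE (.cond (eq (.read 2 (.var 33) (.var 35)) (.var 44))
    (set 34 (.lit 1)) .skip))

theorem does_lists (rep : Rep I s) (hm : I.m ≤ N) :
    Does N listsP s fun s' => s' 34 0 0 ≠ 0 ↔ ∃ j < I.m, I.lst (s 33 0 0) j = s 44 0 0 := by
  unfold listsP
  apply does_set_seq
  set s₁ := s.write 34 0 0 (Exp.eval s (.lit 0)) with hs₁
  have rep₁ : Rep I s₁ := rep.write (by decide)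
  refine does_for (k := I.m) (fun i s' => s' 34 0 0 ≠ 0 ↔ ∃ j < i, I.lst (s 33 0 0) j = s 44 0 0)
    (by decide) hm (fun s' hs => (rep₁.of_sameOff hs (by decide)).eval_m)
    (fun i s' x h => by rwa [Mem.write_of_ne (by decide)]) (by simp [hs₁, Mem.write_same, eval])
    fun i hi s' hs hv hJ => ?_
  have rep' := rep₁.of_sameOff hs (by decide)
  have h33 : s' 33 = s 33 := by rw [hs 33 (by decide), hs₁, Mem.write_of_ne (by decide)]
  have h44 : s' 44 = s 44 := by rw [hs 44 (by decide), hs₁, Mem.write_of_ne (by decide)]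
  have hb := eval_eq (s := s') (x := .read 2 (.var 33) (.var 35)) (y := .var 44)
  simp only [eval, rep'.lst, h33, h44, hv] at hb
  refine does_cond (fun h => does_set ?_) (fun h => does_skip ?_)
  · refine iff_of_true (by simp [Mem.write_same, eval]) ⟨i, by omega, hb.1 h⟩
  · rw [hJ]
    refine ⟨fun ⟨j, hj, h'⟩ => ⟨j, by omega, h'⟩, fun ⟨j, hj, h'⟩ => ⟨j, ?_, h'⟩⟩
    rcases Nat.lt_succ_iff_lt_or_eq.1 hj with hj | rfl
    · exact hj
    · exact absurd h (hb.2 h')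

/-- The test whether the edge `e` is short. -/
def shortE (e : Exp) : Exp := eq (.read 2 e (.sub mE (.lit 1))) (.lit 0)

theorem Rep.eval_short (h : Rep I s) (e : Exp) : (shortE e).eval s ≠ 0 ↔ I.IsShort (e.eval s) := by
  unfold shortE
  rw [eval_eq]
  simp only [eval, mE, h.m, h.lst]
  rfl

/-- Computes the bonus of the color `44` at the vertex `31`. -/
def commonP : Prog :=
  .seq (.cond (.var 44) (.assign 6 (.var 31) (.var 44) (.var 10))
      (.assign 6 (.var 31) (.var 44) (.lit 0)))
    (forP 33 mE (.cond (Exp.and (atE (.var 33) (.var 31)) (shortE (.var 33)))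
      (.seq listsP (.cond (.var 34) .skip (.assign 6 (.var 31) (.var 44) (.lit 0)))) .skip))

end RAM

open scoped Classical in
/-- The bonus of `c` at `v` if only the edges below `i` are taken into account. It does not refer to
the palette, which contains all nonzero colors in `I.colors` anyway. -/
noncomputable def Inst.bonusBelow (I : Inst) (v c i : ℕ) : ℕ :=
  if c ≠ 0 ∧ ∀ e < i, I.Inc e v → I.IsShort e → ∃ j < I.m, I.lst e j = c then I.K else 0

theorem Inst.mem_palette {I : Inst} {c : ℕ} : c ∈ I.palette ↔ c ≠ 0 ∧ c ∈ I.colors := by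
  simp [palette, colors, and_assoc]

theorem Inst.bonusBelow_eq {I : Inst} {v c : ℕ} (h : c ∈ I.colors) :
    I.bonusBelow v c I.m = I.F v c := by
  unfold bonusBelow F common
  simp only [Finset.mem_filter, mem_palette, h, and_true]

namespace RAM

open Exp Prog

variable {I : Inst} {N : ℕ} {s : Mem}

theorem does_common (rep : Rep I s) (hm : I.m ≤ N) {v c : ℕ} (hv : s 31 0 0 = v)
    (hc : s 44 0 0 = c) (hK : s 10 0 0 = I.K) :
    Does N commonP s fun s' => s' 6 v c = I.bonusBelow v c I.m ∧
      ∀ v' c', v' ≠ v ∨ c' ≠ c → s' 6 v' c' = s 6 v' c' := by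
  unfold commonP
  have hother : ∀ (s' : Mem) x v' c', v' ≠ v ∨ c' ≠ c → s'.write 6 v c x 6 v' c' = s' 6 v' c' :=
    fun s' x v' c' h => by rw [Mem.write_same, if_neg (by omega)]
  refine does_seq (Q := fun s' => s' 6 v c = I.bonusBelow v c 0 ∧
      ∀ v' c', v' ≠ v ∨ c' ≠ c → s' 6 v' c' = s 6 v' c') ?_ fun s₁ hs₁ hJ₁ => ?_
  · refine does_cond (fun h => does_assign ?_) (fun h => does_assign ?_)
    all_goals
      simp only [eval, hv, hc] at h ⊢
      refine ⟨?_, hother _ _⟩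
      simp [Mem.write_same, Inst.bonusBelow, h, hK]
  have rep₁ := rep.of_sameOff hs₁ (by decide)
  refine does_for (k := I.m) (fun i s' => s' 6 v c = I.bonusBelow v c i ∧
      ∀ v' c', v' ≠ v ∨ c' ≠ c → s' 6 v' c' = s 6 v' c') (by decide) hm
    (fun s' hs => (rep₁.of_sameOff hs (by decide)).eval_m)
    (fun i s' x h => by rwa [Mem.write_of_ne (by decide)]) hJ₁ fun i hi s₂ hs₂ hi₂ hJ₂ => ?_
  have rep₂ := rep₁.of_sameOff hs₂ (by decide)
  have hv₂ : s₂ 31 0 0 = v := by rw [hs₂ 31 (by decide), hs₁ 31 (by decide), hv]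
  have hc₂ : s₂ 44 0 0 = c := by rw [hs₂ 44 (by decide), hs₁ 44 (by decide), hc]
  have hstay : ∀ s' : Mem, s' 6 = s₂ 6 →
      (I.Inc i v → I.IsShort i → ∃ j < I.m, I.lst i j = c) →
      s' 6 v c = I.bonusBelow v c (i + 1) ∧
      ∀ v' c', v' ≠ v ∨ c' ≠ c → s' 6 v' c' = s 6 v' c' := by
    intro s' h h'
    rw [h]
    refine ⟨hJ₂.1.trans ?_, hJ₂.2⟩
    unfold Inst.bonusBelow
    congr 1
    refine propext (and_congr_right fun _ => ⟨fun h1 e he => ?_, fun h1 e he => h1 e (by omega)⟩)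
    rcases Nat.lt_succ_iff_lt_or_eq.1 he with he | rfl
    · exact h1 e he
    · exact h'
  have hb : (Exp.and (atE (.var 33) (.var 31)) (shortE (.var 33))).eval s₂ ≠ 0 ↔
      I.Inc i v ∧ I.IsShort i := by
    rw [eval_and, rep₂.eval_at, rep₂.eval_short]
    simp only [eval, hi₂, hv₂]
  refine does_cond (fun h => ?_) fun h => does_skip (hstay _ rfl fun h1 h2 =>
    absurd h (hb.2 ⟨h1, h2⟩))
  refine does_seq (does_lists rep₂ hm) fun s₃ hs₃ h₃ => ?_
  rw [hi₂, hc₂] at h₃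
  have h6 : s₃ 6 = s₂ 6 := hs₃ 6 (by decide)
  refine does_cond (fun h' => does_skip (hstay _ h6 fun _ _ => h₃.1 h')) fun h' => does_assign ?_
  have hv₃ : s₃ 31 0 0 = v := by rw [hs₃ 31 (by decide), hv₂]
  have hc₃ : s₃ 44 0 0 = c := by rw [hs₃ 44 (by decide), hc₂]
  simp only [eval, hv₃, hc₃]
  refine ⟨?_, fun v' c' h1 => by rw [hother _ _ _ _ h1, h6, hJ₂.2 _ _ h1]⟩
  rw [Inst.bonusBelow, if_neg]
  · simp [Mem.write_same]
  · exact fun h1 => h₃.2 (h1.2 i (by omega) (hb.1 h).1 (hb.1 h).2) h'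

/-- Computes the table of the bonuses. -/
def tableP : Prog := forColor 42 43 44 (forP 31 nE commonP)

theorem does_table (rep : Rep I s) (hm : I.m ≤ N) (hn : I.n ≤ N) (hK : s 10 0 0 = I.K)
    (h0 : ∀ v c, s 6 v c = 0) :
    Does N tableP s fun s' => ∀ v < I.n, ∀ c, s' 6 v c = I.F v c := by
  unfold tableP
  refine (does_forColor (fun S s' => (∀ v < I.n, ∀ c ∈ S, s' 6 v c = I.bonusBelow v c I.m) ∧
    ∀ v, ∀ c ∉ S, s' 6 v c = 0) rep hm (by decide) (by decide) (by decide)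
    (fun S s' a x ha h => by rwa [Mem.write_of_ne (by omega)]) (by simpa using h0)
    fun S s₁ e j hs₁ hc₁ hJ₁ => ?_).mono fun s' _ h v hv c => ?_
  swap
  · by_cases hc : c ∈ I.colors
    · rw [h.1 v hv c hc, Inst.bonusBelow_eq hc]
    · rw [h.2 v c hc, Inst.F, if_neg]
      exact fun h' => hc (Inst.mem_colors (Finset.filter_subset _ _ h'))
  have rep₁ := rep.of_sameOff hs₁ (by decide)
  set c := I.lst e j with hc
  refine (does_for (k := I.n) (fun i s' => (∀ v < i, s' 6 v c = I.bonusBelow v c I.m) ∧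
    ∀ v c', c' ≠ c → s' 6 v c' = s₁ 6 v c') (by decide) hn
    (fun s' hs => (rep₁.of_sameOff hs (by decide)).eval_n)
    (fun i s' x h => by rwa [Mem.write_of_ne (by decide)]) ⟨by omega, fun _ _ _ => rfl⟩
    fun i hi s₂ hs₂ hi₂ hJ₂ => ?_).mono fun s' _ h => ⟨?_, ?_⟩
  · have rep₂ := rep₁.of_sameOff hs₂ (by decide)
    refine (does_common rep₂ hm hi₂ (c := c) (by rw [hs₂ 44 (by decide), hc₁])
      (by rw [hs₂ 10 (by decide), hs₁ 10 (by decide), hK])).mono fun s' _ h => ⟨?_, ?_⟩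
    · intro v hv
      rcases Nat.lt_succ_iff_lt_or_eq.1 hv with hv | rfl
      · rw [h.2 v c (Or.inl (by omega)), hJ₂.1 v hv]
      · exact h.1
    · intro v c' hc'
      rw [h.2 v c' (Or.inr hc'), hJ₂.2 v c' hc']
  · intro v hv c' hc'
    by_cases hcc : c' = c
    · rw [hcc]; exact h.1 v hv
    · rw [h.2 v c' hcc]; exact hJ₁.1 v hv c' (hc'.resolve_left hcc)
  · intro v c' hc'
    rw [Set.mem_insert_iff, not_or] at hc'
    rw [h.2 v c' hc'.1]; exact hJ₁.2 v c' hc'.2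

/-- Computes the table of the weights. -/
def weightP : Prog := forColor 42 43 44 (forP 33 mE
  (.cond (Exp.and (shortE (.var 33)) (.add (.read 6 (endE (.var 33) (.lit 0)) (.var 44))
      (.read 6 (endE (.var 33) (.lit 1)) (.var 44))))
    (.assign 5 (.var 33) (.var 44) (.add (.add (.read 6 (endE (.var 33) (.lit 0)) (.var 44))
      (.read 6 (endE (.var 33) (.lit 1)) (.var 44))) (.add (cellE 7 (endE (.var 33) (.lit 0)))
        (cellE 7 (endE (.var 33) (.lit 1))))))
    (.assign 5 (.var 33) (.var 44) (.lit 0))))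

theorem does_weight (rep : Rep I s) (hm : I.m ≤ N) (h6 : ∀ v < I.n, ∀ c, s 6 v c = I.F v c)
    (h7 : ∀ v, s 7 v 0 = I.deg v) (h0 : ∀ e c, s 5 e c = 0) :
    Does N weightP s fun s' => Env I s' := by
  unfold weightP
  refine (does_forColor (fun S s' => (∀ e < I.m, ∀ c ∈ S, s' 5 e c = I.W e c) ∧
    ∀ e, ∀ c ∉ S, s' 5 e c = 0) rep hm (by decide) (by decide) (by decide)
    (fun S s' a x ha h => by rwa [Mem.write_of_ne (by omega)]) (by simpa using h0)
    fun S s₁ e j hs₁ hc₁ hJ₁ => ?_).mono fun s' hs h =>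
      ⟨rep.of_sameOff hs (by decide), fun e he c => ?_, by rw [hs 6 (by decide)]; exact h6⟩
  swap
  · by_cases hc : c ∈ I.colors
    · exact h.1 e he c hc
    · rw [h.2 e c hc]
      by_contra hne
      obtain ⟨-, h'⟩ := Inst.W_ne_zero.1 (Ne.symm hne)
      rcases h' with h' | h' <;> exact hc (Inst.mem_colors (Finset.filter_subset _ _ h'))
  have rep₁ := rep.of_sameOff hs₁ (by decide)
  set c := I.lst e j with hc
  refine (does_for (k := I.m) (fun i s' => (∀ e < i, s' 5 e c = I.W e c) ∧
    ∀ e c', c' ≠ c → s' 5 e c' = s₁ 5 e c') (by decide) hm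
    (fun s' hs => (rep₁.of_sameOff hs (by decide)).eval_m)
    (fun i s' x h => by rwa [Mem.write_of_ne (by decide)]) ⟨by omega, fun _ _ _ => rfl⟩
    fun i hi s₂ hs₂ hi₂ hJ₂ => ?_).mono fun s' _ h => ⟨?_, ?_⟩
  · have rep₂ := rep₁.of_sameOff hs₂ (by decide)
    have h44 : s₂ 44 0 0 = c := by rw [hs₂ 44 (by decide), hc₁]
    have h6₂ : ∀ v < I.n, ∀ c, s₂ 6 v c = I.F v c := by
      rw [hs₂ 6 (by decide), hs₁ 6 (by decide)]; exact h6
    have h7₂ : ∀ v, s₂ 7 v 0 = I.deg v := by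
      rw [hs₂ 7 (by decide), hs₁ 7 (by decide)]; exact h7
    have hlt := I.ends_lt i hi
    have hassign : ∀ x, x = I.W i c → (fun s' : Mem => (∀ e < i + 1, s' 5 e c = I.W e c) ∧
        ∀ e c', c' ≠ c → s' 5 e c' = s₁ 5 e c') (s₂.write 5 i c x) := by
      intro x hx
      refine ⟨fun e he => ?_, fun e c' hc' => ?_⟩
      · rw [Mem.write_same]
        split_ifs with h
        · rw [hx, h.1]
        · exact hJ₂.1 e (by omega)
      · rw [Mem.write_same, if_neg (by tauto)]; exact hJ₂.2 e c' hc'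
    have hF0 : ∀ v, I.F v c ≠ 0 ↔ c ∈ I.common v := fun v => by
      have := I.K_pos
      unfold Inst.F
      split_ifs with h <;> simp [h]
      omega
    have hb : (Exp.and (shortE (.var 33)) (.add (.read 6 (endE (.var 33) (.lit 0)) (.var 44))
        (.read 6 (endE (.var 33) (.lit 1)) (.var 44)))).eval s₂ ≠ 0 ↔
        I.IsShort i ∧ (c ∈ I.common (I.ends i 0) ∨ c ∈ I.common (I.ends i 1)) := by
      rw [eval_and, rep₂.eval_short]
      simp only [eval, endE, rep₂.ends, hi₂, h44, h6₂ _ hlt.1, h6₂ _ hlt.2, ← hF0]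
      refine and_congr_right fun _ => ?_
      omega
    refine does_cond (fun h => does_assign ?_) (fun h => does_assign ?_)
    · have := hb.1 h
      simp only [eval, endE, cellE, rep₂.ends, hi₂, h44, h6₂ _ hlt.1, h6₂ _ hlt.2, h7₂]
      refine hassign _ ?_
      rw [Inst.W, if_pos this]; omega
    · simp only [eval, hi₂, h44]
      refine hassign _ ?_
      rw [Inst.W, if_neg]
      exact fun h' => hb.2 h' h
  · intro e' he' c' hc'
    by_cases hcc : c' = c
    · rw [hcc]; exact h.1 e' he'
    · rw [h.2 e' c' hcc]; exact hJ₁.1 e' he' c' (hc'.resolve_left hcc)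
  · intro e' c' hc'
    rw [Set.mem_insert_iff, not_or] at hc'
    rw [h.2 e' c' hc'.1]; exact hJ₁.2 e' c' hc'.2

/-- Gives the edge `31`, if it is uncolored, the color number `33` of its list, if this color is
free at both ends. -/
def tryP : Prog :=
  .cond (cellE 9 (.var 31)) .skip (.cond (.read 2 (.var 31) (.var 33))
    (.seq (findP 9 (endE (.var 31) (.lit 0)) (.read 2 (.var 31) (.var 33))) (.cond (.var 26) .skip
      (.seq (findP 9 (endE (.var 31) (.lit 1)) (.read 2 (.var 31) (.var 33))) (.cond (.var 26) .skip
        (.assign 9 (.var 31) (.lit 0) (.read 2 (.var 31) (.var 33))))))) .skip)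

theorem does_try (rep : Rep I s) (hm : I.m ≤ N) {i j : ℕ} (hi : s 31 0 0 = i) (hj : s 33 0 0 = j)
    (h : I.IsProper (row s 9)) :
    Does N tryP s fun s' => I.IsProper (row s' 9) ∧
      (∀ e < I.m, row s 9 e ≠ 0 → row s' 9 e ≠ 0) ∧
      (row s' 9 i ≠ 0 ∨ row s' 9 = row s 9 ∧
        (I.lst i j = 0 ∨ ∃ e < I.m, e ≠ i ∧ row s 9 e = I.lst i j)) := by
  have hskip : ∀ s', row s' 9 = row s 9 → (row s 9 i ≠ 0 ∨
      (I.lst i j = 0 ∨ ∃ e < I.m, e ≠ i ∧ row s 9 e = I.lst i j)) →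
      Does N .skip s' fun s' => I.IsProper (row s' 9) ∧
      (∀ e < I.m, row s 9 e ≠ 0 → row s' 9 e ≠ 0) ∧
      (row s' 9 i ≠ 0 ∨ row s' 9 = row s 9 ∧
        (I.lst i j = 0 ∨ ∃ e < I.m, e ≠ i ∧ row s 9 e = I.lst i j)) := by
    intro s' h1 h2
    apply does_skip
    rw [h1]
    exact ⟨h, fun _ _ h => h, h2.imp_right fun h => ⟨rfl, h⟩⟩
  have hcell : (cellE 9 (.var 31)).eval s = row s 9 i := by simp only [cellE, eval, hi, row]
  have hcol : ∀ s', SameOff [60, 61, 26, 27] s s' →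
      (Exp.read 2 (.var 31) (.var 33)).eval s' = I.lst i j := fun s' hs => by
    simp only [eval, hs 2 (by decide), hs 31 (by decide), hs 33 (by decide), rep.lst, hi, hj]
  unfold tryP
  refine does_cond (fun h1 => hskip s rfl (Or.inl (by rwa [hcell] at h1))) fun h1 => ?_
  rw [hcell] at h1
  refine does_cond (fun h2 => ?_) fun h2 => hskip s rfl (Or.inr (Or.inl
    (by rwa [hcol s .refl] at h2)))
  rw [hcol s .refl] at h2
  have hconf : ∀ v, I.find (row s 9) v (I.lst i j) ≠ 0 →
      ∃ e < I.m, e ≠ i ∧ row s 9 e = I.lst i j := by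
    intro v hv
    rw [Ne, Inst.find_eq_zero] at hv
    unfold Inst.Free at hv
    push Not at hv
    obtain ⟨e, he, -, heq⟩ := hv
    refine ⟨e, he, ?_, heq⟩
    rintro rfl
    exact h2 (heq.symm.trans h1)
  refine does_seq (does_find rep hm (by decide) (by simp [eval, Mem.write_of_ne]))
    fun s₁ hs₁ h26 => ?_
  have hs₁ := findP_sameOff hs₁
  rw [hcol s .refl, rep.eval_end] at h26
  simp only [eval, hi] at h26
  change s₁ 26 0 0 = I.find (row s 9) _ _ at h26
  have h9 : row s₁ 9 = row s 9 := row_congr (hs₁ 9 (by decide))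
  refine does_cond (fun h3 => hskip s₁ h9 (Or.inr (Or.inr (hconf _ (by rw [← h26]; exact h3)))))
    fun h3 => ?_
  change s₁ 26 0 0 = 0 at h3
  rw [h26, Inst.find_eq_zero] at h3
  have rep₁ := rep.of_sameOff hs₁ (by decide)
  refine does_seq (does_find rep₁ hm (by decide) (by simp [eval, Mem.write_of_ne]))
    fun s₂ hs₂ h26₂ => ?_
  have hs₂ := findP_sameOff hs₂
  have hs₁₂ : SameOff [60, 61, 26, 27] s s₂ := fun a ha => by rw [hs₂ a ha, hs₁ a ha]
  have h31 : s₁ 31 0 0 = i := by rw [hs₁ 31 (by decide), hi]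
  rw [hcol s₁ hs₁, rep₁.eval_end] at h26₂
  simp only [eval, h31] at h26₂
  have h92 : row s₂ 9 = row s 9 := row_congr (hs₁₂ 9 (by decide))
  have h26' : s₂ 26 0 0 = I.find (row s 9) (I.ends i 1) (I.lst i j) := by rw [h26₂, ← h9]; rfl
  refine does_cond (fun h4 => hskip s₂ h92 (Or.inr (Or.inr (hconf _ (by rw [← h26']; exact h4)))))
    fun h4 => does_assign ?_
  change s₂ 26 0 0 = 0 at h4
  rw [h26', Inst.find_eq_zero] at h4
  have h31₂ : s₂ 31 0 0 = i := by rw [hs₁₂ 31 (by decide), hi]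
  rw [hcol s₂ hs₁₂]
  simp only [eval, h31₂]
  rw [row_write_self, h92]
  refine ⟨h.update h1 h3 h4, fun e _ he => ?_, Or.inl (by rwa [Function.update_self])⟩
  rw [Function.update_of_ne]
  · exact he
  · rintro rfl; exact he h1

/-- Colors the remaining edges one after another with the first color that fits. -/
def greedyP : Prog := forP 31 mE (forP 33 mE tryP)

theorem does_greedy (rep : Rep I s) (hm : I.m ≤ N) (hl : I.ListsOk) (h : I.IsProper (row s 9))
    (hs : ∀ e < I.m, I.IsShort e → row s 9 e ≠ 0) :
    Does N greedyP s fun s' => I.IsProper (row s' 9) ∧ ∀ e < I.m, row s' 9 e ≠ 0 := by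
  unfold greedyP
  refine (does_for (k := I.m) (fun i s' => I.IsProper (row s' 9) ∧
    (∀ e < I.m, I.IsShort e → row s' 9 e ≠ 0) ∧ ∀ e < i, row s' 9 e ≠ 0) (by decide) hm
    (fun s' hs => (rep.of_sameOff hs (by decide)).eval_m)
    (fun i s' x h => by rwa [row_write (by decide)]) ⟨h, hs, by omega⟩
    fun i hi s₁ hs₁ hi₁ hJ₁ => ?_).mono fun s' _ h => ⟨h.1, h.2.2⟩
  have rep₁ := rep.of_sameOff hs₁ (by decide)
  refine (does_for (k := I.m) (fun j s' => I.IsProper (row s' 9) ∧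
    (∀ e < I.m, row s₁ 9 e ≠ 0 → row s' 9 e ≠ 0) ∧ (row s' 9 i ≠ 0 ∨
      ∀ j' < j, I.lst i j' = 0 ∨ ∃ e < I.m, e ≠ i ∧ row s' 9 e = I.lst i j')) (by decide) hm
    (fun s' hs => (rep₁.of_sameOff hs (by decide)).eval_m)
    (fun i s' x h => by rwa [row_write (by decide)])
    ⟨hJ₁.1, fun _ _ h => h, Or.inr (by omega)⟩
    fun j hj s₂ hs₂ hj₂ hJ₂ => ?_).mono fun s' _ ⟨h1, h2, h3⟩ =>
      ⟨h1, fun e he hs => h2 e he (hJ₁.2.1 e he hs), fun e he => ?_⟩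
  · have rep₂ := rep₁.of_sameOff hs₂ (by decide)
    have h31 : s₂ 31 0 0 = i := by rw [hs₂ 31 (by decide), hi₁]
    refine (does_try rep₂ hm h31 hj₂ hJ₂.1).mono fun s' _ ⟨h1, h2, h3⟩ =>
      ⟨h1, fun e he h => h2 e he (hJ₂.2.1 e he h), ?_⟩
    rcases h3 with h3 | ⟨h3, h4⟩
    · exact Or.inl h3
    rw [h3]
    refine hJ₂.2.2.imp_right fun h5 j' hj' => ?_
    rcases Nat.lt_succ_iff_lt_or_eq.1 hj' with hj' | rfl
    · exact h5 j' hj'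
    · exact h4
  · rcases Nat.lt_succ_iff_lt_or_eq.1 he with he | rfl
    · exact h2 e (by omega) (hJ₁.2.2 e he)
    · by_cases hsh : I.IsShort e
      · exact h2 e hi (hJ₁.2.1 e hi hsh)
      · exact hl.ne_zero_of_tried hi hsh h3

/-- Writes the coloring into the output array, undoing the shift of the colors. -/
def outputP : Prog := forP 31 mE (.assign 3 (.var 31) (.lit 0) (.sub (cellE 9 (.var 31)) (.lit 1)))

theorem does_output (rep : Rep I s) (hm : I.m ≤ N) :
    Does N outputP s fun s' => ∀ e < I.m, s' 3 e 0 = row s 9 e - 1 := by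
  unfold outputP
  refine does_for (k := I.m) (fun i s' => ∀ e < i, s' 3 e 0 = row s 9 e - 1) (by decide) hm
    (fun s' hs => (rep.of_sameOff hs (by decide)).eval_m)
    (fun i s' x h => by rwa [Mem.write_of_ne (by decide)]) (by omega)
    fun i hi s₁ hs₁ hi₁ hJ₁ => does_assign fun e he => ?_
  simp only [Mem.write_same, eval, hi₁, and_true, cellE]
  split_ifs with h
  · rw [h, hs₁ 9 (by decide)]; rfl
  · exact hJ₁ e (by omega)

/-- The algorithm: tables, local search for the short edges, greedy coloring of the others, output.
-/
def coloringP : Prog :=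
  .seq degP (.seq bonusP (.seq tableP (.seq weightP (.seq searchP (.seq greedyP outputP)))))

set_option maxRecDepth 20000 in
theorem does_coloring (rep : Rep I s) (hblank : ∀ a i j, 3 ≤ a → s a i j = 0) (hl : I.ListsOk)
    (hc : I.Shannon ∨ I.Vizing ∨ I.Konig) (hN : I.n + I.m + 2 ≤ N)
    (hB : I.scoreBound + 1 ≤ N) :
    Does N coloringP s fun s' => (∀ e < I.m, ∃ j, I.lst e j = s' 3 e 0 + 1) ∧
      ∀ e < I.m, ∀ e' < I.m, ∀ v, I.Inc e v → I.Inc e' v → e ≠ e' → s' 3 e 0 ≠ s' 3 e' 0 := by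
  have hm : I.m ≤ N := by omega
  have hn : I.n ≤ N := by omega
  unfold coloringP
  refine does_seq (does_deg rep hm fun v => hblank _ _ _ (by decide)) fun s₁ hs₁ h₁ => ?_
  have rep₁ := rep.of_sameOff hs₁ (by decide)
  refine does_seq (does_bonus rep₁ hm h₁) fun s₂ hs₂ h₂ => ?_
  have rep₂ := rep₁.of_sameOff hs₂ (by decide)
  have hblank₂ : ∀ a, a ∉ [7, 33, 10] → 3 ≤ a → ∀ i j, s₂ a i j = 0 := by
    intro a ha ha' i j
    simp only [List.mem_cons, not_or] at ha
    rw [hs₂ a (by simp [bonusP, forP, Prog.writes]; tauto),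
      hs₁ a (by simp [degP, incrP, forP, Prog.writes]; tauto), hblank a i j ha']
  refine does_seq (does_table rep₂ hm hn h₂ (hblank₂ 6 (by decide) (by decide)))
    fun s₃ hs₃ h₃ => ?_
  have rep₃ := rep₂.of_sameOff hs₃ (by decide)
  refine does_seq (does_weight rep₃ hm h₃
    (by rw [hs₃ 7 (by decide), hs₂ 7 (by decide)]; exact h₁)
    (by rw [hs₃ 5 (by decide)]; exact hblank₂ 5 (by decide) (by decide))) fun s₄ hs₄ env => ?_
  have hpart : ∀ a, a = 4 ∨ a = 9 → I.IsPartial (row s₄ a) := by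
    intro a ha
    have : row s₄ a = fun _ => 0 := by
      funext e
      unfold row
      rcases ha with rfl | rfl
      all_goals
        rw [hs₄ _ (by decide), hs₃ _ (by decide)]
        exact hblank₂ _ (by decide) (by decide) _ _
    rw [this]
    exact Inst.IsPartial.zero_coloring
  refine does_seq (does_search env hN hB (hpart 9 (by simp)) (hpart 4 (by simp)))
    fun s₅ hs₅ ⟨env₅, h₅, hmax⟩ => ?_
  refine does_seq (does_greedy env₅.toRep hm hl h₅.isProper fun e he hs =>
    hmax.ne_zero h₅ hc he hs) fun s₆ hs₆ ⟨h₆, hne⟩ => ?_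
  refine (does_output (env₅.toRep.of_sameOff hs₆ (by decide)) hm).mono fun s₇ _ h₇ => ⟨?_, ?_⟩
  · intro e he
    obtain ⟨j, hj⟩ := h₆.mem e he (hne e he)
    have := hne e he
    exact ⟨j, by rw [h₇ e he, hj]; omega⟩
  · intro e he e' he' v hv hv' hee heq
    rw [h₇ e he, h₇ e' he'] at heq
    have h1 := hne e he
    have h2 := hne e' he'
    exact hee (h₆.inj e he e' he' v hv hv' (by omega) h1)

end RAM

/-! ### Graphs and instances -/

open Graph

/-- The instance `I` is a copy of `(G, L)` under the numberings `f` of the vertices and `g` of the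
edges. -/
structure Inst.Models {α β : Type*} (I : Inst) (G : Graph α β) (L : β → Set ℕ) (f : ℕ → α)
    (g : ℕ → β) : Prop where
  vertexSet_eq : G.vertexSet = f '' Set.Iio I.n
  edgeSet_eq : G.edgeSet = g '' Set.Iio I.m
  inj_vertex : Set.InjOn f (Set.Iio I.n)
  inj_edge : Set.InjOn g (Set.Iio I.m)
  isLink : ∀ e < I.m, G.IsLink (g e) (f (I.ends e 0)) (f (I.ends e 1))
  listsSet : ∀ e < I.m, RAM.ListsSet (I.lst e) (L (g e))

namespace Inst.Models

variable {α β : Type*} {I : Inst} {G : Graph α β} {L : β → Set ℕ} {f : ℕ → α} {g : ℕ → β}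

theorem inc_iff (h : I.Models G L f g) {e v : ℕ} (he : e < I.m) (hv : v < I.n) :
    G.Inc (g e) (f v) ↔ I.Inc e v := by
  have hl := h.isLink e he
  have hlt := I.ends_lt e he
  constructor
  · intro hi
    exact (hi.eq_or_eq_of_isLink hl).imp (fun heq => h.inj_vertex hlt.1 hv heq.symm)
      (fun heq => h.inj_vertex hlt.2 hv heq.symm)
  · rintro (rfl | rfl)
    · exact hl.inc_left
    · exact hl.inc_right

theorem isLink_other (h : I.Models G L f g) {e v : ℕ} (he : e < I.m) (hi : I.Inc e v) :
    G.IsLink (g e) (f v) (f (I.other e v)) := by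
  have hl := h.isLink e he
  have hne := I.ends_ne e he
  rcases hi with hi | hi
  · rwa [← hi, show I.other e (I.ends e 0) = I.ends e 1 by unfold Inst.other; omega]
  · rw [← hi, show I.other e (I.ends e 1) = I.ends e 0 by unfold Inst.other; omega]
    exact hl.symm

theorem incidenceSet_eq (h : I.Models G L f g) {v : ℕ} (hv : v < I.n) :
    G.incidenceSet (f v) = g '' ((Finset.range I.m).filter fun e => I.Inc e v : Finset ℕ) := by
  ext b
  simp only [mem_incidenceSet, Finset.coe_filter, Finset.mem_range, Set.mem_image,
    Set.mem_ofPred_eq]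
  constructor
  · intro hi
    have hb := hi.edge_mem
    rw [h.edgeSet_eq] at hb
    obtain ⟨e, he, rfl⟩ := hb
    exact ⟨e, ⟨he, (h.inc_iff he hv).1 hi⟩, rfl⟩
  · rintro ⟨e, ⟨he, hi⟩, rfl⟩
    exact (h.inc_iff he hv).2 hi

theorem ncard_image (h : I.Models G L f g) {A : Finset ℕ} (hA : ∀ e ∈ A, e < I.m) :
    (g '' (A : Set ℕ)).ncard = A.card := by
  rw [Set.InjOn.ncard_image (h.inj_edge.mono fun e he => hA e he), Set.ncard_coe_finset]

theorem deg_eq (h : I.Models G L f g) {v : ℕ} (hv : v < I.n) : G.deg (f v) = I.deg v := by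
  unfold Graph.deg Inst.deg
  rw [h.incidenceSet_eq hv, h.ncard_image (by simp +contextual)]

theorem mult_eq (h : I.Models G L f g) {v w : ℕ} (hv : v < I.n) (hw : w < I.n) (hvw : v ≠ w) :
    G.mult (f v) (f w) = I.mult v w := by
  unfold Graph.mult Inst.mult
  rw [← h.ncard_image (by simp +contextual)]
  congr 1
  ext b
  simp only [Finset.coe_filter, Finset.mem_range, Set.mem_image, Set.mem_ofPred_eq]
  constructor
  · intro hl
    have hb := hl.edge_mem
    rw [h.edgeSet_eq] at hb
    obtain ⟨e, he, rfl⟩ := hb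
    exact ⟨e, ⟨he, (h.inc_iff he hv).1 hl.inc_left, (h.inc_iff he hw).1 hl.inc_right⟩, rfl⟩
  · rintro ⟨e, ⟨he, hi, hi'⟩, rfl⟩
    have := h.isLink_other he hi
    rwa [Inst.other_eq hi hi' hvw] at this

theorem finite_edgeSet (h : I.Models G L f g) : G.edgeSet.Finite := by
  rw [h.edgeSet_eq]; exact (Set.finite_Iio _).image g

theorem deg_le_maxDeg (h : I.Models G L f g) (x : α) : G.deg x ≤ G.maxDeg := by
  refine le_ciSup (f := fun x => G.deg x) ⟨G.edgeSet.ncard, ?_⟩ x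
  rintro _ ⟨x, rfl⟩
  exact Set.ncard_le_ncard (G.incidenceSet_subset_edgeSet x) h.finite_edgeSet

theorem mult_le_localMult (h : I.Models G L f g) (x y : α) : G.mult x y ≤ G.localMult x := by
  refine le_ciSup (f := fun y => G.mult x y) ⟨G.edgeSet.ncard, ?_⟩ y
  rintro _ ⟨y, rfl⟩
  exact Set.ncard_le_ncard (fun e he => IsLink.edge_mem he) h.finite_edgeSet

/-- Each edge is counted at its first end. -/
theorem card_edges_le (h : I.Models G L f g) : I.m ≤ I.n * G.maxDeg := by
  have hsub : Finset.range I.m ⊆ (Finset.range I.n).biUnion fun v =>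
      (Finset.range I.m).filter fun e => I.Inc e v := by
    intro e he
    have hem := Finset.mem_range.1 he
    exact Finset.mem_biUnion.2 ⟨I.ends e 0, Finset.mem_range.2 (I.ends_lt e hem).1,
      Finset.mem_filter.2 ⟨he, Or.inl rfl⟩⟩
  have h1 := (Finset.card_le_card hsub).trans (Finset.card_biUnion_le_card_mul _ _ G.maxDeg
    fun v hv => (h.deg_eq (Finset.mem_range.1 hv)).symm.le.trans (h.deg_le_maxDeg _))
  simpa using h1

theorem listsOk (h : I.Models G L f g) : I.ListsOk :=
  ⟨fun e he => (h.listsSet e he).nodup, fun e he => (h.listsSet e he).zero_of_le⟩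

/-- At a vertex with a short edge the common colors occur among the first `m` entries of the list of
this edge, so that they are finite in number and all belong to `I.common v`. -/
theorem le_card_common (h : I.Models G L f g) {v k : ℕ} (hv : I.Active v)
    (hk : (k : ℕ∞) ≤ (G.commonColors L (f v)).encard) : k ≤ (I.common v).card := by
  obtain ⟨e₀, he₀, hi₀, hs₀⟩ := hv
  have hvn := inc_lt he₀ hi₀
  have key : ∀ c ∈ G.commonColors L (f v), ∀ e < I.m, I.Inc e v → I.IsShort e →
      ∃ j < I.m, I.lst e j = c + 1 := by
    intro c hc e he hi hs
    have hcL : c ∈ L (g e) := Set.mem_iInter₂.1 hc (g e) ((h.inc_iff he hvn).2 hi)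
    obtain ⟨j, hj⟩ := ((h.listsSet e he).mem_iff c).1 hcL
    refine ⟨j, ?_, hj⟩
    by_contra hjm
    have := (h.listsSet e he).zero_of_le (I.m - 1) j (by omega) hs
    omega
  have hsub : Nat.succ '' G.commonColors L (f v) ⊆ (I.common v : Set ℕ) := by
    rintro _ ⟨c, hc, rfl⟩
    obtain ⟨j, hj, heq⟩ := key c hc e₀ he₀ hi₀ hs₀
    refine Finset.mem_coe.2 (Finset.mem_filter.2
      ⟨mem_palette.2 ⟨Nat.succ_ne_zero c, e₀, he₀, j, hj, heq⟩, key c hc⟩)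
  have h1 := Set.encard_le_encard hsub
  rw [Nat.succ_injective.injOn.encard_image, Set.encard_coe_eq_coe_finsetCard] at h1
  exact_mod_cast hk.trans h1

theorem vertex_mem (h : I.Models G L f g) {v : ℕ} (hv : v < I.n) : f v ∈ G.vertexSet := by
  rw [h.vertexSet_eq]; exact ⟨v, hv, rfl⟩

theorem active_lt {v : ℕ} (hv : I.Active v) : v < I.n := by
  obtain ⟨e, he, hi, -⟩ := hv
  exact inc_lt he hi

theorem shannon (h : I.Models G L f g) (hG : G.ShannonCondition L) : I.Shannon := by
  intro v hv
  have hvn := active_lt hv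
  refine h.le_card_common hv ?_
  rw [← h.deg_eq hvn]
  exact hG _ (h.vertex_mem hvn)

theorem vizing (h : I.Models G L f g) (hG : G.VizingCondition L) : I.Vizing := by
  intro v w hvw hv
  have hvn := active_lt hv
  refine h.le_card_common hv (le_trans ?_ (hG _ (h.vertex_mem hvn)))
  rw [← h.deg_eq hvn]
  refine Nat.cast_le.2 (Nat.add_le_add_left ?_ _)
  by_cases hw : w < I.n
  · rw [← h.mult_eq hvn hw hvw]
    exact h.mult_le_localMult _ _
  · have : I.mult v w = 0 := by
      refine Finset.card_eq_zero.2 (Finset.filter_eq_empty_iff.2 fun e he hi => hw ?_)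
      exact inc_lt (Finset.mem_range.1 he) hi.2
    omega

theorem konig (h : I.Models G L f g) (hG : G.KonigCondition L) : I.Konig := by
  obtain ⟨⟨A, hA⟩, hG⟩ := hG
  refine ⟨⟨f ⁻¹' A, fun e he v hi => hA (g e) _ _ (h.isLink_other he hi)⟩, fun v hv => ?_⟩
  have hvn := active_lt hv
  refine h.le_card_common hv ?_
  rw [← h.deg_eq hvn]
  exact hG _ (h.vertex_mem hvn)

theorem isProperListColoring (h : I.Models G L f g) {φ : β → ℕ}
    (h1 : ∀ e < I.m, ∃ j, I.lst e j = φ (g e) + 1)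
    (h2 : ∀ e < I.m, ∀ e' < I.m, ∀ v, I.Inc e v → I.Inc e' v → e ≠ e' → φ (g e) ≠ φ (g e')) :
    G.IsProperListColoring L φ := by
  constructor
  · intro b hb
    rw [h.edgeSet_eq] at hb
    obtain ⟨e, he, rfl⟩ := hb
    exact ((h.listsSet e he).mem_iff _).2 (h1 e he)
  · intro b b' x hne hi hi'
    have hb := hi.edge_mem
    have hb' := hi'.edge_mem
    have hx := hi.vertex_mem
    rw [h.edgeSet_eq] at hb hb'
    rw [h.vertexSet_eq] at hx
    obtain ⟨e, he, rfl⟩ := hb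
    obtain ⟨e', he', rfl⟩ := hb'
    obtain ⟨v, hv, rfl⟩ := hx
    exact h2 e he e' he' v ((h.inc_iff he hv).1 hi) ((h.inc_iff he' hv).1 hi')
      fun heq => hne (congrArg g heq)

end Inst.Models

namespace RAM

theorem exists_listsSet (S : Set ℕ) : ∃ r, ListsSet r S := by
  classical
  set p : ℕ → Prop := fun c => c ∈ S
  set ok : ℕ → Prop := fun j => ∀ hf : (Set.ofPred p).Finite, j < hf.toFinset.card with hok
  have hnth : ∀ i j, ok i → ok j → Nat.nth p i = Nat.nth p j → i = j := by
    intro i j hi hj heq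
    rcases lt_trichotomy i j with hlt | rfl | hlt
    · exact absurd heq (Nat.nth_lt_nth' hlt hj).ne
    · rfl
    · exact absurd heq (Nat.nth_lt_nth' hlt hi).ne'
  refine ⟨fun j => if ok j then Nat.nth p j + 1 else 0, fun c => ⟨fun hc => ?_, ?_⟩, ?_, ?_⟩
  · obtain ⟨j, hj, heq⟩ := Nat.exists_lt_card_nth_eq (p := p) hc
    exact ⟨j, by rw [if_pos hj, heq]⟩
  · rintro ⟨j, hj⟩
    split_ifs at hj with h
    obtain rfl : Nat.nth p j = c := by omega
    exact Nat.nth_mem j h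
  · intro i j hi heq

    split_ifs at hi heq with h h'
    · exact hnth i j h h' (by omega)
    · simp at hi
  · intro i j hij hi

    split_ifs at hi with h
    exact if_neg fun h' => h fun hf => lt_of_le_of_lt hij (h' hf)

end RAM

theorem Set.Finite.exists_injOn_image_Iio {γ : Type*} [Nonempty γ] {S : Set γ} (hS : S.Finite) :
    ∃ (n : ℕ) (f : ℕ → γ), Set.InjOn f (Set.Iio n) ∧ S = f '' Set.Iio n := by
  obtain ⟨n, f, rfl⟩ := hS.fin_embedding
  refine ⟨n, fun i => if h : i < n then f ⟨i, h⟩ else Classical.arbitrary γ, ?_, ?_⟩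
  · intro i hi j hj heq
    simp only [Set.mem_Iio] at hi hj
    simpa [hi, hj] using heq
  · ext x
    constructor
    · rintro ⟨i, rfl⟩
      exact ⟨i, i.2, by simp⟩
    · rintro ⟨i, hi, rfl⟩
      simp only [Set.mem_Iio] at hi
      exact ⟨⟨i, hi⟩, by simp [hi]⟩

theorem Inst.exists_models {α β : Type*} (G : Graph α β) (L : β → Set ℕ) (hG : G.Loopless)
    (hV : G.vertexSet.Finite) (hE : G.edgeSet.Finite) (hne : G.edgeSet.Nonempty) :
    ∃ I f g, Inst.Models I G L f g := by
  obtain ⟨b, hb⟩ := hne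
  obtain ⟨x, y, hxy⟩ := G.exists_isLink_of_mem_edgeSet hb
  have : Nonempty α := ⟨x⟩
  have : Nonempty β := ⟨b⟩
  obtain ⟨n, f, hf, hfV⟩ := hV.exists_injOn_image_Iio
  obtain ⟨m, g, hg, hgE⟩ := hE.exists_injOn_image_Iio
  have hends : ∀ e, ∃ u w, e < m → u < n ∧ w < n ∧ G.IsLink (g e) (f u) (f w) := by
    intro e
    by_cases he : e < m
    · obtain ⟨x, y, h⟩ := G.exists_isLink_of_mem_edgeSet (e := g e)
        (by rw [hgE]; exact ⟨e, he, rfl⟩)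
      have hx := h.left_mem
      have hy := h.right_mem
      rw [hfV] at hx hy
      obtain ⟨u, hu, rfl⟩ := hx
      obtain ⟨w, hw, rfl⟩ := hy
      exact ⟨u, w, fun _ => ⟨hu, hw, h⟩⟩
    · exact ⟨0, 0, fun h => absurd h he⟩
  choose u w huw using hends
  choose r hr using fun e => RAM.exists_listsSet (L (g e))
  refine ⟨⟨n, m, fun e o => if o = 0 then u e else w e, r, fun e he => ?_, fun e he => ?_⟩, f, g,
    hfV, hgE, hf, hg, fun e he => ?_, fun e _ => hr e⟩
  · simpa using ⟨(huw e he).1, (huw e he).2.1⟩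
  · simp only [if_true]
    intro heq
    have := (huw e he).2.2.ne
    rw [if_neg one_ne_zero] at heq
    exact this (congrArg f heq)
  · simpa using (huw e he).2.2

namespace RAM

/-- A memory that holds the instance as an input. -/
def inputMem (I : Inst) : Mem
  | 0, _, j => if j = 0 then I.n else I.m
  | 1, i, j => I.ends i j
  | 2, i, j => I.lst i j
  | _, _, _ => 0

/-- The colorings exist because the algorithm finds them; the graph may be replaced by a numbered copy. -/
theorem exists_coloring {α β : Type*} (G : Graph α β) (L : β → Set ℕ) (hG : G.Loopless)
    (hV : G.vertexSet.Finite) (hE : G.edgeSet.Finite)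
    (h : G.ShannonCondition L ∨ G.VizingCondition L ∨ G.KonigCondition L) :
    ∃ φ : β → ℕ, G.IsProperListColoring L φ := by
  rcases G.edgeSet.eq_empty_or_nonempty with h0 | hne
  · refine ⟨fun _ => 0, fun e he => ?_, fun e e' x _ hi => ?_⟩
    · rw [h0] at he; exact he.elim
    · have := hi.edge_mem
      rw [h0] at this; exact this.elim
  obtain ⟨I, f, g, hI⟩ := Inst.exists_models G L hG hV hE hne
  obtain ⟨t, s', -, -, h1, h2⟩ := does_coloring (I := I) (s := inputMem I)
    (N := I.n + I.m + 2 + (I.scoreBound + 1)) ⟨rfl, rfl, rfl, rfl⟩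
    (fun a i j ha => by obtain ⟨k, rfl⟩ := Nat.exists_eq_add_of_le' ha; rfl) hI.listsOk
    (h.imp hI.shannon (Or.imp hI.vizing hI.konig)) (by omega) (by omega)
  have hinv : ∀ e < I.m, Function.invFunOn g (Set.Iio I.m) (g e) = e := fun e he =>
    hI.inj_edge.leftInvOn_invFunOn he
  refine ⟨fun b => s' 3 (Function.invFunOn g (Set.Iio I.m) b) 0,
    hI.isProperListColoring (fun e he => ?_) fun e he e' he' v hi hi' hee => ?_⟩
  · rw [hinv e he]; exact h1 e he
  · rw [hinv e he, hinv e' he']; exact h2 e he e' he' v hi hi' hee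

theorem Encodes.exists_models {s : Mem} {n m : ℕ} {G : Graph ℕ ℕ} {L : ℕ → Set ℕ}
    (h : Encodes s n m G L) (hG : G.Loopless) :
    ∃ I : Inst, Rep I s ∧ I.n = n ∧ I.Models G L id id := by
  refine ⟨⟨n, m, s 1, s 2, fun e he => ?_, fun e he => (h.ends e he).ne⟩,
    ⟨h.card_vertices, h.card_edges, rfl, rfl⟩, rfl, ⟨?_, ?_, Function.injective_id.injOn,
      Function.injective_id.injOn, h.ends, h.lists⟩⟩
  · have h1 := (h.ends e he).left_mem
    have h2 := (h.ends e he).right_mem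
    rw [h.vertexSet_eq] at h1 h2
    exact ⟨h1, h2⟩
  · simpa using h.vertexSet_eq
  · simpa using h.edgeSet_eq

/-- A polynomial in `Δ` (the variable `0`) and `n` (the variable `1`) that bounds the number of
times any loop of the algorithm is executed. The number of edges has been replaced by its bound `n *
Δ`. -/
noncomputable def boundPoly : MvPolynomial (Fin 2) ℕ :=
  let M := MvPolynomial.X 1 * MvPolynomial.X 0
  MvPolynomial.X 1 + M + 2 + (M * (2 * (1 + 2 * M * M) + 2 * M) + 1)

/-- One program serves all three conditions. The bound on the sizes of the common sets plays no role:
only the first `m` colors of each list are ever read. -/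
theorem polyTimeColoring {H : Graph ℕ ℕ → (ℕ → Set ℕ) → Prop}
    (hH : ∀ G L, H G L → G.ShannonCondition L ∨ G.VizingCondition L ∨ G.KonigCondition L) :
    PolyTimeColoring H := by
  obtain ⟨q, hq⟩ := coloringP.exists_polynomial_time
  refine ⟨coloringP, fun _ => ⟨q.eval₂ MvPolynomial.C boundPoly, ?_⟩⟩
  intro n m G L s hG hs hGL _
  obtain ⟨I, rep, rfl, hI⟩ := hs.exists_models hG
  set x : Fin 2 → ℕ := ![G.maxDeg, I.n] with hx
  have hm := hI.card_edges_le
  have hB : MvPolynomial.eval x boundPoly = I.n + I.n * G.maxDeg + 2 + (I.n * G.maxDeg *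
      (2 * (1 + 2 * (I.n * G.maxDeg) * (I.n * G.maxDeg)) + 2 * (I.n * G.maxDeg)) + 1) := by
    simp [boundPoly, hx]
  have hscore : I.scoreBound ≤ I.n * G.maxDeg *
      (2 * (1 + 2 * (I.n * G.maxDeg) * (I.n * G.maxDeg)) + 2 * (I.n * G.maxDeg)) := by
    unfold Inst.scoreBound; gcongr
  obtain ⟨t, s', hr, ht, h1, h2⟩ := does_coloring (N := MvPolynomial.eval x boundPoly) rep
    hs.blank hI.listsOk ((hH G L hGL).imp hI.shannon (Or.imp hI.vizing hI.konig))
    (by omega) (by omega)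
  refine ⟨t, s', hr, ht.trans_eq ?_, hI.isProperListColoring h1 h2⟩
  rw [hq, Polynomial.hom_eval₂, Subsingleton.elim ((MvPolynomial.eval x).comp MvPolynomial.C)
    (RingHom.id ℕ), Polynomial.eval₂_id]

end RAM

theorem theorem1p3 :
    (∀ {α : Type*} {β : Type*} (G : Graph α β) (L : β → Set ℕ),
      G.Loopless → G.vertexSet.Finite → G.edgeSet.Finite →
        (G.ShannonCondition L → ∃ φ : β → ℕ, G.IsProperListColoring L φ) ∧
        (G.VizingCondition L → ∃ φ : β → ℕ, G.IsProperListColoring L φ) ∧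
        (G.KonigCondition L → ∃ φ : β → ℕ, G.IsProperListColoring L φ)) ∧
    RAM.PolyTimeColoring (fun G L => G.ShannonCondition L) ∧
    RAM.PolyTimeColoring (fun G L => G.VizingCondition L) ∧
    RAM.PolyTimeColoring (fun G L => G.KonigCondition L) := by
  refine ⟨fun G L hG hV hE => ⟨fun h => ?_, fun h => ?_, fun h => ?_⟩, ?_, ?_, ?_⟩
  · exact RAM.exists_coloring G L hG hV hE (Or.inl h)
  · exact RAM.exists_coloring G L hG hV hE (Or.inr (Or.inl h))
  · exact RAM.exists_coloring G L hG hV hE (Or.inr (Or.inr h))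
  · exact RAM.polyTimeColoring fun _ _ h => Or.inl h
  · exact RAM.polyTimeColoring fun _ _ h => Or.inr (Or.inl h)
  · exact RAM.polyTimeColoring fun _ _ h => Or.inr (Or.inr h)
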